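/- Let $(M,g)$ be a finite-dimensional smooth ($C^\infty$) Riemannian manifold (Hausdorff, second countable) with Levi-Civita connection $\nabla$ and curvature $R(X,Y)=[\nabla_X,\nabla_Y]-\nabla_{[X,Y]}$, and let $f\in C^\infty(M)$ with $f>0$. Let $\pi:T^1_1(M)\to M$ be the bundle of $(1,1)$ tensors, with induced coordinates $(x^j,t^i_j)$. For a vector field $X$ and a $(1,1)$ tensor field $A$ on $M$, the vertical and horizontal lifts to $T^1_1(M)$ are given in these coordinates by $${}^VA=(0,\;A^i_j),\qquad {}^HX=\bigl(X^j,\;X^s(\Gamma^m_{sj}t^i_m-\Gamma^i_{sm}t^m_j)\bigr).$$ Put $G(A,B)=g_{it}g^{jl}A^i_jB^t_l$. Then there is exactly one smooth Riemannian metric ${}^Sg_f$ on $T^1_1(M)$ (the rescaled Sasaki type metric) with $${}^Sg_f({}^VA,{}^VB)=G(A,B)\circ\pi,\quad {}^Sg_f({}^VA,{}^HY)=0,\quad {}^Sg_f({}^HX,{}^HY)=(f\,g(X,Y))\circ\pi .$$ Let $\widetilde\nabla$ be its Levi-Civita connection, let $J$ be the almost product structure on $T^1_1(M)$ with $J({}^HX)=-{}^HX$,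 $J({}^VA)={}^VA$, and put $$\widetilde S(\widetilde X,\widetilde Y)=\tfrac12\{(\widetilde\nabla_{J\widetilde Y}J)\widetilde X+J((\widetilde\nabla_{\widetilde Y}J)\widetilde X)-J((\widetilde\nabla_{\widetilde X}J)\widetilde Y)\},\qquad {}^{(P)}\widetilde\nabla_{\widetilde X}\widetilde Y=\widetilde\nabla_{\widetilde X}\widetilde Y-\widetilde S(\widetilde X,\widetilde Y).$$ Then ${}^{(P)}\widetilde\nabla$ is an almost product connection, i.e. ${}^{(P)}\widetilde\nabla J=0$, and for all smooth vector fields $X,Y$ and smooth $(1,1)$ tensor fields $B,C$ on $M$, at every point $t\in T^1_1(M)$ and with $f$ evaluated at $\pi(t)$, i) ${}^{(P)}\widetilde\nabla_{{}^HX}{}^HY={}^H\bigl(\nabla_XY+\tfrac1{2f}\,{}^fA(X,Y)\bigr)$, where ${}^fA(X,Y)=X(f)Y+Y(f)X-g(X,Y)\,\mathrm{grad}_g f$; ii) ${}^{(P)}\widetilde\nabla_{{}^HX}{}^VB={}^V(\nabla_XB)$; iii) ${}^{(P)}\widetilde\nabla_{{}^VC}{}^HY=\tfrac3{2f}\,{}^H\bigl(g^{bl}R(t\,\partial_b,C\,\partial_l)Y+W\bigr)$,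 where $W$ is the vector with $g(W,Z)=g^{bl}g\bigl(t(R(Z,Y)\partial_b),C\,\partial_l\bigr)$ for all tangent vectors $Z$, the tensors $t$ and $C$ being regarded as endomorphisms of the tangent space; iv) ${}^{(P)}\widetilde\nabla_{{}^VC}{}^VB=0$. Moreover, ${}^{(P)}\widetilde\nabla$ is symmetric (torsion-free) if and only if $(M,g)$ is flat, i.e. $R=0$. -/

import Mathlib

open Bundle FiberBundle VectorField
open scoped Manifold ContDiff

set_option linter.unusedSectionVars false

noncomputable section

namespace TensorBundle

/-! ### Riemannian geometry on a manifold -/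

section General

variable {E : Type*} [NormedAddCommGroup E] [NormedSpace ℝ E] [FiniteDimensional ℝ E]
  {H : Type*} [TopologicalSpace H] {I : ModelWithCorners ℝ E H}
  {M : Type*} [TopologicalSpace M] [ChartedSpace H M]

instance tangentSpace_finiteDimensional (x : M) : FiniteDimensional ℝ (TangentSpace I x) :=
  inferInstanceAs (FiniteDimensional ℝ E)

instance tangentSpace_t2Space (x : M) : T2Space (TangentSpace I x) :=
  inferInstanceAs (T2Space E)

variable (I) in
/-- The basis `(∂ᵢ)` of the tangent space at `x` in the preferred chart at `x`. -/
def coordBasis (x : M) : Module.Basis (Fin (Module.finrank ℝ E)) ℝ (TangentSpace I x) :=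
  Module.finBasis ℝ E

/-- The linear map which agrees with `c` on the coordinate basis; it is `c` itself, as a continuous
linear map, when `c` is linear. -/
def extendLinear {F : Type*} [AddCommGroup F] [Module ℝ F] [TopologicalSpace F]
    [IsTopologicalAddGroup F] [ContinuousSMul ℝ F] (x : M)
    (c : TangentSpace I x → F) : TangentSpace I x →L[ℝ] F :=
  LinearMap.toContinuousLinearMap ((coordBasis I x).constr ℝ (fun i ↦ c (coordBasis I x i)))

variable [IsManifold I ∞ M]

/-- Smooth Riemannian metrics on `M`. -/
abbrev SmoothMetric (I : ModelWithCorners ℝ E H) (M : Type*) [TopologicalSpace M] [ChartedSpace H M]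
    [IsManifold I ∞ M] :=
  ContMDiffRiemannianMetric I ∞ E (TangentSpace I : M → Type _)

lemma flat_injective (g : SmoothMetric I M) (x : M) : Function.Injective (g.inner x) := by
  rw [injective_iff_map_eq_zero]
  intro v hv
  by_contra h
  have := g.pos x v h
  rw [hv] at this
  simp at this

lemma flat_bijective (g : SmoothMetric I M) (x : M) : Function.Bijective (g.inner x) := by
  refine ⟨flat_injective g x, ?_⟩
  have h : Module.finrank ℝ (TangentSpace I x) =
      Module.finrank ℝ (TangentSpace I x →L[ℝ] ℝ) := by
    rw [← (LinearMap.toContinuousLinearMap (𝕜 := ℝ) (E := TangentSpace I x) (F' := ℝ)).finrank_eq]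
    exact (Subspace.dual_finrank_eq (K := ℝ) (V := TangentSpace I x)).symm
  have : FiniteDimensional ℝ (TangentSpace I x →L[ℝ] ℝ) :=
    Module.Finite.equiv (LinearMap.toContinuousLinearMap (𝕜 := ℝ) (E := TangentSpace I x) (F' := ℝ))
  exact (LinearMap.injective_iff_surjective_of_finrank_eq_finrank
    (f := (g.inner x).toLinearMap) h).1 (flat_injective g x)

/-- The musical isomorphism `T*ₓM → TₓM`. -/
def sharp (g : SmoothMetric I M) (x : M) : (TangentSpace I x →L[ℝ] ℝ) →ₗ[ℝ] TangentSpace I x :=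
  (LinearEquiv.ofBijective (g.inner x).toLinearMap (flat_bijective g x)).symm.toLinearMap

lemma inner_sharp (g : SmoothMetric I M) (x : M) (α : TangentSpace I x →L[ℝ] ℝ) :
    g.inner x (sharp g x α) = α :=
  (LinearEquiv.ofBijective (g.inner x).toLinearMap (flat_bijective g x)).apply_symm_apply α

lemma mdifferentiableAt_inner (g : SmoothMetric I M) {X Y : Π x : M, TangentSpace I x} {x : M}
    (hX : MDiffAt (T% X) x) (hY : MDiffAt (T% Y) x) :
    MDiffAt (fun y ↦ g.inner y (X y) (Y y)) x := by
  have h : MDifferentiableAt I (I.prod 𝓘(ℝ))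
      (fun y ↦ TotalSpace.mk' ℝ (E := Bundle.Trivial M ℝ) y (g.inner y (X y) (Y y))) x := by
    apply MDifferentiableAt.clm_bundle_apply₂ (F₁ := E) (F₂ := E)
    · exact g.contMDiff.mdifferentiableAt (by simp)
    · exact hX
    · exact hY
  rw [mdifferentiableAt_totalSpace] at h
  exact h.2

/-- The right-hand side of the Koszul formula for `2 g(∇_X Y, Z)`. -/
def koszul (g : SmoothMetric I M) (X Y Z : Π x : M, TangentSpace I x) (x : M) : ℝ :=
  mvfderiv I (fun y ↦ g.inner y (Y y) (Z y)) x (X x)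
    + mvfderiv I (fun y ↦ g.inner y (Z y) (X y)) x (Y x)
    - mvfderiv I (fun y ↦ g.inner y (X y) (Y y)) x (Z x)
    - g.inner x (X x) (mlieBracket I Y Z x)
    + g.inner x (Y x) (mlieBracket I Z X x)
    + g.inner x (Z x) (mlieBracket I X Y x)

lemma koszul_tensorial_left (g : SmoothMetric I M) {Y Z : Π x : M, TangentSpace I x} {x : M}
    (hY : MDiffAt (T% Y) x) (hZ : MDiffAt (T% Z) x) :
    TensorialAt I E (fun X ↦ koszul g X Y Z x) x where
  smul {f X} hf hX := by
    have h1 := mdifferentiableAt_inner g hZ hX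
    have h2 := mdifferentiableAt_inner g hX hY
    simp [koszul, mvfderiv_fun_mul hf h1, mvfderiv_fun_mul hf h2,
      mlieBracket_smul_left hf hX, mlieBracket_smul_right hf hX]
    rw [g.symm x (Z x) (X x), g.symm x (Y x) (X x)]
    ring
  add {X X'} hX hX' := by
    have h1 := mdifferentiableAt_inner g hZ hX
    have h2 := mdifferentiableAt_inner g hX hY
    have h1' := mdifferentiableAt_inner g hZ hX'
    have h2' := mdifferentiableAt_inner g hX' hY
    simp [koszul, mvfderiv_fun_add h1 h1', mvfderiv_fun_add h2 h2',
      mlieBracket_add_left hX hX', mlieBracket_add_right hX hX']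
    ring

lemma koszul_tensorial_right (g : SmoothMetric I M) {X Y : Π x : M, TangentSpace I x} {x : M}
    (hX : MDiffAt (T% X) x) (hY : MDiffAt (T% Y) x) :
    TensorialAt I E (fun Z ↦ koszul g X Y Z x) x where
  smul {f Z} hf hZ := by
    have h1 := mdifferentiableAt_inner g hY hZ
    have h2 := mdifferentiableAt_inner g hZ hX
    simp [koszul, mvfderiv_fun_mul hf h1, mvfderiv_fun_mul hf h2,
      mlieBracket_smul_left hf hZ, mlieBracket_smul_right hf hZ]
    rw [g.symm x (X x) (Z x), g.symm x (Y x) (Z x)]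
    ring
  add {Z Z'} hZ hZ' := by
    have h1 := mdifferentiableAt_inner g hY hZ
    have h2 := mdifferentiableAt_inner g hZ hX
    have h1' := mdifferentiableAt_inner g hY hZ'
    have h2' := mdifferentiableAt_inner g hZ' hX
    simp [koszul, mvfderiv_fun_add h1 h1', mvfderiv_fun_add h2 h2',
      mlieBracket_add_left hZ hZ', mlieBracket_add_right hZ hZ']
    ring

lemma koszul_add_middle (g : SmoothMetric I M) {X Y Y' Z : Π x : M, TangentSpace I x} {x : M}
    (hX : MDiffAt (T% X) x) (hY : MDiffAt (T% Y) x) (hY' : MDiffAt (T% Y') x)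
    (hZ : MDiffAt (T% Z) x) :
    koszul g X (Y + Y') Z x = koszul g X Y Z x + koszul g X Y' Z x := by
  have h1 := mdifferentiableAt_inner g hY hZ
  have h2 := mdifferentiableAt_inner g hX hY
  have h1' := mdifferentiableAt_inner g hY' hZ
  have h2' := mdifferentiableAt_inner g hX hY'
  simp [koszul, mvfderiv_fun_add h1 h1', mvfderiv_fun_add h2 h2',
    mlieBracket_add_left hY hY', mlieBracket_add_right hY hY']
  ring

lemma koszul_smul_middle (g : SmoothMetric I M) {X Y Z : Π x : M, TangentSpace I x} {f : M → ℝ} {x : M}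
    (hX : MDiffAt (T% X) x) (hY : MDiffAt (T% Y) x) (hZ : MDiffAt (T% Z) x) (hf : MDiffAt f x) :
    koszul g X (f • Y) Z x =
      f x * koszul g X Y Z x + 2 * mvfderiv I f x (X x) * g.inner x (Y x) (Z x) := by
  have h1 := mdifferentiableAt_inner g hY hZ
  have h2 := mdifferentiableAt_inner g hX hY
  simp [koszul, mvfderiv_fun_mul hf h1, mvfderiv_fun_mul hf h2,
    mlieBracket_smul_left hf hY, mlieBracket_smul_right hf hY]
  rw [g.symm x (Z x) (Y x), g.symm x (X x) (Y x)]
  ring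

/-- The Koszul expression as a bilinear form in the arguments `X` and `Z` at the point `x`. -/
def koszulForm (g : SmoothMetric I M) (Y : Π x : M, TangentSpace I x) (x : M) (hY : MDiffAt (T% Y) x) :
    TangentSpace I x →L[ℝ] TangentSpace I x →L[ℝ] ℝ :=
  TensorialAt.mkHom₂ (fun X Z ↦ koszul g X Y Z x) x
    (fun _ hZ ↦ koszul_tensorial_left g hY hZ) (fun _ hX ↦ koszul_tensorial_right g hX hY)

lemma koszulForm_apply (g : SmoothMetric I M) {X Y Z : Π x : M, TangentSpace I x} {x : M}
    (hX : MDiffAt (T% X) x) (hY : MDiffAt (T% Y) x) (hZ : MDiffAt (T% Z) x) :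
    koszulForm g Y x hY (X x) (Z x) = koszul g X Y Z x :=
  TensorialAt.mkHom₂_apply _ _ hX hZ

open Classical in
/-- The operator underlying the Levi-Civita connection: at a point where `Y` is differentiable,
`∇_v Y` is the vector `w` with `2 g(w, Z) = koszul g X Y Z` for all `X`, `Z` with `X x = v`. -/
def leviCivitaAux (g : SmoothMetric I M) (Y : Π x : M, TangentSpace I x) (x : M) :
    TangentSpace I x →L[ℝ] TangentSpace I x :=
  if hY : MDiffAt (T% Y) x then
    LinearMap.toContinuousLinearMap
      ((1 / 2 : ℝ) • (sharp g x ∘ₗ (koszulForm g Y x hY).toLinearMap))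
  else 0

/-- The Koszul formula. -/
lemma two_inner_leviCivitaAux (g : SmoothMetric I M) {X Y Z : Π x : M, TangentSpace I x} {x : M}
    (hX : MDiffAt (T% X) x) (hY : MDiffAt (T% Y) x) (hZ : MDiffAt (T% Z) x) :
    2 * g.inner x (leviCivitaAux g Y x (X x)) (Z x) = koszul g X Y Z x := by
  simp [leviCivitaAux, hY, inner_sharp, koszulForm_apply g hX hY hZ]

lemma eq_of_inner_eq (g : SmoothMetric I M) {x : M} {v w : TangentSpace I x}
    (h : ∀ z, 2 * g.inner x v z = 2 * g.inner x w z) : v = w :=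
  flat_injective g x (by ext z; simpa using h z)

/-- The Levi-Civita connection of a Riemannian metric. The vector `∇_v Y` at `x` is written
`leviCivita g Y x v`. -/
def leviCivita (g : SmoothMetric I M) : CovariantDerivative I E (TangentSpace I : M → Type _) where
  toFun := leviCivitaAux g
  isCovariantDerivativeOnUniv :=
    { add := by
        intro Y Y' x hY hY' _
        ext v
        apply eq_of_inner_eq g
        intro z
        have hv := mdifferentiableAt_extend I E v
        have hz := mdifferentiableAt_extend I E z
        have h := koszul_add_middle g hv hY hY' hz
        rw [← two_inner_leviCivitaAux g hv hY hz, ← two_inner_leviCivitaAux g hv hY' hz,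
          ← two_inner_leviCivitaAux g hv (mdifferentiableAt_add_section hY hY') hz] at h
        simp only [extend_apply_self] at h
        rw [h]
        simp
        ring
      leibniz := by
        intro Y f x hY hf _
        ext v
        apply eq_of_inner_eq g
        intro z
        have hv := mdifferentiableAt_extend I E v
        have hz := mdifferentiableAt_extend I E z
        have h := koszul_smul_middle g hv hY hz hf
        rw [← two_inner_leviCivitaAux g hv hY hz,
          ← two_inner_leviCivitaAux g hv (hf.smul_section hY) hz] at h
        simp only [extend_apply_self] at h
        rw [h]
        simp
        ring }

lemma two_inner_leviCivita (g : SmoothMetric I M) {X Y Z : Π x : M, TangentSpace I x} {x : M}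
    (hX : MDiffAt (T% X) x) (hY : MDiffAt (T% Y) x) (hZ : MDiffAt (T% Z) x) :
    2 * g.inner x (leviCivita g Y x (X x)) (Z x) = koszul g X Y Z x :=
  two_inner_leviCivitaAux g hX hY hZ

theorem leviCivita_torsion (g : SmoothMetric I M) : (leviCivita g).torsion = 0 := by
  rw [CovariantDerivative.torsion_eq_zero_iff]
  intro X Y x hX hY
  apply eq_of_inner_eq g
  intro z
  have hz := mdifferentiableAt_extend I E z
  have h1 := two_inner_leviCivita g hX hY hz
  have h2 := two_inner_leviCivita g hY hX hz
  simp only [extend_apply_self] at h1 h2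
  simp only [map_sub, sub_apply, mul_sub, h1, h2, koszul, extend_apply_self]
  rw [mlieBracket_swap_apply (V := Y) (W := X), mlieBracket_swap_apply (V := extend E z) (W := X),
    mlieBracket_swap_apply (V := Y) (W := extend E z)]
  simp only [g.symm _ (extend E z _) _, g.symm _ (Y _) (X _)]
  simp only [map_neg]
  rw [g.symm x z]
  ring

theorem leviCivita_metric (g : SmoothMetric I M) {X Y Z : Π x : M, TangentSpace I x} {x : M}
    (hX : MDiffAt (T% X) x) (hY : MDiffAt (T% Y) x) (hZ : MDiffAt (T% Z) x) :
    mvfderiv I (fun y ↦ g.inner y (Y y) (Z y)) x (X x) =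
      g.inner x (leviCivita g Y x (X x)) (Z x) + g.inner x (Y x) (leviCivita g Z x (X x)) := by
  have h1 := two_inner_leviCivita g hX hY hZ
  have h2 := two_inner_leviCivita g hX hZ hY
  rw [g.symm x (Y x)]
  simp only [koszul] at h1 h2
  rw [mlieBracket_swap_apply (V := Z) (W := Y), mlieBracket_swap_apply (V := Y) (W := X),
    mlieBracket_swap_apply (V := X) (W := Z)] at h2
  simp only [g.symm _ (Z _) (Y _), g.symm _ (Y _) (X _), g.symm _ (Z _) (X _)] at h1 h2
  simp only [map_neg] at h2
  linarith

/-- The covariant derivative `∇_v σ` at `x` of a field `σ` of endomorphisms of the tangent spaces,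
i.e. of a `(1,1)` tensor field: `(∇_v σ) W = ∇_v (σ W) - σ (∇_v W)`, computed on the coordinate
fields `W` around `x`. -/
def nablaEnd (D : CovariantDerivative I E (TangentSpace I : M → Type _))
    (σ : Π x : M, TangentSpace I x →L[ℝ] TangentSpace I x) (x : M) (v : TangentSpace I x) :
    TangentSpace I x →L[ℝ] TangentSpace I x :=
  extendLinear x fun w ↦ D (fun y ↦ σ y (extend E w y)) x v - σ x (D (extend E w) x v)

/-- The curvature tensor `R(u, v) w = ∇_u ∇_v W - ∇_v ∇_u W - ∇_[U, V] W` at `x`. -/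
def curvature (D : CovariantDerivative I E (TangentSpace I : M → Type _)) (x : M)
    (u v w : TangentSpace I x) : TangentSpace I x :=
  D (fun y ↦ D (extend E w) y (extend E v y)) x u
    - D (fun y ↦ D (extend E w) y (extend E u y)) x v
    - D (extend E w) x (mlieBracket I (extend E u) (extend E v) x)

/-- The `(1,2)` tensor `S(X, Y) = ½ ((∇_{JY} J) X + J ((∇_Y J) X) - J ((∇_X J) Y))` of a connection
`∇` and an almost product structure `J`. -/
def productTensor (D : CovariantDerivative I E (TangentSpace I : M → Type _))
    (J : Π x : M, TangentSpace I x →L[ℝ] TangentSpace I x) (x : M) (X Y : TangentSpace I x) :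
    TangentSpace I x :=
  (1 / 2 : ℝ) • (nablaEnd D J x (J x Y) X + J x (nablaEnd D J x Y X) - J x (nablaEnd D J x X Y))

/-- The almost product connection `∇_X Y - S(X, Y)` of a connection `∇` and an almost product
structure `J`. -/
def almostProductConnection (D : CovariantDerivative I E (TangentSpace I : M → Type _))
    (J : Π x : M, TangentSpace I x →L[ℝ] TangentSpace I x) :
    CovariantDerivative I E (TangentSpace I : M → Type _) :=
  D.addOneForm fun x ↦ extendLinear x fun Y ↦ extendLinear x fun X ↦ -productTensor D J x X Y

/-- The inverse `(gⁱʲ)` of the matrix of the metric in the coordinate basis. -/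
def gInv (g : SmoothMetric I M) (x : M) :
    Matrix (Fin (Module.finrank ℝ E)) (Fin (Module.finrank ℝ E)) ℝ :=
  (Matrix.of fun i j ↦ g.inner x (coordBasis I x i) (coordBasis I x j))⁻¹

/-- The extension `G(A, B) = g_{it} gʲˡ Aⁱⱼ Bᵗₗ` of the metric to `(1,1)` tensors at `x`. -/
def tensorInner (g : SmoothMetric I M) (x : M) (A B : TangentSpace I x →L[ℝ] TangentSpace I x) : ℝ :=
  ∑ j, ∑ l, gInv g x j l * g.inner x (A (coordBasis I x j)) (B (coordBasis I x l))

/-- The gradient `(df)*`. -/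
def grad (g : SmoothMetric I M) (f : M → ℝ) (x : M) : TangentSpace I x :=
  sharp g x (mvfderiv I f x)

/-- The tensor `ᶠA(X, Y) = X(f) Y + Y(f) X - g(X, Y) (df)*`. -/
def conformalTensor (g : SmoothMetric I M) (f : M → ℝ) (x : M) (X Y : TangentSpace I x) :
    TangentSpace I x :=
  mvfderiv I f x X • Y + mvfderiv I f x Y • X - g.inner x X Y • grad g f x

/-- The vector `gᵇˡ R(t_b, C_l) Y + g_{at} (tᵃ (g⁻¹ ∘ R( , Y) C̃ᵗ))`, where `t_b = t ∂_b`,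
`C_l = C ∂_l`, and the second summand is the vector metrically dual to the covector
`Z ↦ g_{at} tᵃ (R(Z, Y) C̃ᵗ) = gᵇˡ g(t (R(Z, Y) ∂_b), C ∂_l)`. -/
def curvatureTerm (g : SmoothMetric I M) (x : M) (t C : TangentSpace I x →L[ℝ] TangentSpace I x)
    (Y : TangentSpace I x) : TangentSpace I x :=
  (∑ b, ∑ l, gInv g x b l •
      curvature (leviCivita g) x (t (coordBasis I x b)) (C (coordBasis I x l)) Y)
    + sharp g x (extendLinear x fun Z ↦ ∑ b, ∑ l, gInv g x b l *
        g.inner x (t (curvature (leviCivita g) x Z Y (coordBasis I x b))) (C (coordBasis I x l)))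

/-- A Riemannian metric is flat if its curvature tensor vanishes. -/
def IsFlat (g : SmoothMetric I M) : Prop :=
  ∀ (x : M) (u v w : TangentSpace I x), curvature (leviCivita g) x u v w = 0

end General

/-! ### The `(1,1)`-tensor bundle -/

section TensorBundle

variable {E : Type*} [NormedAddCommGroup E] [NormedSpace ℝ E] [FiniteDimensional ℝ E]
  {M : Type*} [TopologicalSpace M] [ChartedSpace E M] [IsManifold 𝓘(ℝ, E) ∞ M]

/-- The `(1,1)` tensors at `x`, seen as endomorphisms of the tangent space at `x`. -/
abbrev Tensor11 (E : Type*) [NormedAddCommGroup E] [NormedSpace ℝ E] {M : Type*}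
    [TopologicalSpace M] [ChartedSpace E M] (x : M) : Type _ :=
  TangentSpace 𝓘(ℝ, E) x →L[ℝ] TangentSpace 𝓘(ℝ, E) x

/-- The total space of the bundle of `(1,1)` tensors over `M`; its points are the pairs
`⟨x, t⟩` of a point `x` of `M` and a `(1,1)` tensor `t` at `x`. -/
abbrev T11 (E : Type*) [NormedAddCommGroup E] [NormedSpace ℝ E] (M : Type*)
    [TopologicalSpace M] [ChartedSpace E M] : Type _ :=
  TotalSpace (E →L[ℝ] E) (fun x : M ↦ Tensor11 E x)

/-- The model with corners of the tensor bundle, with model space `E × End E`. -/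
abbrev T11Model (E : Type*) [NormedAddCommGroup E] [NormedSpace ℝ E] :
    ModelWithCorners ℝ (E × (E →L[ℝ] E)) (ModelProd E (E →L[ℝ] E)) :=
  𝓘(ℝ, E).prod 𝓘(ℝ, E →L[ℝ] E)

/-- The Christoffel operator at `x` in the preferred chart at `x`: `Γ_v w = vˢ Γⁱₛₘ wᵐ ∂ᵢ`. -/
def christoffel (D : CovariantDerivative 𝓘(ℝ, E) E (TangentSpace 𝓘(ℝ, E) : M → Type _)) (x : M) :
    TangentSpace 𝓘(ℝ, E) x →L[ℝ] TangentSpace 𝓘(ℝ, E) x →L[ℝ] TangentSpace 𝓘(ℝ, E) x :=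
  extendLinear x fun v ↦ extendLinear x fun w ↦ D (extend E w) x v

/-- The vertical lift `(0, A)` to the point `u` of the tensor bundle, in the coordinates
`(xʲ, tⁱⱼ)` induced by the preferred chart at the base point of `u`. -/
def vLift (u : T11 E M) (A : Tensor11 E u.1) : TangentSpace (T11Model E) u :=
  ((0, A) : E × (E →L[ℝ] E))

/-- The horizontal lift `(Xʲ, Xˢ (Γᵐₛⱼ tⁱₘ - Γⁱₛₘ tᵐⱼ))` to the point `u = (x, t)` of the tensor
bundle, in the coordinates `(xʲ, tⁱⱼ)` induced by the preferred chart at `x`. -/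
def hLift (g : SmoothMetric 𝓘(ℝ, E) M) (u : T11 E M) (X : TangentSpace 𝓘(ℝ, E) u.1) :
    TangentSpace (T11Model E) u :=
  ((X, u.2 ∘L christoffel (leviCivita g) u.1 X - christoffel (leviCivita g) u.1 X ∘L u.2) :
    E × (E →L[ℝ] E))

/-- The projection `dπ` of a tangent vector of the tensor bundle to the base. -/
def basePart {u : T11 E M} (ξ : TangentSpace (T11Model E) u) : TangentSpace 𝓘(ℝ, E) u.1 :=
  (show E × (E →L[ℝ] E) from ξ).1

/-- The `(1,1)` tensor `A` in the decomposition `ξ = ᴴX + ⱽA`. -/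
def verticalPart (g : SmoothMetric 𝓘(ℝ, E) M) {u : T11 E M} (ξ : TangentSpace (T11Model E) u) :
    Tensor11 E u.1 :=
  (show E × (E →L[ℝ] E) from ξ - hLift g u (basePart ξ)).2

lemma hLift_add_vLift (g : SmoothMetric 𝓘(ℝ, E) M) {u : T11 E M} (ξ : TangentSpace (T11Model E) u) :
    hLift g u (basePart ξ) + vLift u (verticalPart g ξ) = ξ := by
  refine Prod.ext (?_ : (basePart ξ : E) + 0 = basePart ξ) ?_
  · exact add_zero _
  · exact add_sub_cancel (G := E →L[ℝ] E) _ _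

/-- The almost product structure of the tensor bundle: `J (ᴴX) = -ᴴX` and `J (ⱽA) = ⱽA`. -/
def structureJ (g : SmoothMetric 𝓘(ℝ, E) M) (u : T11 E M) :
    TangentSpace (T11Model E) u →L[ℝ] TangentSpace (T11Model E) u :=
  extendLinear u fun ξ ↦ vLift u (verticalPart g ξ) - hLift g u (basePart ξ)

/-- The rescaled Sasaki type metric of `g` and `f`. -/
structure IsRescaledSasaki (g : SmoothMetric 𝓘(ℝ, E) M) (f : M → ℝ)
    (G : SmoothMetric (T11Model E) (T11 E M)) : Prop where
  vert_vert (u : T11 E M) (A B : Tensor11 E u.1) :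
    G.inner u (vLift u A) (vLift u B) = tensorInner g u.1 A B
  vert_horiz (u : T11 E M) (A : Tensor11 E u.1) (Y : TangentSpace 𝓘(ℝ, E) u.1) :
    G.inner u (vLift u A) (hLift g u Y) = 0
  horiz_horiz (u : T11 E M) (X Y : TangentSpace 𝓘(ℝ, E) u.1) :
    G.inner u (hLift g u X) (hLift g u Y) = f u.1 * g.inner u.1 X Y

lemma hLift_add (g : SmoothMetric 𝓘(ℝ, E) M) (u : T11 E M) (X Y : TangentSpace 𝓘(ℝ, E) u.1) :
    hLift g u (X + Y) = hLift g u X + hLift g u Y := by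
  refine Prod.ext rfl ?_
  simp only [hLift, map_add, ContinuousLinearMap.comp_add, ContinuousLinearMap.add_comp]
  exact add_sub_add_comm _ _ _ _

lemma hLift_smul (g : SmoothMetric 𝓘(ℝ, E) M) (u : T11 E M) (c : ℝ) (X : TangentSpace 𝓘(ℝ, E) u.1) :
    hLift g u (c • X) = c • hLift g u X := by
  refine Prod.ext rfl ?_
  simp only [hLift, map_smul, ContinuousLinearMap.comp_smul, ContinuousLinearMap.smul_comp]
  exact (smul_sub _ _ _).symm

end TensorBundle
end TensorBundle

end

open TensorBundle

/-! The proof evaluates the Koszul formula on lifts. With `t` the point of the bundle, the brackets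
are `[ᴴX, ᴴY] = ᴴ[X, Y] + ⱽ(t ∘ R(X, Y) - R(X, Y) ∘ t)`, `[ᴴX, ⱽA] = ⱽ(∇_X A)` and `[ⱽA, ⱽB] = 0`
(`mlieBracket_hLift`, `mlieBracket_hLift_vLift`, `mlieBracket_vLift`). Inner products of lifts of
like type are pulled back from `M`, so they are constant along the fibres and are differentiated on
the base along `ᴴX` (`mvfderiv_comp_proj`). Since `∇` is compatible with the metric on (1,1) tensors
(`mvfderiv_tensorInner`), Koszul's formula gives the four components needed: the horizontal parts of
`∇̃_ᴴX ᴴY` and `∇̃_ᴴY ⱽC`, and the vertical parts of `∇̃_ᴴX ⱽB` and `∇̃_ⱽC ⱽB`.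

For any connection, `∇̃J` on a horizontal field is minus twice the vertical part of its derivative,
and on a vertical field twice the horizontal part. Hence subtracting `S̃` removes from the
derivative of a horizontal or vertical lift the component in the other distribution. In the mixed
cases it also adds twice a component which the vanishing torsion of `∇̃` identifies; this is where
the factor 3 in iii) comes from. The new connection preserves both distributions, which is `ᴾ∇̃ J =
0`.

By the bracket formulas, the torsion is `-ⱽ(t ∘ R(X, Y) - R(X, Y) ∘ t)` on two horizontal lifts, a
multiple of the curvature term on a mixed pair, and zero on two vertical lifts. It vanishes if `R =
0`. Conversely, if it vanishes at every `t`, then `R(X, Y)` commutes with all endomorphisms of the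
tangent space, so it is a scalar, and being skew it is zero.

The computations take place in charts. The delicate point is that the lifts at a point are defined
in the chart preferred there, whereas derivatives require their coordinates at nearby points in one
fixed chart. Instead of the transformation law of Christoffel symbols, `coordAt_hLift` uses the
invariant identity `dσ(v) = ᴴv + ⱽ(∇_v σ)` for sections `σ` (`mfderiv_section`). Existence of the
metric amounts to smoothness of its coordinate expression (`formRep_sasakiForm`); uniqueness follows
because lifts span each tangent space. -/

noncomputable section

open scoped Topology

set_option maxSynthPendingDepth 3

namespace TensorBundle

/-! ### Tangent vectors, vector fields and Lie brackets in a fixed chart -/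

section Coordinates

variable {E : Type*} [NormedAddCommGroup E] [NormedSpace ℝ E] [FiniteDimensional ℝ E]
  {H : Type*} [TopologicalSpace H] {I : ModelWithCorners ℝ E H} [I.Boundaryless]
  {M : Type*} [TopologicalSpace M] [ChartedSpace H M] [IsManifold I ∞ M]

variable (I) in
/-- The coordinates of tangent vectors at `y` in the preferred chart at `x₀`. -/
def coordAt (x₀ y : M) : TangentSpace I y →L[ℝ] E :=
  (trivializationAt E (TangentSpace I : M → Type _) x₀).continuousLinearMapAt ℝ y

variable (I) in
/-- The tangent vector at `y` with given coordinates in the preferred chart at `x₀`. -/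
def frameAt (x₀ y : M) : E →L[ℝ] TangentSpace I y :=
  (trivializationAt E (TangentSpace I : M → Type _) x₀).symmL ℝ y

lemma coordAt_frameAt {x₀ y : M} (hy : y ∈ (chartAt H x₀).source) (w : E) :
    coordAt I x₀ y (frameAt I x₀ y w) = w :=
  (trivializationAt E (TangentSpace I : M → Type _) x₀).continuousLinearMapAt_symmL hy w

lemma frameAt_coordAt {x₀ y : M} (hy : y ∈ (chartAt H x₀).source) (v : TangentSpace I y) :
    frameAt I x₀ y (coordAt I x₀ y v) = v :=
  (trivializationAt E (TangentSpace I : M → Type _) x₀).symmL_continuousLinearMapAt hy v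

/-- The tangent space at `x` is the model space seen through the preferred chart at `x`, so the
coordinate change is the identity. This links the pointwise definitions of the lifts and of
`coordBasis` to the trivializations. -/
lemma coordAt_self (x : M) (v : TangentSpace I x) : coordAt I x x v = v := by
  have := TangentBundle.continuousLinearMapAt_trivializationAt_eq_core (I := I) (mem_chart_source H x)
  unfold coordAt
  rw [this]
  exact tangentCoordChange_self (I := I) (x := x) (z := x) (v := v) (mem_extChartAt_source x)

lemma frameAt_self (x : M) (v : E) : frameAt I x x v = v :=
  (congrArg (frameAt I x x) (coordAt_self (I := I) x v)).symm.trans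
    (frameAt_coordAt (I := I) (mem_chart_source H x) (v : TangentSpace I x))

/-- `extend` keeps the coordinates constant in the chart at `x`. Thus the derivatives, curvature and
Christoffel operator, which are defined through `extend`, become computations in a coordinate frame.
-/
lemma extend_eq_frameAt {x y : M} (hy : y ∈ (chartAt H x).source) (v : TangentSpace I x) :
    extend E v y = frameAt I x y v := by
  have h : (trivializationAt E (TangentSpace I : M → Type _) x ⟨x, v⟩).2 = v := by
    have := coordAt_self (I := I) x v
    rwa [coordAt, Trivialization.continuousLinearMapAt_apply,
      Trivialization.coe_linearMapAt_of_mem _ (mem_chart_source H x)] at this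
  simp only [extend, frameAt]
  rw [h]
  exact (Trivialization.symmL_apply (R := ℝ)
    (trivializationAt E (TangentSpace I : M → Type _) x) hy (v : E)).symm

lemma coordAt_eq_mfderiv {x₀ y : M} (hy : y ∈ (chartAt H x₀).source) :
    coordAt I x₀ y = mfderiv I 𝓘(ℝ, E) (extChartAt I x₀) y :=
  TangentBundle.continuousLinearMapAt_trivializationAt hy

/-- The representation of a vector field in the preferred chart at `x₀`. -/
def localRep (x₀ : M) (V : Π x : M, TangentSpace I x) (z : E) : E :=
  coordAt I x₀ ((extChartAt I x₀).symm z) (V ((extChartAt I x₀).symm z))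

lemma extChartAt_symm_mem {x₀ : M} {z : E} (hz : z ∈ (extChartAt I x₀).target) :
    (extChartAt I x₀).symm z ∈ (chartAt H x₀).source := by
  simpa using (extChartAt I x₀).map_target hz

lemma extChartAt_target_mem {x₀ y : M} (hy : y ∈ (chartAt H x₀).source) :
    extChartAt I x₀ y ∈ (extChartAt I x₀).target :=
  (extChartAt I x₀).map_source (by simpa using hy)

lemma extChartAt_leftInv {x₀ y : M} (hy : y ∈ (chartAt H x₀).source) :
    (extChartAt I x₀).symm (extChartAt I x₀ y) = y :=
  (extChartAt I x₀).left_inv (by simpa using hy)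

lemma eventually_mem_target {x₀ y : M} (hy : y ∈ (chartAt H x₀).source) :
    ∀ᶠ z in 𝓝 (extChartAt I x₀ y), z ∈ (extChartAt I x₀).target :=
  (isOpen_extChartAt_target x₀).mem_nhds (extChartAt_target_mem hy)

lemma eventually_mem_source {x₀ y : M} (hy : y ∈ (chartAt H x₀).source) :
    ∀ᶠ y' in 𝓝 y, y' ∈ (chartAt H x₀).source :=
  (chartAt H x₀).open_source.mem_nhds hy

lemma contMDiffAt_chart_symm {x₀ y : M} (hy : y ∈ (chartAt H x₀).source) :
    ContMDiffAt 𝓘(ℝ, E) I ∞ (extChartAt I x₀).symm (extChartAt I x₀ y) :=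
  (contMDiffOn_extChartAt_symm x₀).contMDiffAt (eventually_mem_target hy)

lemma contMDiffAt_chart {x₀ y : M} (hy : y ∈ (chartAt H x₀).source) :
    ContMDiffAt I 𝓘(ℝ, E) ∞ (extChartAt I x₀) y :=
  contMDiffAt_extChartAt' hy

section Functions

variable {F : Type*} [NormedAddCommGroup F] [NormedSpace ℝ F] {h : M → F} {x₀ y : M}

lemma eventuallyEq_chart (hy : y ∈ (chartAt H x₀).source) :
    h =ᶠ[𝓝 y] (h ∘ (extChartAt I x₀).symm) ∘ extChartAt I x₀ := by
  filter_upwards [eventually_mem_source hy] with y' hy'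
  exact (congrArg h (extChartAt_leftInv (I := I) hy')).symm

lemma mdifferentiableAt_iff_chart (hy : y ∈ (chartAt H x₀).source) :
    MDiffAt h y ↔ DifferentiableAt ℝ (h ∘ (extChartAt I x₀).symm) (extChartAt I x₀ y) := by
  constructor
  · intro hh
    refine mdifferentiableAt_iff_differentiableAt.1 ?_
    refine MDifferentiableAt.comp (I' := I) _ ?_
      ((contMDiffAt_chart_symm hy).mdifferentiableAt (by simp))
    rwa [extChartAt_leftInv hy]
  · intro hh
    refine MDifferentiableAt.congr_of_eventuallyEq ?_ (eventuallyEq_chart (I := I) hy)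
    exact hh.mdifferentiableAt.comp y ((contMDiffAt_chart hy).mdifferentiableAt (by simp))

lemma contMDiffAt_iff_chart (hy : y ∈ (chartAt H x₀).source) :
    ContMDiffAt I 𝓘(ℝ, F) ∞ h y ↔
      ContDiffAt ℝ ∞ (h ∘ (extChartAt I x₀).symm) (extChartAt I x₀ y) := by
  constructor
  · intro hh
    refine contMDiffAt_iff_contDiffAt.1 ?_
    refine ContMDiffAt.comp (I' := I) _ ?_ (contMDiffAt_chart_symm hy)
    rwa [extChartAt_leftInv hy]
  · intro hh
    refine ContMDiffAt.congr_of_eventuallyEq ?_ (eventuallyEq_chart (I := I) hy)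
    exact hh.contMDiffAt.comp y (contMDiffAt_chart hy)

lemma mvfderiv_eq_fderiv (hy : y ∈ (chartAt H x₀).source) (hh : MDiffAt h y)
    (v : TangentSpace I y) :
    mvfderiv I h y v =
      fderiv ℝ (h ∘ (extChartAt I x₀).symm) (extChartAt I x₀ y) (coordAt I x₀ y v) := by
  have h1 : mfderiv I 𝓘(ℝ, F) h y =
      mfderiv I 𝓘(ℝ, F) ((h ∘ (extChartAt I x₀).symm) ∘ extChartAt I x₀) y :=
    (eventuallyEq_chart (I := I) hy).mfderiv_eq
  have h2 := mfderiv_comp_apply (I := I) (I' := 𝓘(ℝ, E)) (I'' := 𝓘(ℝ, F)) y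
    (g := h ∘ (extChartAt I x₀).symm) (f := extChartAt I x₀)
    ((mdifferentiableAt_iff_chart hy).1 hh).mdifferentiableAt
    ((contMDiffAt_chart hy).mdifferentiableAt (by simp)) v
  rw [← h1, mfderiv_eq_fderiv] at h2
  rw [coordAt_eq_mfderiv hy]
  exact h2

end Functions

lemma mdifferentiableAt_section_iff {V : Π x : M, TangentSpace I x} {x₀ y : M}
    (hy : y ∈ (chartAt H x₀).source) :
    MDiffAt (T% V) y ↔ DifferentiableAt ℝ (localRep x₀ V) (extChartAt I x₀ y) := by
  rw [Trivialization.mdifferentiableAt_section_iff I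
    (trivializationAt E (TangentSpace I : M → Type _) x₀) V hy, mdifferentiableAt_iff_chart hy]
  refine Filter.EventuallyEq.differentiableAt_iff ?_
  filter_upwards [eventually_mem_target hy] with z hz
  simp only [localRep, coordAt, Function.comp_apply]
  rw [Trivialization.continuousLinearMapAt_apply,
      Trivialization.coe_linearMapAt_of_mem _ (extChartAt_symm_mem hz)]

lemma isInvertible_mfderiv_chart {x₀ y : M} (hy : y ∈ (chartAt H x₀).source) (w : E) :
    (mfderiv I 𝓘(ℝ, E) (extChartAt I x₀) y).inverse w = frameAt I x₀ y w := by
  have h := (trivializationAt E (TangentSpace I : M → Type _) x₀).coe_continuousLinearEquivAt_eq'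
    (R := ℝ) hy
  rw [← coordAt_eq_mfderiv hy]
  unfold coordAt
  rw [← h]
  refine (congrArg (fun f : E →L[ℝ] TangentSpace I y ↦ f w) (ContinuousLinearMap.inverse_equiv
    ((trivializationAt E (TangentSpace I : M → Type _) x₀).continuousLinearEquivAt ℝ y hy))).trans ?_
  exact congrArg (fun f ↦ f w) ((trivializationAt E (TangentSpace I : M → Type _)
    x₀).symm_continuousLinearEquivAt_eq' (R := ℝ) hy)

lemma mlieBracket_vectorSpace {V W : Π z : E, TangentSpace 𝓘(ℝ, E) z} (z : E) :
    mlieBracket 𝓘(ℝ, E) V W z = lieBracket ℝ V W z := by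
  rw [← mlieBracketWithin_univ, mlieBracketWithin_eq_lieBracketWithin]
  exact congrFun (lieBracketWithin_univ (𝕜 := ℝ) (V := (V : E → E)) (W := (W : E → E))) z

/-- Naturality of the bracket: near `y` each field is the pullback of its coordinate representation
by the chart, and pullback commutes with brackets. -/
lemma mlieBracket_eq {V W : Π x : M, TangentSpace I x} {x₀ y : M}
    (hy : y ∈ (chartAt H x₀).source) (hV : MDiffAt (T% V) y) (hW : MDiffAt (T% W) y) :
    mlieBracket I V W y =
      frameAt I x₀ y (lieBracket ℝ (localRep x₀ V) (localRep x₀ W) (extChartAt I x₀ y)) := by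
  have key (X : Π x : M, TangentSpace I x) :
      mpullback I 𝓘(ℝ, E) (extChartAt I x₀) (localRep x₀ X) =ᶠ[𝓝 y] X := by
    filter_upwards [eventually_mem_source hy] with y' hy'
    simp only [mpullback, localRep]
    refine (isInvertible_mfderiv_chart hy' _).trans ?_
    rw [extChartAt_leftInv hy', frameAt_coordAt hy']
  rw [← (key V).mlieBracket_vectorField_eq (key W)]
  have hd (R : E → E) (hR : DifferentiableAt ℝ R (extChartAt I x₀ y)) :
      MDiffAt (fun z ↦ (⟨z, R z⟩ : TangentBundle 𝓘(ℝ, E) E)) (extChartAt I x₀ y) := by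
    refine (mdifferentiableAt_totalSpace _ _).2 ⟨mdifferentiableAt_id, ?_⟩
    refine hR.mdifferentiableAt.congr_of_eventuallyEq (.of_forall fun z ↦ ?_)
    simp
  have : IsManifold I (minSmoothness ℝ 2) M := by
    rw [minSmoothness_of_isRCLikeNormedField]; infer_instance
  have := mpullback_mlieBracket (n := ∞) (hd _ ((mdifferentiableAt_section_iff hy).1 hV))
    (hd _ ((mdifferentiableAt_section_iff hy).1 hW)) (contMDiffAt_chart hy)
    (by rw [minSmoothness_of_isRCLikeNormedField]; exact WithTop.coe_le_coe.2 le_top)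
  rw [← this]
  refine (isInvertible_mfderiv_chart hy _).trans ?_
  exact congrArg (frameAt I x₀ y) (mlieBracket_vectorSpace _)

end Coordinates

/-! ### Christoffel symbols and curvature of a metric on an open set of a vector space -/

section Flat

variable {E : Type*} [NormedAddCommGroup E] [NormedSpace ℝ E] [FiniteDimensional ℝ E]

lemma isInvertible_of_pos (B : E →L[ℝ] E →L[ℝ] ℝ) (h : ∀ v, v ≠ 0 → 0 < B v v) :
    B.IsInvertible := by
  have inj : Function.Injective B.toLinearMap := by
    rw [injective_iff_map_eq_zero]
    intro v hv
    by_contra hne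
    have := h v hne
    rw [show B v = 0 from hv] at this
    simp at this
  have hfin : Module.finrank ℝ E = Module.finrank ℝ (E →L[ℝ] ℝ) := by
    rw [← (LinearMap.toContinuousLinearMap (𝕜 := ℝ) (E := E) (F' := ℝ)).finrank_eq]
    exact (Subspace.dual_finrank_eq (K := ℝ) (V := E)).symm
  have : FiniteDimensional ℝ (E →L[ℝ] ℝ) :=
    Module.Finite.equiv (LinearMap.toContinuousLinearMap (𝕜 := ℝ) (E := E) (F' := ℝ))
  refine ⟨(LinearEquiv.ofInjectiveOfFinrankEq B.toLinearMap inj hfin).toContinuousLinearEquiv, ?_⟩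
  ext; rfl

/-- A smooth Riemannian metric on an open subset of a vector space. -/
structure IsLocalMetric (G : E → E →L[ℝ] E →L[ℝ] ℝ) (U : Set E) : Prop where
  isOpen : IsOpen U
  contDiffAt : ∀ z ∈ U, ContDiffAt ℝ ∞ G z
  symm : ∀ z ∈ U, ∀ v w, G z v w = G z w v
  pos : ∀ z ∈ U, ∀ v, v ≠ 0 → 0 < G z v v

/-- The Christoffel symbols `Γ_v w` of a metric on an open subset of a vector space. -/
def localChr (G : E → E →L[ℝ] E →L[ℝ] ℝ) (z : E) : E →L[ℝ] E →L[ℝ] E :=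
  (ContinuousLinearMap.compL ℝ E (E →L[ℝ] ℝ) E (ContinuousLinearMap.inverse (G z))) ∘L
    ((1 / 2 : ℝ) • (fderiv ℝ G z + (fderiv ℝ G z).flip -
      (ContinuousLinearMap.flipₗᵢ ℝ E E ℝ).toContinuousLinearEquiv.toContinuousLinearMap ∘L
        (fderiv ℝ G z).flip))

/-- The curvature `R(u, v) w` of a metric on an open subset of a vector space. -/
def localCurv (G : E → E →L[ℝ] E →L[ℝ] ℝ) (z u v w : E) : E :=
  fderiv ℝ (localChr G) z u v w + localChr G z u (localChr G z v w)
    - fderiv ℝ (localChr G) z v u w - localChr G z v (localChr G z u w)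

namespace IsLocalMetric

variable {G : E → E →L[ℝ] E →L[ℝ] ℝ} {U : Set E} (h : IsLocalMetric G U) {z : E} (hz : z ∈ U)
include h hz

lemma isInvertible : (G z).IsInvertible := isInvertible_of_pos _ (h.pos z hz)

lemma apply_inverse (α : E →L[ℝ] ℝ) : G z ((G z).inverse α) = α := by
  obtain ⟨e, he⟩ := h.isInvertible hz
  rw [← he]; simp

lemma eq_of_forall {v w : E} (hvw : ∀ u, G z v u = G z w u) : v = w := by
  obtain ⟨e, he⟩ := h.isInvertible hz
  apply e.injective
  ext u
  have := hvw u
  rw [← he] at this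
  exact this

lemma differentiableAt : DifferentiableAt ℝ G z := (h.contDiffAt z hz).differentiableAt (by simp)

lemma contDiffAt_inverse : ContDiffAt ℝ ∞ (fun z ↦ (G z).inverse) z := by
  obtain ⟨e, he⟩ := h.isInvertible hz
  have : ContDiffAt ℝ ∞ (ContinuousLinearMap.inverse : (E →L[ℝ] E →L[ℝ] ℝ) → _) (G z) := by
    rw [← he]; exact contDiffAt_map_inverse e
  exact this.comp z (h.contDiffAt z hz)

set_option synthInstance.maxHeartbeats 200000 in
lemma contDiffAt_localChr : ContDiffAt ℝ ∞ (localChr G) z := by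
  have h1 : ContDiffAt ℝ ∞ (fderiv ℝ G) z := (h.contDiffAt z hz).fderiv_right (by simp)
  have h2 : ContDiffAt ℝ ∞ (fun z ↦ (fderiv ℝ G z).flip) z :=
    (ContinuousLinearMap.flipₗᵢ ℝ E E (E →L[ℝ] ℝ)).contDiff.contDiffAt.comp z h1
  unfold localChr
  refine ContDiffAt.clm_comp ?_ ?_
  · exact (ContinuousLinearMap.contDiff _).contDiffAt.comp z (h.contDiffAt_inverse hz)
  · exact ((h1.add h2).sub (contDiffAt_const.clm_comp h2)).const_smul _

lemma fderiv_symm (a v w : E) : fderiv ℝ G z a v w = fderiv ℝ G z a w v := by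
  have h1 (v w : E) : HasFDerivAt (fun z ↦ G z v w) _ z :=
    ((h.differentiableAt hz).hasFDerivAt.clm_apply (hasFDerivAt_const v z)).clm_apply
      (hasFDerivAt_const w z)
  have h2 : (fun z ↦ G z v w) =ᶠ[𝓝 z] fun z ↦ G z w v := by
    filter_upwards [h.isOpen.mem_nhds hz] with y hy using h.symm y hy v w
  have := congrArg (fun L ↦ L a) ((h1 v w).unique ((h1 w v).congr_of_eventuallyEq h2))
  simpa using this

/-- Koszul's formula for constant fields, whose brackets vanish. Nondegeneracy makes it a
characterization of `localChr`. -/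
lemma two_localChr (v w u : E) : 2 * G z (localChr G z v w) u =
    fderiv ℝ G z v w u + fderiv ℝ G z w u v - fderiv ℝ G z u v w := by
  simp only [localChr, ContinuousLinearMap.comp_apply, ContinuousLinearMap.compL_apply,
    h.apply_inverse hz]
  simp [h.fderiv_symm hz w u v]

lemma localChr_symm (v w : E) : localChr G z v w = localChr G z w v := by
  refine h.eq_of_forall hz fun u ↦ ?_
  have h1 := h.two_localChr hz v w u
  have h2 := h.two_localChr hz w v u
  have h3 := h.fderiv_symm hz
  rw [h3 w u v, h3 u v w] at h1
  rw [h3 v u w] at h2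
  linarith

/-- Compatibility of the connection with the metric: add the Koszul formulas for the two orders of
the last two arguments. -/
lemma fderiv_eq (a v w : E) :
    fderiv ℝ G z a v w = G z (localChr G z a v) w + G z v (localChr G z a w) := by
  have h1 := h.two_localChr hz a v w
  have h2 := h.two_localChr hz a w v
  have h3 := h.fderiv_symm hz
  rw [h.symm z hz v, h3 a v w]
  rw [h3 a v w, h3 v w a] at h1
  rw [h3 w v a] at h2
  linarith

lemma fderiv_localChr_symm (a v w : E) :
    fderiv ℝ (localChr G) z a v w = fderiv ℝ (localChr G) z a w v := by
  have h1 (v w : E) : HasFDerivAt (fun z ↦ localChr G z v w) _ z :=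
    ((((h.contDiffAt_localChr hz).differentiableAt (by simp)).hasFDerivAt).clm_apply
      (hasFDerivAt_const v z)).clm_apply (hasFDerivAt_const w z)
  have h2 : (fun z ↦ localChr G z v w) =ᶠ[𝓝 z] fun z ↦ localChr G z w v := by
    filter_upwards [h.isOpen.mem_nhds hz] with y hy using h.localChr_symm hy v w
  have := congrArg (fun L ↦ L a) ((h1 v w).unique ((h1 w v).congr_of_eventuallyEq h2))
  simpa using this

omit h hz in
lemma localCurv_antisymm (z u v w : E) : localCurv G z u v w = -localCurv G z v u w := by
  simp only [localCurv]; abel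

/-- With `Γ` symmetric, each term of the cyclic sum occurs twice with opposite signs. -/
lemma localCurv_bianchi (u v w : E) :
    localCurv G z u v w + localCurv G z v w u + localCurv G z w u v = 0 := by
  simp only [localCurv]
  rw [h.fderiv_localChr_symm hz u v w, h.fderiv_localChr_symm hz v w u,
    h.fderiv_localChr_symm hz w u v, h.localChr_symm hz v w, h.localChr_symm hz w u,
    h.localChr_symm hz u v]
  abel

/-- Differentiate the compatibility identity `fderiv_eq` once more and antisymmetrize in the two
directions. The second derivative of `G` is symmetric and drops out, leaving the skewness of the
curvature operator. -/
lemma localCurv_skew (a v w u : E) :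
    G z (localCurv G z a v w) u + G z w (localCurv G z a v u) = 0 := by
  have hG := (h.differentiableAt hz).hasFDerivAt
  have hΓ := ((h.contDiffAt_localChr hz).differentiableAt (by simp)).hasFDerivAt
  have hD : HasFDerivAt (fderiv ℝ G) (fderiv ℝ (fderiv ℝ G) z) z :=
    (((h.contDiffAt z hz).fderiv_right (m := 1) (by exact WithTop.coe_le_coe.2 le_top)).differentiableAt
      (by simp)).hasFDerivAt
  have hsymm : IsSymmSndFDerivAt ℝ G z := (h.contDiffAt z hz).isSymmSndFDerivAt
    (by rw [minSmoothness_of_isRCLikeNormedField]; exact WithTop.coe_le_coe.2 le_top)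
  have key (a v : E) : fderiv ℝ (fderiv ℝ G) z a v w u =
      fderiv ℝ G z a (localChr G z v w) u + G z (fderiv ℝ (localChr G) z a v w) u
      + (fderiv ℝ G z a w (localChr G z v u) + G z w (fderiv ℝ (localChr G) z a v u)) := by
    have h1 := ((hD.clm_apply (hasFDerivAt_const v z)).clm_apply (hasFDerivAt_const w z)).clm_apply
      (hasFDerivAt_const u z)
    have hc (w : E) := (hΓ.clm_apply (hasFDerivAt_const v z)).clm_apply (hasFDerivAt_const w z)
    have h2 := ((hG.clm_apply (hc w)).clm_apply (hasFDerivAt_const u z)).add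
      ((hG.clm_apply (hasFDerivAt_const w z)).clm_apply (hc u))
    have h3 := h1.congr_of_eventuallyEq (f₁ := fun z ↦ G z (localChr G z v w) u + G z w (localChr G z v u)) (by
      filter_upwards [h.isOpen.mem_nhds hz] with y hy using (h.fderiv_eq hy v w u).symm)
    have := congrArg (fun L ↦ L a) (h3.unique h2)
    simp at this
    rw [this]
    ring
  have e1 := key a v
  have e2 := key v a
  rw [hsymm.eq a v, e2] at e1
  simp only [h.fderiv_eq hz] at e1
  simp only [localCurv, map_sub, map_add, sub_apply, add_apply]
  linarith

/-- The classical octahedron argument: four cyclic identities combined with skewness in the first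
pair and in the last pair. -/
lemma localCurv_pair (a b c d : E) :
    G z (localCurv G z a b c) d = G z (localCurv G z c d a) b := by
  have sk := h.localCurv_skew hz
  have bi (a b c d : E) := congrArg (fun v ↦ G z v d) (h.localCurv_bianchi hz a b c)
  have an (a b c d : E) := congrArg (fun v ↦ G z v d) (localCurv_antisymm (G := G) z a b c)
  simp only [map_add, add_apply, map_zero, zero_apply, map_neg, neg_apply] at bi an
  have sk' (a b c d : E) : G z (localCurv G z a b c) d = - G z (localCurv G z a b d) c := by
    have := sk a b c d
    rw [h.symm z hz c] at this
    linarith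
  have b1 := bi a b c d
  have b2 := bi b c d a
  have b3 := bi c d a b
  have b4 := bi d a b c
  linarith [sk' a b c d, sk' a b d c, sk' b c a d, sk' c a b d, sk' b c d a, sk' c d b a, sk' d b c a,
    sk' c d a b, sk' d a c b, sk' a c d b, sk' d a b c, sk' b d a c, an a c b d, an a c d b, an d b c a,
    an b d a c, an a c b d, an d b a c]

end IsLocalMetric

end Flat

/-! ### The metric and connections in coordinate frames -/

section LocalMetric

variable {E : Type*} [NormedAddCommGroup E] [NormedSpace ℝ E] [FiniteDimensional ℝ E]
  {H : Type*} [TopologicalSpace H] {I : ModelWithCorners ℝ E H} [I.Boundaryless]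
  {M : Type*} [TopologicalSpace M] [ChartedSpace H M] [IsManifold I ∞ M]

/-- Linear maps are determined on a basis. This removes `extendLinear` from a definition once its
argument is known to be linear. -/
lemma extendLinear_eq {F : Type*} [AddCommGroup F] [Module ℝ F] [TopologicalSpace F]
    [IsTopologicalAddGroup F] [ContinuousSMul ℝ F] {x : M} {c : TangentSpace I x → F}
    (L : TangentSpace I x →L[ℝ] F) (h : ∀ v, c v = L v) : extendLinear x c = L := by
  ext v
  have : (coordBasis I x).constr ℝ (fun i ↦ c (coordBasis I x i)) = (L : TangentSpace I x →ₗ[ℝ] F) :=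
    (coordBasis I x).ext fun i ↦ by simp [h]
  exact congrArg (fun f : TangentSpace I x →ₗ[ℝ] F ↦ f v) this

/-- A field of bilinear forms on the tangent spaces, in the preferred chart at `x₀`. -/
def formRep (B : Π x : M, TangentSpace I x →L[ℝ] TangentSpace I x →L[ℝ] ℝ) (x₀ : M) (z : E) :
    E →L[ℝ] E →L[ℝ] ℝ :=
  ContinuousLinearMap.inCoordinates E (TangentSpace I : M → Type _) (E →L[ℝ] ℝ)
    (fun x : M ↦ TangentSpace I x →L[ℝ] ℝ) x₀ ((extChartAt I x₀).symm z) x₀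
    ((extChartAt I x₀).symm z) (B ((extChartAt I x₀).symm z))

lemma formRep_apply (B : Π x : M, TangentSpace I x →L[ℝ] TangentSpace I x →L[ℝ] ℝ) {x₀ : M} {z : E}
    (hz : z ∈ (extChartAt I x₀).target) (v w : E) :
    formRep B x₀ z v w = B ((extChartAt I x₀).symm z)
      (frameAt I x₀ ((extChartAt I x₀).symm z) v) (frameAt I x₀ ((extChartAt I x₀).symm z) w) := by
  have hy : (extChartAt I x₀).symm z ∈ (trivializationAt E (TangentSpace I : M → Type _) x₀).baseSet :=
    extChartAt_symm_mem hz
  have := inCoordinates_apply_eq₂ (F₃ := ℝ) (E₃ := Bundle.Trivial M ℝ) (v := v) (w := w)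
    (ϕ := B ((extChartAt I x₀).symm z)) hy hy (by simp)
  refine this.trans ?_
  simp only [frameAt, Trivialization.symmL_apply _ hy]
  simp

/-- Used in both directions: to obtain a smooth local metric from `g`, and to prove that the Sasaki
form is smooth from its coordinate expression. -/
lemma contMDiffAt_form_iff (B : Π x : M, TangentSpace I x →L[ℝ] TangentSpace I x →L[ℝ] ℝ) {x₀ y : M}
    (hy : y ∈ (chartAt H x₀).source) :
    ContMDiffAt I (I.prod 𝓘(ℝ, E →L[ℝ] E →L[ℝ] ℝ)) ∞
      (fun x ↦ TotalSpace.mk' (E →L[ℝ] E →L[ℝ] ℝ)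
        (E := fun x : M ↦ TangentSpace I x →L[ℝ] TangentSpace I x →L[ℝ] ℝ) x (B x)) y ↔
      ContDiffAt ℝ ∞ (formRep B x₀) (extChartAt I x₀ y) := by
  have h := (trivializationAt (E →L[ℝ] E →L[ℝ] ℝ)
    (fun x : M ↦ TangentSpace I x →L[ℝ] TangentSpace I x →L[ℝ] ℝ) x₀).contMDiffAt_iff
    (IM := I) (IB := I) (n := ∞) (x₀ := y)
    (f := fun x ↦ TotalSpace.mk' (E →L[ℝ] E →L[ℝ] ℝ)
        (E := fun x : M ↦ TangentSpace I x →L[ℝ] TangentSpace I x →L[ℝ] ℝ) x (B x))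
    (by
      rw [Trivialization.mem_source]
      exact ⟨hy, hy, by simp⟩)
  rw [h]
  refine (and_iff_right (contMDiffAt_id (I := I))).trans ?_
  rw [contMDiffAt_iff_chart hy]
  rfl

lemma contMDiffAt_frame (x₀ : M) {y : M} (hy : y ∈ (chartAt H x₀).source) (w : E) :
    MDiffAt (T% (fun y ↦ frameAt I x₀ y w)) y := by
  rw [mdifferentiableAt_section_iff hy]
  refine (differentiableAt_const w).congr_of_eventuallyEq ?_
  filter_upwards [eventually_mem_target hy] with z hz
  exact coordAt_frameAt (extChartAt_symm_mem hz) w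

lemma localRep_frame {x₀ : M} {z : E} (hz : z ∈ (extChartAt I x₀).target) (w : E) :
    localRep x₀ (fun y ↦ frameAt I x₀ y w) z = w :=
  coordAt_frameAt (extChartAt_symm_mem hz) w

lemma mlieBracket_frame {x₀ y : M} (hy : y ∈ (chartAt H x₀).source) (v w : E) :
    mlieBracket I (fun y ↦ frameAt I x₀ y v) (fun y ↦ frameAt I x₀ y w) y = 0 := by
  rw [mlieBracket_eq hy (contMDiffAt_frame x₀ hy v) (contMDiffAt_frame x₀ hy w)]
  have h (v : E) : localRep x₀ (fun y ↦ frameAt I x₀ y v) =ᶠ[𝓝 (extChartAt I x₀ y)] fun _ ↦ v := by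
    filter_upwards [eventually_mem_target hy] with z hz using localRep_frame hz v
  rw [(h v).lieBracket_vectorField_eq (h w)]
  simp [lieBracket]

lemma isLocalMetric_formRep (g : SmoothMetric I M) (x₀ : M) :
    IsLocalMetric (formRep g.inner x₀) (extChartAt I x₀).target where
  isOpen := isOpen_extChartAt_target x₀
  contDiffAt z hz := by
    have := (contMDiffAt_form_iff g.inner (extChartAt_symm_mem hz)).1 g.contMDiff.contMDiffAt
    rwa [(extChartAt I x₀).right_inv hz] at this
  symm z hz v w := by rw [formRep_apply _ hz, formRep_apply _ hz, g.symm]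
  pos z hz v hv := by
    rw [formRep_apply _ hz]
    refine g.pos _ _ fun h ↦ hv ?_
    rw [← coordAt_frameAt (I := I) (extChartAt_symm_mem hz) v, h, map_zero]

lemma inner_eq_formRep (g : SmoothMetric I M) {x₀ y : M} (hy : y ∈ (chartAt H x₀).source)
    (v w : TangentSpace I y) :
    g.inner y v w = formRep g.inner x₀ (extChartAt I x₀ y) (coordAt I x₀ y v) (coordAt I x₀ y w) := by
  rw [formRep_apply _ (extChartAt_target_mem hy)]
  rw [extChartAt_leftInv hy, frameAt_coordAt hy, frameAt_coordAt hy]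

lemma mvfderiv_inner_frame (g : SmoothMetric I M) {x₀ y : M} (hy : y ∈ (chartAt H x₀).source)
    (a v w : E) :
    mvfderiv I (fun y ↦ g.inner y (frameAt I x₀ y v) (frameAt I x₀ y w)) y (frameAt I x₀ y a) =
      fderiv ℝ (formRep g.inner x₀) (extChartAt I x₀ y) a v w := by
  have hG := (isLocalMetric_formRep g x₀).differentiableAt (extChartAt_target_mem hy)
  rw [mvfderiv_eq_fderiv hy (mdifferentiableAt_inner g (contMDiffAt_frame x₀ hy v)
    (contMDiffAt_frame x₀ hy w)), coordAt_frameAt hy]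
  have : (fun y ↦ g.inner y (frameAt I x₀ y v) (frameAt I x₀ y w)) ∘ (extChartAt I x₀).symm
      =ᶠ[𝓝 (extChartAt I x₀ y)] fun z ↦ formRep g.inner x₀ z v w := by
    filter_upwards [eventually_mem_target hy] with z hz
    rw [formRep_apply _ hz]; rfl
  rw [this.fderiv_eq]
  have h1 := (hG.hasFDerivAt.clm_apply (hasFDerivAt_const v _)).clm_apply
      (hasFDerivAt_const w _)
  rw [h1.fderiv]
  simp

/-- Frame fields commute, so the Koszul expression reduces to the derivatives of the metric
coefficients that define `localChr`. -/
lemma leviCivita_frame (g : SmoothMetric I M) {x₀ y : M} (hy : y ∈ (chartAt H x₀).source)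
    (v w : E) :
    leviCivita g (fun y ↦ frameAt I x₀ y w) y (frameAt I x₀ y v) =
      frameAt I x₀ y (localChr (formRep g.inner x₀) (extChartAt I x₀ y) v w) := by
  apply eq_of_inner_eq g
  intro u'
  obtain ⟨u, rfl⟩ : ∃ u, u' = frameAt I x₀ y u := ⟨_, (frameAt_coordAt hy u').symm⟩
  have h := two_inner_leviCivita g (contMDiffAt_frame x₀ hy v) (contMDiffAt_frame x₀ hy w)
    (contMDiffAt_frame x₀ hy u)
  rw [h, inner_eq_formRep g hy, coordAt_frameAt hy, coordAt_frameAt hy,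
    (isLocalMetric_formRep g x₀).two_localChr (extChartAt_target_mem hy), koszul,
    mlieBracket_frame hy, mlieBracket_frame hy, mlieBracket_frame hy, mvfderiv_inner_frame g hy,
    mvfderiv_inner_frame g hy, mvfderiv_inner_frame g hy]
  simp

section Connection

variable (D : CovariantDerivative I E (TangentSpace I : M → Type _))

lemma localRep_add (x₀ : M) (V W : Π x : M, TangentSpace I x) :
    localRep x₀ (V + W) = localRep x₀ V + localRep x₀ W := by
  ext z; exact map_add (coordAt I x₀ _) _ _

/-- Subtracting the derivative of the coordinates cancels the Leibniz term, so the remainder is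
tensorial in `Y`. It depends only on `Y y` and may be evaluated on the frame field with that value,
whose coordinates are constant. -/
lemma covariantDerivative_eq_frame {x₀ y : M} (hy : y ∈ (chartAt H x₀).source)
    {Y : Π x : M, TangentSpace I x} (hY : MDiffAt (T% Y) y) (v : TangentSpace I y) :
    D Y y v = frameAt I x₀ y (fderiv ℝ (localRep x₀ Y) (extChartAt I x₀ y) (coordAt I x₀ y v))
      + D (fun y' ↦ frameAt I x₀ y' (coordAt I x₀ y (Y y))) y v := by
  have ten : TensorialAt I E (fun Y : Π x : M, TangentSpace I x ↦ D Y y v -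
      frameAt I x₀ y (fderiv ℝ (localRep x₀ Y) (extChartAt I x₀ y) (coordAt I x₀ y v))) y := by
    constructor
    · intro f Y hf hY
      have h1 := D.isCovariantDerivativeOnUniv.leibniz hY hf
      have h2 : localRep x₀ (f • Y) = fun z ↦ (f ∘ (extChartAt I x₀).symm) z • localRep x₀ Y z := by
        ext z; exact map_smul (coordAt I x₀ _) _ _
      have h3 := (((mdifferentiableAt_iff_chart hy).1 hf).hasFDerivAt.smul
        ((mdifferentiableAt_section_iff hy).1 hY).hasFDerivAt).fderiv
      have h4 : localRep x₀ Y (extChartAt I x₀ y) = coordAt I x₀ y (Y y) := by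
        rw [localRep, extChartAt_leftInv hy]
      rw [show D (f • Y) y = _ from h1, h2]
      rw [show fderiv ℝ (fun z ↦ (f ∘ (extChartAt I x₀).symm) z • localRep x₀ Y z) _ = _ from h3]
      simp only [h4, Function.comp_apply, extChartAt_leftInv (I := I) hy, add_apply, smul_apply,
        ContinuousLinearMap.smulRight_apply, map_add, map_smul, frameAt_coordAt hy,
        mvfderiv_eq_fderiv hy hf, smul_sub]
      abel
    · intro Y Y' hY hY'
      have h1 := D.isCovariantDerivativeOnUniv.add hY hY'
      rw [show D (Y + Y') y = _ from h1, localRep_add, fderiv_add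
        ((mdifferentiableAt_section_iff hy).1 hY) ((mdifferentiableAt_section_iff hy).1 hY')]
      simp
      abel
  have h := ten.pointwise hY (contMDiffAt_frame x₀ hy (coordAt I x₀ y (Y y))) (frameAt_coordAt hy _).symm
  have h5 : localRep x₀ (fun y' ↦ frameAt I x₀ y' (coordAt I x₀ y (Y y)))
      =ᶠ[𝓝 (extChartAt I x₀ y)] fun _ ↦ coordAt I x₀ y (Y y) := by
    filter_upwards [eventually_mem_target hy] with z hz using localRep_frame hz _
  rw [h5.fderiv_eq, fderiv_fun_const] at h
  simp only [Pi.zero_apply, zero_apply, map_zero, sub_zero] at h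
  rw [← h]; abel

/-- `nablaEnd` is computed on coordinate extensions only. The right-hand side is tensorial in `W`,
so any differentiable field with the same value will do. -/
lemma nablaEnd_apply {σ : Π x : M, TangentSpace I x →L[ℝ] TangentSpace I x} {y : M}
    (hσ : ∀ W : Π x : M, TangentSpace I x, MDiffAt (T% W) y → MDiffAt (T% (fun x ↦ σ x (W x))) y)
    {W : Π x : M, TangentSpace I x} (hW : MDiffAt (T% W) y) (v : TangentSpace I y) :
    nablaEnd D σ y v (W y) = D (fun x ↦ σ x (W x)) y v - σ y (D W y v) := by
  have ten : TensorialAt I E (fun W : Π x : M, TangentSpace I x ↦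
      D (fun x ↦ σ x (W x)) y v - σ y (D W y v)) y := by
    constructor
    · intro f W hf hW
      have h1 := D.isCovariantDerivativeOnUniv.leibniz hW hf
      have h2 := D.isCovariantDerivativeOnUniv.leibniz (hσ W hW) hf
      have h3 : (fun x ↦ σ x ((f • W) x)) = f • fun x ↦ σ x (W x) := by ext; simp
      rw [h3, show D (f • W) y = _ from h1, show D (f • fun x ↦ σ x (W x)) y = _ from h2]
      simp [smul_sub]
    · intro W W' hW hW'
      have h1 := D.isCovariantDerivativeOnUniv.add hW hW'
      have h2 := D.isCovariantDerivativeOnUniv.add (hσ W hW) (hσ W' hW')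
      have h3 : (fun x ↦ σ x ((W + W') x)) = (fun x ↦ σ x (W x)) + fun x ↦ σ x (W' x) := by ext; simp
      rw [h3, show D (W + W') y = _ from h1, show D ((fun x ↦ σ x (W x)) + fun x ↦ σ x (W' x)) y = _ from h2]
      simp
      abel
  rw [nablaEnd, extendLinear_eq (TensorialAt.mkHom _ y ten)]
  · exact TensorialAt.mkHom_apply ten hW
  · intro w
    rw [TensorialAt.mkHom_apply_eq_extend]

end Connection

end LocalMetric

/-! ### The induced metric on endomorphisms as the trace form `tr (A* B)` -/

section TraceForm

variable {E : Type*} [NormedAddCommGroup E] [NormedSpace ℝ E] [FiniteDimensional ℝ E]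

variable (E) in
/-- The trace of endomorphisms, as a continuous linear form. -/
def traceCLM : (E →L[ℝ] E) →L[ℝ] ℝ :=
  LinearMap.toContinuousLinearMap (LinearMap.trace ℝ E ∘ₗ ContinuousLinearMap.coeLM ℝ)

lemma traceCLM_apply (T : E →L[ℝ] E) : traceCLM E T = LinearMap.trace ℝ E T := rfl

lemma traceCLM_comm (S T : E →L[ℝ] E) : traceCLM E (S ∘L T) = traceCLM E (T ∘L S) :=
  LinearMap.trace_mul_comm ℝ (S : E →ₗ[ℝ] E) (T : E →ₗ[ℝ] E)

lemma traceCLM_eq_sum {ι : Type*} [Fintype ι] (e : Module.Basis ι ℝ E) (T : E →L[ℝ] E) :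
    traceCLM E T = ∑ l, e.coord l (T (e l)) := by
  classical
  rw [traceCLM_apply, LinearMap.trace_eq_matrix_trace ℝ e, Matrix.trace]
  simp [LinearMap.toMatrix_apply]

lemma sum_coord_mul {ι : Type*} [Fintype ι] (e : Module.Basis ι ℝ E) (f : E →L[ℝ] ℝ) (v : E) :
    ∑ j, e.coord j v * f (e j) = f v := by
  conv_rhs => rw [← e.sum_repr v, map_sum]
  simp only [map_smul, smul_eq_mul, Module.Basis.coord_apply]

/-- The endomorphism `A* B`, with the adjoint `A*` of `A` for the bilinear form `G`. -/
def adjointComp (G : E →L[ℝ] E →L[ℝ] ℝ) (A B : E →L[ℝ] E) : E →L[ℝ] E :=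
  G.inverse ∘L ((ContinuousLinearMap.compL ℝ E E ℝ).flip A) ∘L G ∘L B

lemma adjointComp_apply (G : E →L[ℝ] E →L[ℝ] ℝ) (A B : E →L[ℝ] E) (w : E) :
    adjointComp G A B w = G.inverse (G (B w) ∘L A) := rfl

/-- The form `tr (A* B)` on endomorphisms. -/
def traceForm (G : E →L[ℝ] E →L[ℝ] ℝ) (A B : E →L[ℝ] E) : ℝ := traceCLM E (adjointComp G A B)

section Pos

variable {G : E →L[ℝ] E →L[ℝ] ℝ} (hs : ∀ v w, G v w = G w v) (hp : ∀ v, v ≠ 0 → 0 < G v v)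
include hs hp

omit hs in
lemma apply_inverse_of_pos (α : E →L[ℝ] ℝ) : G (G.inverse α) = α := by
  obtain ⟨e, he⟩ := isInvertible_of_pos G hp
  rw [← he]; simp

/-- Column `l` of the inverse Gram matrix consists of the coordinates of the vector dual to the
`l`-th coordinate form. For square matrices a right inverse is enough. -/
lemma gram_inv {ι : Type*} [Fintype ι] [DecidableEq ι] (e : Module.Basis ι ℝ E) :
    (Matrix.of fun i j ↦ G (e i) (e j))⁻¹ =
      Matrix.of fun j l ↦ e.coord j (G.inverse (LinearMap.toContinuousLinearMap (e.coord l))) := by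
  refine Matrix.inv_eq_right_inv ?_
  ext k l
  simp only [Matrix.mul_apply, Matrix.of_apply]
  have h1 : ∑ j, G (e k) (e j) * e.coord j (G.inverse (LinearMap.toContinuousLinearMap (e.coord l))) =
      G (e k) (G.inverse (LinearMap.toContinuousLinearMap (e.coord l))) := by
    simp_rw [mul_comm (G (e k) _)]
    exact sum_coord_mul e _ _
  rw [h1, hs, apply_inverse_of_pos hp]
  simp [Matrix.one_apply, Finsupp.single_apply]

/-- The index expression of the metric on tensors is a trace. It is therefore independent of the
basis, and the basis at a point can be exchanged for the frame of any chart. -/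
lemma sum_gram_inv {ι : Type*} [Fintype ι] [DecidableEq ι] (e : Module.Basis ι ℝ E)
    (A B : E →L[ℝ] E) :
    ∑ j, ∑ l, (Matrix.of fun i j ↦ G (e i) (e j))⁻¹ j l * G (A (e j)) (B (e l)) = traceForm G A B := by
  rw [gram_inv hs hp, traceForm, traceCLM_eq_sum e, Finset.sum_comm]
  refine Finset.sum_congr rfl fun l _ ↦ ?_
  calc _ = ∑ j, e.coord j (G.inverse (LinearMap.toContinuousLinearMap (e.coord l))) *
        (G (B (e l)) ∘L A) (e j) :=
        Finset.sum_congr rfl fun j _ ↦ by rw [hs]; rfl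
    _ = G (adjointComp G A B (e l)) (G.inverse (LinearMap.toContinuousLinearMap (e.coord l))) := by
        rw [sum_coord_mul, adjointComp_apply, apply_inverse_of_pos hp]
    _ = _ := by rw [hs, apply_inverse_of_pos hp]; rfl

/-- In a `G`-orthogonal basis the trace becomes a sum with positive weights, from which symmetry and
positivity are visible. The basis is not normalized, hence the inverse factors. -/
lemma exists_traceForm_eq : ∃ e : Module.Basis (Fin (Module.finrank ℝ E)) ℝ E, ∀ A B,
    traceForm G A B = ∑ l, (G (e l) (e l))⁻¹ * G (A (e l)) (B (e l)) := by
  let b : LinearMap.BilinForm ℝ E := (ContinuousLinearMap.coeLM ℝ) ∘ₗ (G : E →ₗ[ℝ] E →L[ℝ] ℝ)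
  have hb (v w : E) : b v w = G v w := rfl
  obtain ⟨e, he⟩ := LinearMap.BilinForm.exists_orthogonal_basis (B := b) ⟨fun v w ↦ hs v w⟩
  refine ⟨e, fun A B ↦ ?_⟩
  rw [traceForm, traceCLM_eq_sum e]
  refine Finset.sum_congr rfl fun l _ ↦ ?_
  have h1 (v : E) : G v (e l) = e.coord l v * G (e l) (e l) := by
    rw [hs, ← sum_coord_mul e]
    refine Finset.sum_eq_single l (fun j _ hj ↦ ?_) (by simp)
    have : G (e l) (e j) = 0 := he hj.symm
    rw [this, mul_zero]
  have h2 : G (adjointComp G A B (e l)) (e l) = G (A (e l)) (B (e l)) := by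
    rw [adjointComp_apply, apply_inverse_of_pos hp, hs]; rfl
  have h3 := hp (e l) (e.ne_zero l)
  rw [← h2, h1 (adjointComp G A B (e l)), mul_comm, mul_inv_cancel_right₀ h3.ne']

lemma traceForm_symm (A B : E →L[ℝ] E) : traceForm G A B = traceForm G B A := by
  obtain ⟨e, he⟩ := exists_traceForm_eq hs hp
  rw [he, he]
  exact Finset.sum_congr rfl fun l _ ↦ by rw [hs (A (e l))]

lemma traceForm_pos {A : E →L[ℝ] E} (hA : A ≠ 0) : 0 < traceForm G A A := by
  obtain ⟨e, he⟩ := exists_traceForm_eq hs hp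
  have hnn (v : E) : 0 ≤ G v v := by
    rcases eq_or_ne v 0 with rfl | hv
    · simp
    · exact (hp v hv).le
  obtain ⟨l, hl⟩ : ∃ l, A (e l) ≠ 0 := by
    by_contra! hc
    exact hA (ContinuousLinearMap.coe_injective (e.ext (by simpa using hc)))
  rw [he]
  refine Finset.sum_pos' (fun l _ ↦ mul_nonneg (inv_nonneg.2 (hnn _)) (hnn _)) ⟨l, Finset.mem_univ _, ?_⟩
  exact mul_pos (inv_pos.2 (hp _ (e.ne_zero l))) (hp _ hl)

end Pos

variable (E) in
/-- The trace form as a bilinear map, as a function of a form `G` and its inverse `P`. -/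
def traceFormCLM (P : (E →L[ℝ] ℝ) →L[ℝ] E) (G : E →L[ℝ] E →L[ℝ] ℝ) :
    (E →L[ℝ] E) →L[ℝ] (E →L[ℝ] E) →L[ℝ] ℝ :=
  (ContinuousLinearMap.compL ℝ (E →L[ℝ] E) (E →L[ℝ] E) ℝ (traceCLM E)) ∘L
    ((ContinuousLinearMap.compL ℝ (E →L[ℝ] E) (E →L[ℝ] E →L[ℝ] ℝ) (E →L[ℝ] E)).flip
      (ContinuousLinearMap.compL ℝ E E (E →L[ℝ] ℝ) G)) ∘L
    (ContinuousLinearMap.compL ℝ E (E →L[ℝ] ℝ) E) ∘L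
    (ContinuousLinearMap.compL ℝ (E →L[ℝ] ℝ) (E →L[ℝ] ℝ) E P) ∘L
    (ContinuousLinearMap.compL ℝ E E ℝ).flip

namespace IsLocalMetric

variable {G : E → E →L[ℝ] E →L[ℝ] ℝ} {U : Set E} (h : IsLocalMetric G U) {z : E} (hz : z ∈ U)
include h hz

/-- The trace form is assembled by composition from `G z` and its inverse, both smooth in `z`. At `P
= (G z).inverse` the map `traceFormCLM` unfolds to `traceForm`, and later proofs use this
definitional equality. -/
lemma contDiffAt_traceFormCLM :
    ContDiffAt ℝ ∞ (fun z ↦ traceFormCLM E (G z).inverse (G z)) z := by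
  have h1 := h.contDiffAt z hz
  have h2 := h.contDiffAt_inverse hz
  unfold traceFormCLM
  refine contDiffAt_const.clm_comp (ContDiffAt.clm_comp ?_ (contDiffAt_const.clm_comp
    (ContDiffAt.clm_comp ?_ contDiffAt_const)))
  · exact (ContinuousLinearMap.contDiff _).contDiffAt.comp z
      ((ContinuousLinearMap.contDiff _).contDiffAt.comp z h1)
  · exact (ContinuousLinearMap.contDiff _).contDiffAt.comp z h2

/-- Differentiate `G (G⁻¹ α) = α` and express the derivative of `G` by `Γ`: the inverse metric is
parallel too. -/
lemma fderiv_inverse (v : E) (α : E →L[ℝ] ℝ) :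
    fderiv ℝ (fun z ↦ (G z).inverse) z v α =
      - localChr G z v ((G z).inverse α) - (G z).inverse (α ∘L localChr G z v) := by
  have hP := ((h.contDiffAt_inverse hz).differentiableAt (by simp)).hasFDerivAt
  have h1 := (h.differentiableAt hz).hasFDerivAt.clm_apply (hP.clm_apply (hasFDerivAt_const α z))
  have h2 : (fun z ↦ G z ((G z).inverse α)) =ᶠ[𝓝 z] fun _ ↦ α := by
    filter_upwards [h.isOpen.mem_nhds hz] with y hy using h.apply_inverse hy α
  have h3 := congrArg (fun L ↦ L v) (h1.unique ((hasFDerivAt_const α z).congr_of_eventuallyEq h2))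
  simp at h3
  refine h.eq_of_forall hz fun u ↦ ?_
  have h4 := congrArg (fun L ↦ L u) h3
  simp [h.fderiv_eq hz] at h4
  simp only [map_sub, map_neg, sub_apply, neg_apply, h.apply_inverse hz]
  rw [h.apply_inverse hz] at h4
  simp only [ContinuousLinearMap.comp_apply]
  linarith

/-- The derivative of the endomorphism `A* B` is the sum of the two covariant terms and a commutator
with `Γ_v`. The trace kills the commutator. -/
lemma fderiv_traceForm {A B : E → E →L[ℝ] E} (hA : DifferentiableAt ℝ A z)
    (hB : DifferentiableAt ℝ B z) (v : E) :
    fderiv ℝ (fun z ↦ traceForm (G z) (A z) (B z)) z v =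
      traceForm (G z) (fderiv ℝ A z v + localChr G z v ∘L A z - A z ∘L localChr G z v) (B z) +
      traceForm (G z) (A z) (fderiv ℝ B z v + localChr G z v ∘L B z - B z ∘L localChr G z v) := by
  have hP := ((h.contDiffAt_inverse hz).differentiableAt (by simp)).hasFDerivAt
  have hG := (h.differentiableAt hz).hasFDerivAt
  have hT : DifferentiableAt ℝ (fun z ↦ adjointComp (G z) (A z) (B z)) z := by
    unfold adjointComp
    refine hP.differentiableAt.clm_comp (DifferentiableAt.clm_comp ?_
      (hG.differentiableAt.clm_comp hB))
    exact (ContinuousLinearMap.differentiableAt _).comp z hA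
  -- The last summand is the commutator of `A* B` with `Γ_v`; the product rule and `fderiv_inverse`
  -- give the rest.
  have key : fderiv ℝ (fun z ↦ adjointComp (G z) (A z) (B z)) z v =
      adjointComp (G z) (fderiv ℝ A z v + localChr G z v ∘L A z - A z ∘L localChr G z v) (B z) +
      adjointComp (G z) (A z) (fderiv ℝ B z v + localChr G z v ∘L B z - B z ∘L localChr G z v)
      + (adjointComp (G z) (A z) (B z) ∘L localChr G z v -
        localChr G z v ∘L adjointComp (G z) (A z) (B z)) := by
    ext w
    have h1 := hT.hasFDerivAt.clm_apply (hasFDerivAt_const w z)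
    have h2 := hP.clm_apply ((hG.clm_apply (hB.hasFDerivAt.clm_apply
      (hasFDerivAt_const w z))).clm_comp hA.hasFDerivAt)
    have h3 := congrArg (fun L ↦ L v) (h1.unique h2)
    simp [h.fderiv_inverse hz] at h3
    have h4 : fderiv ℝ G z v (B z w) = G z (localChr G z v (B z w)) + G z (B z w) ∘L localChr G z v := by
      ext u
      simp [h.fderiv_eq hz]
    rw [h3, h4]
    simp only [adjointComp_apply, add_apply, sub_apply, ContinuousLinearMap.comp_apply, map_add,
      map_sub, ContinuousLinearMap.comp_add, ContinuousLinearMap.comp_sub,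
      ContinuousLinearMap.add_comp, ContinuousLinearMap.sub_comp, ContinuousLinearMap.comp_assoc]
    abel
  have h1 : HasFDerivAt (fun z ↦ traceForm (G z) (A z) (B z)) _ z :=
    (traceCLM E).hasFDerivAt.comp z hT.hasFDerivAt
  rw [h1.fderiv, ContinuousLinearMap.comp_apply, key, map_add, map_add, map_sub, traceCLM_comm]
  simp [traceForm]

end IsLocalMetric

end TraceForm

/-! ### Curvature and covariant derivatives of endomorphism fields in a chart -/

section LocalConnection

variable {E : Type*} [NormedAddCommGroup E] [NormedSpace ℝ E] [FiniteDimensional ℝ E]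
  {H : Type*} [TopologicalSpace H] {I : ModelWithCorners ℝ E H} [I.Boundaryless]
  {M : Type*} [TopologicalSpace M] [ChartedSpace H M] [IsManifold I ∞ M]

lemma leviCivita_eq (g : SmoothMetric I M) {x₀ y : M} (hy : y ∈ (chartAt H x₀).source)
    {Y : Π x : M, TangentSpace I x} (hY : MDiffAt (T% Y) y) (a : E) :
    leviCivita g Y y (frameAt I x₀ y a) = frameAt I x₀ y
      (fderiv ℝ (localRep x₀ Y) (extChartAt I x₀ y) a +
        localChr (formRep g.inner x₀) (extChartAt I x₀ y) a (coordAt I x₀ y (Y y))) := by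
  rw [covariantDerivative_eq_frame _ hy hY, leviCivita_frame g hy, coordAt_frameAt hy, map_add]

lemma extend_frameAt {x y : M} (hy : y ∈ (chartAt H x).source) (w : E) :
    extend E (frameAt I x x w) y = frameAt I x y w :=
  (extend_eq_frameAt hy _).trans (congrArg (frameAt I x y) (frameAt_self x w))

lemma extend_eventuallyEq (x : M) (w : E) :
    ∀ᶠ y in 𝓝 x, extend E (frameAt I x x w) y = frameAt I x y w := by
  filter_upwards [eventually_mem_source (mem_chart_source H x)] with y hy using extend_frameAt hy w

lemma covariantDerivative_congr (D : CovariantDerivative I E (TangentSpace I : M → Type _))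
    {V W : Π x : M, TangentSpace I x} {x : M} (hV : MDiffAt (T% V) x) (h : ∀ᶠ y in 𝓝 x, V y = W y) :
    D V x = D W x := by
  refine D.isCovariantDerivativeOnUniv.congr_of_eventuallyEq hV ?_ Filter.univ_mem h
  refine hV.congr_of_eventuallyEq ?_
  filter_upwards [h] with y hy
  simp only [hy]

lemma exists_frameAt {x₀ y : M} (hy : y ∈ (chartAt H x₀).source) (v : TangentSpace I y) :
    ∃ a, v = frameAt I x₀ y a := ⟨_, (frameAt_coordAt hy v).symm⟩

/-- The extended fields are frame fields near `x`. Their brackets vanish, and `∇_v w` has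
coordinates `Γ_v w`; one more derivative gives `dΓ + Γ Γ`, antisymmetrized. -/
lemma curvature_eq (g : SmoothMetric I M) (x : M) (u v w : E) :
    curvature (leviCivita g) x (frameAt I x x u) (frameAt I x x v) (frameAt I x x w) =
      frameAt I x x (localCurv (formRep g.inner x) (extChartAt I x x) u v w) := by
  have hx := mem_chart_source H x
  have hz := extChartAt_target_mem (I := I) hx
  have hm := isLocalMetric_formRep g x
  have hΓ := ((hm.contDiffAt_localChr hz).differentiableAt (by simp)).hasFDerivAt
  have key (u v : E) : leviCivita g (fun y ↦ leviCivita g (extend E (frameAt I x x w)) y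
      (extend E (frameAt I x x v) y)) x (frameAt I x x u) =
      frameAt I x x (fderiv ℝ (localChr (formRep g.inner x)) (extChartAt I x x) u v w
        + localChr (formRep g.inner x) (extChartAt I x x) u
          (localChr (formRep g.inner x) (extChartAt I x x) v w)) := by
    set Y : Π y : M, TangentSpace I y := fun y ↦ leviCivita g (extend E (frameAt I x x w)) y
      (extend E (frameAt I x x v) y) with hYdef
    -- The inner derivative is needed on a whole neighbourhood of `x`, because it is differentiated
    -- again.
    have hY : ∀ y ∈ (chartAt H x).source, Y y =
        frameAt I x y (localChr (formRep g.inner x) (extChartAt I x y) v w) := by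
      intro y hy
      have he : ∀ᶠ y' in 𝓝 y, extend E (frameAt I x x w) y' = frameAt I x y' w := by
        filter_upwards [eventually_mem_source hy] with y' hy' using extend_frameAt hy' w
      have hd : MDiffAt (T% (extend E (frameAt I x x w))) y := by
        refine (contMDiffAt_frame x hy w).congr_of_eventuallyEq ?_
        filter_upwards [he] with y' hy'
        simp only [hy']
      rw [hYdef]
      simp only
      rw [covariantDerivative_congr _ hd he, extend_frameAt hy, leviCivita_frame g hy]
    have hrep : localRep x Y =ᶠ[𝓝 (extChartAt I x x)] fun z ↦ localChr (formRep g.inner x) z v w := by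
      filter_upwards [eventually_mem_target hx] with z hz'
      rw [localRep, hY _ (extChartAt_symm_mem hz'), coordAt_frameAt (extChartAt_symm_mem hz'),
        (extChartAt I x).right_inv hz']
    have hc := (hΓ.clm_apply (hasFDerivAt_const v _)).clm_apply (hasFDerivAt_const w _)
    have hYd : MDiffAt (T% Y) x :=
      (mdifferentiableAt_section_iff hx).2 (hc.congr_of_eventuallyEq hrep).differentiableAt
    rw [leviCivita_eq g hx hYd, hrep.fderiv_eq, hc.fderiv, hY x hx, coordAt_frameAt hx]
    simp
  have hb : mlieBracket I (extend E (frameAt I x x u)) (extend E (frameAt I x x v)) x = 0 := by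
    rw [Filter.EventuallyEq.mlieBracket_vectorField_eq (extend_eventuallyEq x u)
      (extend_eventuallyEq x v), mlieBracket_frame hx]
  rw [curvature, key u v, key v u, hb]
  simp only [map_zero, sub_zero, ← map_sub, localCurv]
  congr 1
  abel

section Curvature

variable (g : SmoothMetric I M) (x : M)

lemma exists_frameAt_self (v : TangentSpace I x) : ∃ a, v = frameAt I x x a :=
  exists_frameAt (mem_chart_source H x) v

/-- Linearity in the first argument lets `extendLinear` be removed from the covector in
`curvatureTerm`. -/
lemma exists_curvature_left (v w : TangentSpace I x) :
    ∃ L : TangentSpace I x →L[ℝ] TangentSpace I x, ∀ u, curvature (leviCivita g) x u v w = L u := by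
  have h : IsLinearMap ℝ fun u ↦ curvature (leviCivita g) x u v w := by
    obtain ⟨v, rfl⟩ := exists_frameAt_self x v
    obtain ⟨w, rfl⟩ := exists_frameAt_self x w
    constructor
    · intro u u'
      obtain ⟨u, rfl⟩ := exists_frameAt_self x u
      obtain ⟨u', rfl⟩ := exists_frameAt_self x u'
      have h : localCurv (formRep g.inner x) (extChartAt I x x) (u + u') v w =
          localCurv (formRep g.inner x) (extChartAt I x x) u v w
            + localCurv (formRep g.inner x) (extChartAt I x x) u' v w := by
        simp only [localCurv, map_add, add_apply]
        abel
      rw [← map_add, curvature_eq, curvature_eq, curvature_eq, h]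
      exact map_add (frameAt I x x) _ _
    · intro c u
      obtain ⟨u, rfl⟩ := exists_frameAt_self x u
      have h : localCurv (formRep g.inner x) (extChartAt I x x) (c • u) v w =
          c • localCurv (formRep g.inner x) (extChartAt I x x) u v w := by
        simp only [localCurv, map_smul, smul_apply, smul_sub, smul_add]
      rw [← map_smul, curvature_eq, curvature_eq, h]
      exact map_smul (frameAt I x x) _ _
  exact ⟨LinearMap.toContinuousLinearMap h.mk', fun u ↦ rfl⟩

lemma inner_frameAt {x₀ y : M} (hy : y ∈ (chartAt H x₀).source) (v w : E) :
    g.inner y (frameAt I x₀ y v) (frameAt I x₀ y w) =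
      formRep g.inner x₀ (extChartAt I x₀ y) v w := by
  rw [inner_eq_formRep g hy, coordAt_frameAt hy, coordAt_frameAt hy]

lemma curvature_skew (u v w a : TangentSpace I x) :
    g.inner x (curvature (leviCivita g) x u v w) a =
      - g.inner x (curvature (leviCivita g) x u v a) w := by
  obtain ⟨u, rfl⟩ := exists_frameAt_self x u
  obtain ⟨v, rfl⟩ := exists_frameAt_self x v
  obtain ⟨w, rfl⟩ := exists_frameAt_self x w
  obtain ⟨a, rfl⟩ := exists_frameAt_self x a
  have hx := mem_chart_source H x
  have hz := extChartAt_target_mem (I := I) hx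
  have hm := isLocalMetric_formRep g x
  rw [curvature_eq, curvature_eq, inner_frameAt g hx, inner_frameAt g hx]
  have := hm.localCurv_skew hz u v w a
  rw [hm.symm _ hz w] at this
  linarith

lemma curvature_pair (u v w a : TangentSpace I x) :
    g.inner x (curvature (leviCivita g) x u v w) a =
      g.inner x (curvature (leviCivita g) x w a u) v := by
  obtain ⟨u, rfl⟩ := exists_frameAt_self x u
  obtain ⟨v, rfl⟩ := exists_frameAt_self x v
  obtain ⟨w, rfl⟩ := exists_frameAt_self x w
  obtain ⟨a, rfl⟩ := exists_frameAt_self x a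
  have hx := mem_chart_source H x
  rw [curvature_eq, curvature_eq, inner_frameAt g hx, inner_frameAt g hx]
  exact (isLocalMetric_formRep g x).localCurv_pair (extChartAt_target_mem (I := I) hx) u v w a

end Curvature

/-- A field of endomorphisms of the tangent spaces, in the preferred chart at `x₀`. -/
def endRep (σ : Π x : M, TangentSpace I x →L[ℝ] TangentSpace I x) (x₀ : M) (z : E) : E →L[ℝ] E :=
  coordAt I x₀ ((extChartAt I x₀).symm z) ∘L σ ((extChartAt I x₀).symm z) ∘L
    frameAt I x₀ ((extChartAt I x₀).symm z)

lemma mdifferentiableAt_end_iff (σ : Π x : M, TangentSpace I x →L[ℝ] TangentSpace I x) {x₀ y : M}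
    (hy : y ∈ (chartAt H x₀).source) :
    MDifferentiableAt I (I.prod 𝓘(ℝ, E →L[ℝ] E))
      (fun x ↦ TotalSpace.mk' (E →L[ℝ] E)
        (E := fun x : M ↦ TangentSpace I x →L[ℝ] TangentSpace I x) x (σ x)) y ↔
      DifferentiableAt ℝ (endRep σ x₀) (extChartAt I x₀ y) := by
  have h := (trivializationAt (E →L[ℝ] E)
    (fun x : M ↦ TangentSpace I x →L[ℝ] TangentSpace I x) x₀).mdifferentiableAt_section_iff
    I σ (b₀ := y) ⟨hy, hy⟩
  refine h.trans ?_
  rw [mdifferentiableAt_iff_chart hy]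
  rfl

lemma mdifferentiableAt_end_apply {σ : Π x : M, TangentSpace I x →L[ℝ] TangentSpace I x} {x₀ y : M}
    (hy : y ∈ (chartAt H x₀).source) (hσ : DifferentiableAt ℝ (endRep σ x₀) (extChartAt I x₀ y))
    (W : Π x : M, TangentSpace I x) (hW : MDiffAt (T% W) y) :
    MDiffAt (T% (fun x ↦ σ x (W x))) y := by
  rw [mdifferentiableAt_section_iff hy] at hW ⊢
  refine (hσ.clm_apply hW).congr_of_eventuallyEq ?_
  filter_upwards [eventually_mem_target hy] with z hz
  simp only [localRep, endRep, ContinuousLinearMap.comp_apply, frameAt_coordAt (extChartAt_symm_mem hz)]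

lemma nablaEnd_leviCivita_eq (g : SmoothMetric I M)
    {σ : Π x : M, TangentSpace I x →L[ℝ] TangentSpace I x} {x₀ y : M}
    (hy : y ∈ (chartAt H x₀).source) (hσ : DifferentiableAt ℝ (endRep σ x₀) (extChartAt I x₀ y))
    (a w : E) :
    nablaEnd (leviCivita g) σ y (frameAt I x₀ y a) (frameAt I x₀ y w) = frameAt I x₀ y
      (fderiv ℝ (endRep σ x₀) (extChartAt I x₀ y) a w
        + localChr (formRep g.inner x₀) (extChartAt I x₀ y) a (endRep σ x₀ (extChartAt I x₀ y) w)
        - endRep σ x₀ (extChartAt I x₀ y) (localChr (formRep g.inner x₀) (extChartAt I x₀ y) a w)) := by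
  have h1 := nablaEnd_apply (leviCivita g) (mdifferentiableAt_end_apply hy hσ)
    (contMDiffAt_frame x₀ hy w) (frameAt I x₀ y a)
  have h2 : localRep x₀ (fun x ↦ σ x (frameAt I x₀ x w)) = fun z ↦ endRep σ x₀ z w := rfl
  have h3 (b : E) : σ y (frameAt I x₀ y b) = frameAt I x₀ y (endRep σ x₀ (extChartAt I x₀ y) b) := by
    rw [endRep, extChartAt_leftInv hy]
    exact (frameAt_coordAt hy _).symm
  rw [h1, leviCivita_frame g hy, leviCivita_eq g hy (mdifferentiableAt_end_apply hy hσ _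
    (contMDiffAt_frame x₀ hy w)), h2, h3, h3, coordAt_frameAt hy, ← map_sub,
    (hσ.hasFDerivAt.clm_apply (hasFDerivAt_const w _)).fderiv]
  simp

/-- The frame of the chart carries the coordinate basis at `y` to a basis of the model space, and
the trace form does not depend on the basis. -/
lemma tensorInner_eq (g : SmoothMetric I M) {x₀ y : M} (hy : y ∈ (chartAt H x₀).source)
    (A B : TangentSpace I y →L[ℝ] TangentSpace I y) :
    tensorInner g y A B = traceForm (formRep g.inner x₀ (extChartAt I x₀ y))
      (coordAt I x₀ y ∘L A ∘L frameAt I x₀ y) (coordAt I x₀ y ∘L B ∘L frameAt I x₀ y) := by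
  have hz := extChartAt_target_mem (I := I) hy
  have hm := isLocalMetric_formRep g x₀
  let e' : TangentSpace I y ≃ₗ[ℝ] E := LinearEquiv.ofLinearMap (coordAt I x₀ y).toLinearMap
    (frameAt I x₀ y).toLinearMap (by ext w; exact coordAt_frameAt hy w)
    (by ext w; exact frameAt_coordAt hy w)
  have he' (v : TangentSpace I y) : e' v = coordAt I x₀ y v := rfl
  rw [← sum_gram_inv (hm.symm _ hz) (hm.pos _ hz) ((coordBasis I y).map e')]
  simp only [tensorInner, gInv, Module.Basis.map_apply, he', ContinuousLinearMap.comp_apply,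
    frameAt_coordAt hy, ← inner_eq_formRep g hy]

end LocalConnection

/-! ### The induced charts of the tensor bundle -/

section TensorBundleCoordinates

variable {E : Type*} [NormedAddCommGroup E] [NormedSpace ℝ E] [FiniteDimensional ℝ E]
  {M : Type*} [TopologicalSpace M] [ChartedSpace E M] [IsManifold 𝓘(ℝ, E) ∞ M]

/-- The coordinates of a `(1,1)` tensor at `y` in the preferred chart at `x₀`. -/
def endAt (x₀ y : M) : Tensor11 E y →ₗ[ℝ] (E →L[ℝ] E) where
  toFun A := coordAt 𝓘(ℝ, E) x₀ y ∘L A ∘L frameAt 𝓘(ℝ, E) x₀ y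
  map_add' A B := by ext w; simp
  map_smul' c A := by ext w; simp

lemma endAt_apply (x₀ y : M) (A : Tensor11 E y) (w : E) :
    endAt x₀ y A w = coordAt 𝓘(ℝ, E) x₀ y (A (frameAt 𝓘(ℝ, E) x₀ y w)) := rfl

lemma apply_frameAt {x₀ y : M} (hy : y ∈ (chartAt E x₀).source) (A : Tensor11 E y) (w : E) :
    A (frameAt 𝓘(ℝ, E) x₀ y w) = frameAt 𝓘(ℝ, E) x₀ y (endAt x₀ y A w) := by
  rw [endAt_apply, frameAt_coordAt hy]

lemma mem_chart_T11_iff {u₀ p : T11 E M} :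
    p ∈ (chartAt (ModelProd E (E →L[ℝ] E)) u₀).source ↔ p.1 ∈ (chartAt E u₀.1).source := by
  rw [FiberBundle.chartedSpace_chartAt]
  simp only [mfld_simps]
  exact ⟨fun h ↦ h.1, fun h ↦ ⟨h, h⟩⟩

/-- By definition the bundle chart is the trivialization of the endomorphism bundle followed by the
chart of the base. These are the induced coordinates `(xʲ, tⁱⱼ)`. -/
lemma extChartAt_T11 (u₀ p : T11 E M) :
    extChartAt (T11Model E) u₀ p = (extChartAt 𝓘(ℝ, E) u₀.1 p.1, endAt u₀.1 p.1 p.2) := by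
  rfl

lemma extChartAt_T11_symm_fst {u₀ : T11 E M} {q : E × (E →L[ℝ] E)}
    (hq : q ∈ (extChartAt (T11Model E) u₀).target) :
    ((extChartAt (T11Model E) u₀).symm q).1 = (extChartAt 𝓘(ℝ, E) u₀.1).symm q.1 ∧
    q.1 ∈ (extChartAt 𝓘(ℝ, E) u₀.1).target := by
  have h1 := (extChartAt (T11Model E) u₀).right_inv hq
  have h2 := mem_chart_T11_iff.1 (extChartAt_symm_mem hq)
  rw [extChartAt_T11] at h1
  rw [← congrArg Prod.fst h1]
  exact ⟨(extChartAt_leftInv h2).symm, extChartAt_target_mem h2⟩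

lemma endAt_extChartAt_symm {u₀ : T11 E M} {q : E × (E →L[ℝ] E)}
    (hq : q ∈ (extChartAt (T11Model E) u₀).target) :
    endAt u₀.1 ((extChartAt (T11Model E) u₀).symm q).1 ((extChartAt (T11Model E) u₀).symm q).2
      = q.2 := by
  have h1 := (extChartAt (T11Model E) u₀).right_inv hq
  rw [extChartAt_T11] at h1
  exact congrArg Prod.snd h1

lemma endAt_self (x : M) (A : Tensor11 E x) : endAt x x A = A := by
  ext w
  rw [endAt_apply, frameAt_self]
  exact coordAt_self _ _

end TensorBundleCoordinates

section MFDeriv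
variable {E : Type*} [NormedAddCommGroup E] [NormedSpace ℝ E] [FiniteDimensional ℝ E]
  {H : Type*} [TopologicalSpace H] {I : ModelWithCorners ℝ E H} [I.Boundaryless]
  {M : Type*} [TopologicalSpace M] [ChartedSpace H M] [IsManifold I ∞ M]
  {E' : Type*} [NormedAddCommGroup E'] [NormedSpace ℝ E']
  {H' : Type*} [TopologicalSpace H'] {I' : ModelWithCorners ℝ E' H'}
  {N : Type*} [TopologicalSpace N] [ChartedSpace H' N]

/-- `coordAt` is the derivative of the chart, so this is the chain rule. It is applied below to
fibre inclusions, to sections and to the projection. -/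
lemma coordAt_mfderiv {F : N → M} {n : N} {x₀ : M} (hn : F n ∈ (chartAt H x₀).source)
    (hF : MDifferentiableAt I' I F n) (ξ : TangentSpace I' n) :
    coordAt I x₀ (F n) (mfderiv I' I F n ξ) =
      mfderiv I' 𝓘(ℝ, E) (fun n ↦ extChartAt I x₀ (F n)) n ξ := by
  rw [coordAt_eq_mfderiv hn]
  exact (mfderiv_comp_apply (I' := I) n ((contMDiffAt_chart hn).mdifferentiableAt (by simp)) hF ξ).symm

end MFDeriv

/-! ### Vertical and horizontal lifts in an arbitrary induced chart -/

section TensorBundleCoordinates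

variable {E : Type*} [NormedAddCommGroup E] [NormedSpace ℝ E] [FiniteDimensional ℝ E]
  {M : Type*} [TopologicalSpace M] [ChartedSpace E M] [IsManifold 𝓘(ℝ, E) ∞ M]

/-- The inclusion of the fibre over `x` into the tensor bundle. -/
def fibreMk (x : M) (A : E →L[ℝ] E) : T11 E M := ⟨x, A⟩

/-- The endomorphism `endAt x₀ x` of `E →L[ℝ] E`. -/
def endCLM (x₀ x : M) : (E →L[ℝ] E) →L[ℝ] (E →L[ℝ] E) :=
  LinearMap.toContinuousLinearMap (endAt x₀ x)

lemma mdifferentiableAt_fibreMk (x : M) (A : E →L[ℝ] E) :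
    MDifferentiableAt 𝓘(ℝ, E →L[ℝ] E) (T11Model E) (fibreMk x) A := by
  rw [mdifferentiableAt_totalSpace]
  have h : MDifferentiableAt 𝓘(ℝ, E →L[ℝ] E) 𝓘(ℝ, E →L[ℝ] E) (endCLM x x) A :=
    (endCLM (E := E) x x).mdifferentiableAt
  exact ⟨mdifferentiableAt_const, h⟩

lemma coordAt_mfderiv_fibreMk {x : M} {u₀ : T11 E M} (hx : x ∈ (chartAt E u₀.1).source)
    (A B : E →L[ℝ] E) :
    coordAt (T11Model E) u₀ (fibreMk x A)
      (mfderiv 𝓘(ℝ, E →L[ℝ] E) (T11Model E) (fibreMk x) A B) = (0, endCLM u₀.1 x B) := by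
  refine (coordAt_mfderiv (mem_chart_T11_iff.2 hx) (mdifferentiableAt_fibreMk x A) B).trans ?_
  have : (fun A : E →L[ℝ] E ↦ extChartAt (T11Model E) u₀ (fibreMk x A)) =
    fun A : E →L[ℝ] E ↦ (extChartAt 𝓘(ℝ, E) u₀.1 x, endCLM u₀.1 x A) := rfl
  rw [this, mfderiv_eq_fderiv]
  have h := (hasFDerivAt_const (extChartAt 𝓘(ℝ, E) u₀.1 x) A).prodMk
    (endCLM u₀.1 x).hasFDerivAt
  exact congrArg (fun L ↦ L B) h.fderiv

lemma mfderiv_fibreMk (x : M) (A B : E →L[ℝ] E) :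
      mfderiv 𝓘(ℝ, E →L[ℝ] E) (T11Model E) (fibreMk x) A B = vLift (fibreMk x A) B := by
  have h := coordAt_mfderiv_fibreMk (u₀ := fibreMk x A) (mem_chart_source E x) A B
  rw [coordAt_self] at h
  exact h.trans (congrArg (Prod.mk (0 : E)) (endAt_self x B))

/-- `vLift` is defined in the chart preferred at its own point. As the derivative of the fibre
inclusion it has an invariant meaning, and the inclusion is linear in the fibre coordinates of every
induced chart. -/
lemma coordAt_vLift {u₀ p : T11 E M} (hp : p.1 ∈ (chartAt E u₀.1).source) (A : Tensor11 E p.1) :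
    coordAt (T11Model E) u₀ p (vLift p A) = (0, endAt u₀.1 p.1 A) := by
  refine Eq.trans ?_ (coordAt_mfderiv_fibreMk hp p.2 A)
  exact congrArg (coordAt (T11Model E) u₀ p) (mfderiv_fibreMk (E := E) p.1 p.2 A).symm

lemma mdifferentiableAt_T11_section_iff (σ : Π x : M, Tensor11 E x) {x₀ y : M}
    (hy : y ∈ (chartAt E x₀).source) :
    MDifferentiableAt 𝓘(ℝ, E) (T11Model E) (fun x ↦ (⟨x, σ x⟩ : T11 E M)) y ↔
      DifferentiableAt ℝ (endRep σ x₀) (extChartAt 𝓘(ℝ, E) x₀ y) :=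
  mdifferentiableAt_end_iff σ hy

/-- In coordinates a section is the graph `z ↦ (z, σ z)`. -/
lemma coordAt_mfderiv_section {σ : Π x : M, Tensor11 E x} {u₀ : T11 E M} {y : M}
    (hy : y ∈ (chartAt E u₀.1).source)
    (hσ : DifferentiableAt ℝ (endRep σ u₀.1) (extChartAt 𝓘(ℝ, E) u₀.1 y)) (a : E) :
    coordAt (T11Model E) u₀ ⟨y, σ y⟩ (mfderiv 𝓘(ℝ, E) (T11Model E)
      (fun x ↦ (⟨x, σ x⟩ : T11 E M)) y (frameAt 𝓘(ℝ, E) u₀.1 y a)) =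
      (a, fderiv ℝ (endRep σ u₀.1) (extChartAt 𝓘(ℝ, E) u₀.1 y) a) := by
  have hS := (mdifferentiableAt_T11_section_iff σ hy).2 hσ
  have hc : MDifferentiableAt 𝓘(ℝ, E) 𝓘(ℝ, E × (E →L[ℝ] E))
      (fun x ↦ extChartAt (T11Model E) u₀ (⟨x, σ x⟩ : T11 E M)) y :=
    MDifferentiableAt.comp (I' := T11Model E) (f := fun x ↦ (⟨x, σ x⟩ : T11 E M)) y
      ((contMDiffAt_chart (I := T11Model E) (x₀ := u₀) (y := (⟨y, σ y⟩ : T11 E M)) (mem_chart_T11_iff.2 hy)).mdifferentiableAt (by simp)) hS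
  rw [coordAt_mfderiv (F := fun x ↦ (⟨x, σ x⟩ : T11 E M)) (mem_chart_T11_iff.2 hy) hS]
  have h := mvfderiv_eq_fderiv hy hc (frameAt 𝓘(ℝ, E) u₀.1 y a)
  have he : (fun x ↦ extChartAt (T11Model E) u₀ (⟨x, σ x⟩ : T11 E M)) ∘
      (extChartAt 𝓘(ℝ, E) u₀.1).symm =ᶠ[𝓝 (extChartAt 𝓘(ℝ, E) u₀.1 y)]
      fun z ↦ (z, endRep σ u₀.1 z) := by
    filter_upwards [eventually_mem_target hy] with z hz
    exact Prod.ext ((extChartAt 𝓘(ℝ, E) u₀.1).right_inv hz) rfl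
  rw [he.fderiv_eq, (HasFDerivAt.prodMk (f₁ := fun z ↦ z) (hasFDerivAt_id _) hσ.hasFDerivAt).fderiv, coordAt_frameAt hy] at h
  exact h

lemma christoffel_frameAt (g : SmoothMetric 𝓘(ℝ, E) M) (x : M) (v w : E) :
    christoffel (leviCivita g) x (frameAt 𝓘(ℝ, E) x x v) (frameAt 𝓘(ℝ, E) x x w) =
      frameAt 𝓘(ℝ, E) x x (localChr (formRep g.inner x) (extChartAt 𝓘(ℝ, E) x x) v w) := by
  have hx := mem_chart_source E x
  have key (v w : E) : leviCivita g (extend E (frameAt 𝓘(ℝ, E) x x w)) x (frameAt 𝓘(ℝ, E) x x v) =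
      frameAt 𝓘(ℝ, E) x x (localChr (formRep g.inner x) (extChartAt 𝓘(ℝ, E) x x) v w) := by
    rw [covariantDerivative_congr _ (mdifferentiableAt_extend _ _ _) (extend_eventuallyEq x w),
      leviCivita_frame g hx]
  let L : E →L[ℝ] E →L[ℝ] E := localChr (formRep g.inner x) (extChartAt 𝓘(ℝ, E) x x)
  let L' : TangentSpace 𝓘(ℝ, E) x →L[ℝ] TangentSpace 𝓘(ℝ, E) x →L[ℝ] TangentSpace 𝓘(ℝ, E) x := L
  have : christoffel (leviCivita g) x = L' := by
    refine extendLinear_eq _ fun v ↦ extendLinear_eq _ fun w ↦ ?_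
    obtain ⟨v, rfl⟩ := exists_frameAt_self x v
    obtain ⟨w, rfl⟩ := exists_frameAt_self x w
    refine (key v w).trans ?_
    rw [frameAt_self, frameAt_self, frameAt_self]
    rfl
  rw [this, frameAt_self, frameAt_self, frameAt_self]
  rfl

lemma nablaEnd_self (g : SmoothMetric 𝓘(ℝ, E) M) {σ : Π x : M, Tensor11 E x} {y : M}
    (hσ : DifferentiableAt ℝ (endRep σ y) (extChartAt 𝓘(ℝ, E) y y)) (v : E) :
    nablaEnd (leviCivita g) σ y (frameAt 𝓘(ℝ, E) y y v) =
      frameAt 𝓘(ℝ, E) y y ∘L fderiv ℝ (endRep σ y) (extChartAt 𝓘(ℝ, E) y y) v ∘L coordAt 𝓘(ℝ, E) y y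
      + (christoffel (leviCivita g) y (frameAt 𝓘(ℝ, E) y y v) ∘L σ y
        - σ y ∘L christoffel (leviCivita g) y (frameAt 𝓘(ℝ, E) y y v)) := by
  have hy := mem_chart_source E y
  ext w
  obtain ⟨w, rfl⟩ := exists_frameAt_self y w
  have h3 : endRep σ y (extChartAt 𝓘(ℝ, E) y y) = endAt y y (σ y) := by
    rw [endRep, extChartAt_leftInv hy]
    rfl
  refine (nablaEnd_leviCivita_eq g hy hσ v w).trans ?_
  change _ = frameAt 𝓘(ℝ, E) y y (fderiv ℝ (endRep σ y) (extChartAt 𝓘(ℝ, E) y y) v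
    (coordAt 𝓘(ℝ, E) y y (frameAt 𝓘(ℝ, E) y y w))) + (christoffel (leviCivita g) y
      (frameAt 𝓘(ℝ, E) y y v) (σ y (frameAt 𝓘(ℝ, E) y y w)) - σ y (christoffel (leviCivita g) y
      (frameAt 𝓘(ℝ, E) y y v) (frameAt 𝓘(ℝ, E) y y w)))
  rw [apply_frameAt hy (σ y) w, christoffel_frameAt, christoffel_frameAt, apply_frameAt hy (σ y), h3,
    coordAt_frameAt hy]
  simp only [frameAt_self]
  exact add_sub_assoc (G := E) _ _ _

/-- The invariant meaning of the horizontal lift: the vertical part of `dσ(v)` is the covariant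
derivative. In coordinates, the terms `σ Γ_v - Γ_v σ` of the lift cancel those of `∇_v σ`, leaving
`dσ`. -/
lemma mfderiv_section (g : SmoothMetric 𝓘(ℝ, E) M) {σ : Π x : M, Tensor11 E x} {y : M}
    (hσ : DifferentiableAt ℝ (endRep σ y) (extChartAt 𝓘(ℝ, E) y y)) (v : TangentSpace 𝓘(ℝ, E) y) :
    mfderiv 𝓘(ℝ, E) (T11Model E) (fun x ↦ (⟨x, σ x⟩ : T11 E M)) y v =
      hLift g ⟨y, σ y⟩ v + vLift ⟨y, σ y⟩ (nablaEnd (leviCivita g) σ y v) := by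
  have hy := mem_chart_source E y
  obtain ⟨v, rfl⟩ := exists_frameAt_self y v
  have h := coordAt_mfderiv_section (u₀ := ⟨y, σ y⟩) hy hσ v
  rw [coordAt_self] at h
  have hF : frameAt 𝓘(ℝ, E) y y ∘L fderiv ℝ (endRep σ y) (extChartAt 𝓘(ℝ, E) y y) v ∘L
      coordAt 𝓘(ℝ, E) y y = fderiv ℝ (endRep σ y) (extChartAt 𝓘(ℝ, E) y y) v := by
    ext w
    simp only [ContinuousLinearMap.comp_apply, coordAt_self, frameAt_self]
    rfl
  rw [nablaEnd_self g hσ, hF]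
  refine h.trans (Prod.ext ?_ ?_)
  · refine Eq.trans ?_ (add_zero (M := E) _).symm
    exact (frameAt_self y v).symm
  · rw [frameAt_self]
    set F : E →L[ℝ] E := fderiv ℝ (endRep σ y) (extChartAt 𝓘(ℝ, E) y y) v
    have (F A B : E →L[ℝ] E) : F = A - B + (F + (B - A)) := by abel
    exact this _ _ _

/-- The same formula holds in every induced chart. Take a section through the given tensor with
constant coordinates in that chart: its derivative is `(a, 0)`, and subtracting the lift of its
covariant derivative `Γ_a t - t Γ_a` leaves the horizontal lift. -/
lemma coordAt_hLift (g : SmoothMetric 𝓘(ℝ, E) M) {u₀ p : T11 E M}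
    (hp : p.1 ∈ (chartAt E u₀.1).source) (a : E) :
    coordAt (T11Model E) u₀ p (hLift g p (frameAt 𝓘(ℝ, E) u₀.1 p.1 a)) =
      (a, endAt u₀.1 p.1 p.2 ∘L localChr (formRep g.inner u₀.1) (extChartAt 𝓘(ℝ, E) u₀.1 p.1) a
        - localChr (formRep g.inner u₀.1) (extChartAt 𝓘(ℝ, E) u₀.1 p.1) a ∘L endAt u₀.1 p.1 p.2) := by
  obtain ⟨y, t⟩ := p
  change y ∈ (chartAt E u₀.1).source at hp
  let σ : Π x : M, Tensor11 E x := fun x ↦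
    frameAt 𝓘(ℝ, E) u₀.1 x ∘L endAt u₀.1 y t ∘L coordAt 𝓘(ℝ, E) u₀.1 x
  have hσy : σ y = t := by
    ext v
    simp only [σ, ContinuousLinearMap.comp_apply, endAt_apply, frameAt_coordAt hp]
  have hrep : endRep σ u₀.1 =ᶠ[𝓝 (extChartAt 𝓘(ℝ, E) u₀.1 y)] fun _ ↦ endAt u₀.1 y t := by
    filter_upwards [eventually_mem_target hp] with z hz
    ext w
    simp only [endRep, σ, ContinuousLinearMap.comp_apply, coordAt_frameAt (extChartAt_symm_mem hz)]
  have hd : DifferentiableAt ℝ (endRep σ u₀.1) (extChartAt 𝓘(ℝ, E) u₀.1 y) :=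
    (differentiableAt_const _).congr_of_eventuallyEq hrep
  -- Differentiability passes from the chart at `u₀.1` to the preferred chart at `y` through the
  -- invariant notion for sections.
  have hdy : DifferentiableAt ℝ (endRep σ y) (extChartAt 𝓘(ℝ, E) y y) :=
    (mdifferentiableAt_T11_section_iff σ (mem_chart_source E y)).1
      ((mdifferentiableAt_T11_section_iff σ hp).2 hd)
  have h1 := coordAt_mfderiv_section hp hd a
  rw [mfderiv_section g hdy, map_add, coordAt_vLift hp, hrep.fderiv_eq, hσy] at h1
  simp only [fderiv_fun_const, Pi.zero_apply, zero_apply] at h1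
  rw [eq_sub_of_add_eq h1]
  refine Prod.ext (sub_zero a) ?_
  refine (zero_sub _).trans ?_
  ext w
  have h2 := nablaEnd_leviCivita_eq g hp hd a w
  rw [hrep.fderiv_eq, hrep.eq_of_nhds] at h2
  rw [neg_apply, endAt_apply]
  refine (congrArg (fun v ↦ - coordAt 𝓘(ℝ, E) u₀.1 y v) h2).trans ?_
  rw [coordAt_frameAt hp]
  simp

end TensorBundleCoordinates

/-! ### Lie brackets of lifts over a vector space -/

section FlatLifts

variable {E : Type*} [NormedAddCommGroup E] [NormedSpace ℝ E]

/-- The fibre component of the horizontal lift of `v` at `s`, for the Christoffel operator `Γ`. -/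
def horizontalCoord (Γ : E →L[ℝ] E →L[ℝ] E) (s : E →L[ℝ] E) (v : E) : E →L[ℝ] E :=
  s ∘L Γ v - Γ v ∘L s

variable {Γ : E → E →L[ℝ] E →L[ℝ] E} {X Y : E → E} {A B : E → E →L[ℝ] E} {z : E} {s : E →L[ℝ] E}

lemma differentiableAt_horizontal (hΓ : DifferentiableAt ℝ Γ z) (hY : DifferentiableAt ℝ Y z) :
    DifferentiableAt ℝ (fun q : E × (E →L[ℝ] E) ↦
      (Y q.1, horizontalCoord (Γ q.1) q.2 (Y q.1))) (z, s) := by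
  have h1 : DifferentiableAt ℝ (fun q : E × (E →L[ℝ] E) ↦ Γ q.1) (z, s) :=
    hΓ.comp (z, s) differentiableAt_fst
  have h2 : DifferentiableAt ℝ (fun q : E × (E →L[ℝ] E) ↦ Y q.1) (z, s) :=
    hY.comp (z, s) differentiableAt_fst
  have h3 : DifferentiableAt ℝ (fun q : E × (E →L[ℝ] E) ↦ Γ q.1 (Y q.1)) (z, s) := h1.clm_apply h2
  exact h2.prodMk ((differentiableAt_snd.clm_comp h3).sub (h3.clm_comp differentiableAt_snd))

lemma fderiv_horizontal (hΓ : DifferentiableAt ℝ Γ z) (hY : DifferentiableAt ℝ Y z)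
    (a : E) (S : E →L[ℝ] E) :
    fderiv ℝ (fun q : E × (E →L[ℝ] E) ↦ (Y q.1, horizontalCoord (Γ q.1) q.2 (Y q.1))) (z, s) (a, S) =
      (fderiv ℝ Y z a, horizontalCoord (Γ z) S (Y z)
        + horizontalCoord (fderiv ℝ Γ z a) s (Y z) + horizontalCoord (Γ z) s (fderiv ℝ Y z a)) := by
  have h1 : HasFDerivAt (fun q : E × (E →L[ℝ] E) ↦ Γ q.1) _ (z, s) :=
    hΓ.hasFDerivAt.comp (z, s) hasFDerivAt_fst
  have h2 : HasFDerivAt (fun q : E × (E →L[ℝ] E) ↦ Y q.1) _ (z, s) :=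
    hY.hasFDerivAt.comp (z, s) hasFDerivAt_fst
  have h3 : HasFDerivAt (fun q : E × (E →L[ℝ] E) ↦ Γ q.1 (Y q.1)) _ (z, s) := h1.clm_apply h2
  have h := h2.prodMk ((hasFDerivAt_snd.clm_comp h3).sub (h3.clm_comp hasFDerivAt_snd))
  refine (congrArg (fun L ↦ L (a, S)) h.fderiv).trans ?_
  refine Prod.ext rfl ?_
  ext w
  simp [horizontalCoord]
  abel

lemma differentiableAt_vertical (hA : DifferentiableAt ℝ A z) :
    DifferentiableAt ℝ (fun q : E × (E →L[ℝ] E) ↦ ((0 : E), A q.1)) (z, s) :=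
  (differentiableAt_const 0).prodMk (hA.comp (z, s) differentiableAt_fst)

lemma fderiv_vertical (hA : DifferentiableAt ℝ A z) (a : E) (S : E →L[ℝ] E) :
    fderiv ℝ (fun q : E × (E →L[ℝ] E) ↦ ((0 : E), A q.1)) (z, s) (a, S) = (0, fderiv ℝ A z a) := by
  have h : HasFDerivAt (fun q : E × (E →L[ℝ] E) ↦ ((0 : E), A q.1)) _ (z, s) :=
    (hasFDerivAt_const 0 _).prodMk (hA.hasFDerivAt.comp (z, s) hasFDerivAt_fst)
  exact congrArg (fun L ↦ L (a, S)) h.fderiv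

/-- Derivatives of `X` and `Y` combine into the lift of `[X, Y]`. What remains is the curvature
`dΓ(X) Y - dΓ(Y) X + [Γ_X, Γ_Y]`, acting on `s` by a commutator. -/
lemma lieBracket_horizontal (hΓ : DifferentiableAt ℝ Γ z) (hX : DifferentiableAt ℝ X z)
    (hY : DifferentiableAt ℝ Y z) :
    lieBracket ℝ (fun q : E × (E →L[ℝ] E) ↦ (X q.1, horizontalCoord (Γ q.1) q.2 (X q.1)))
        (fun q ↦ (Y q.1, horizontalCoord (Γ q.1) q.2 (Y q.1))) (z, s) =
      (lieBracket ℝ X Y z, horizontalCoord (Γ z) s (lieBracket ℝ X Y z) +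
        (s ∘L (fderiv ℝ Γ z (X z) (Y z) - fderiv ℝ Γ z (Y z) (X z)
            + Γ z (X z) ∘L Γ z (Y z) - Γ z (Y z) ∘L Γ z (X z))
          - (fderiv ℝ Γ z (X z) (Y z) - fderiv ℝ Γ z (Y z) (X z)
            + Γ z (X z) ∘L Γ z (Y z) - Γ z (Y z) ∘L Γ z (X z)) ∘L s)) := by
  rw [lieBracket, fderiv_horizontal hΓ hX, fderiv_horizontal hΓ hY]
  refine Prod.ext rfl ?_
  ext w
  simp only [lieBracket, horizontalCoord, Prod.snd_sub, sub_apply, add_apply, map_sub, map_add,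
    ContinuousLinearMap.comp_apply]
  abel

/-- The fibre coordinate enters the horizontal lift linearly, so its derivative along `A` supplies
exactly the `Γ` terms of the covariant derivative of `A`. -/
lemma lieBracket_horizontal_vertical (hΓ : DifferentiableAt ℝ Γ z) (hX : DifferentiableAt ℝ X z)
    (hA : DifferentiableAt ℝ A z) :
    lieBracket ℝ (fun q : E × (E →L[ℝ] E) ↦ (X q.1, horizontalCoord (Γ q.1) q.2 (X q.1)))
        (fun q ↦ (0, A q.1)) (z, s) =
      (0, fderiv ℝ A z (X z) + Γ z (X z) ∘L A z - A z ∘L Γ z (X z)) := by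
  rw [lieBracket, fderiv_horizontal hΓ hX, fderiv_vertical hA]
  refine Prod.ext (by simp) ?_
  ext w
  simp [horizontalCoord]
  abel

lemma lieBracket_vertical (hA : DifferentiableAt ℝ A z) (hB : DifferentiableAt ℝ B z) :
    lieBracket ℝ (fun q : E × (E →L[ℝ] E) ↦ ((0 : E), A q.1)) (fun q ↦ (0, B q.1)) (z, s) = 0 := by
  rw [lieBracket, fderiv_vertical hA, fderiv_vertical hB]
  simp

end FlatLifts

/-! ### Lie brackets of lifts and derivatives of pulled-back functions on the tensor bundle -/

section Lifts

variable {E : Type*} [NormedAddCommGroup E] [NormedSpace ℝ E] [FiniteDimensional ℝ E]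
  {M : Type*} [TopologicalSpace M] [ChartedSpace E M] [IsManifold 𝓘(ℝ, E) ∞ M]

lemma localRep_vLift (B : Π x : M, Tensor11 E x) {u₀ : T11 E M} {q : E × (E →L[ℝ] E)}
    (hq : q ∈ (extChartAt (T11Model E) u₀).target) :
    localRep u₀ (fun p : T11 E M ↦ vLift p (B p.1)) q = (0, endRep B u₀.1 q.1) := by
  refine (coordAt_vLift (mem_chart_T11_iff.1 (extChartAt_symm_mem hq)) _).trans ?_
  rw [(extChartAt_T11_symm_fst hq).1]
  rfl

lemma localRep_hLift (g : SmoothMetric 𝓘(ℝ, E) M) (Y : Π x : M, TangentSpace 𝓘(ℝ, E) x)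
    {u₀ : T11 E M} {q : E × (E →L[ℝ] E)} (hq : q ∈ (extChartAt (T11Model E) u₀).target) :
    localRep u₀ (fun p : T11 E M ↦ hLift g p (Y p.1)) q =
      (localRep u₀.1 Y q.1,
        horizontalCoord (localChr (formRep g.inner u₀.1) q.1) q.2 (localRep u₀.1 Y q.1)) := by
  have hp := mem_chart_T11_iff.1 (extChartAt_symm_mem hq)
  have h := coordAt_hLift g hp (coordAt 𝓘(ℝ, E) u₀.1 _ (Y ((extChartAt (T11Model E) u₀).symm q).1))
  rw [frameAt_coordAt hp, endAt_extChartAt_symm hq, (extChartAt_T11_symm_fst hq).1,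
    (extChartAt 𝓘(ℝ, E) u₀.1).right_inv (extChartAt_T11_symm_fst hq).2] at h
  exact h

/-- Differentiability at `p` of a vector field on the tensor bundle. -/
abbrev FieldDiffAt (V : Π p : T11 E M, TangentSpace (T11Model E) p) (p : T11 E M) : Prop :=
  MDifferentiableAt (T11Model E) ((T11Model E).prod 𝓘(ℝ, E × (E →L[ℝ] E)))
    (fun p ↦ TotalSpace.mk' (E × (E →L[ℝ] E)) p (V p)) p

variable (g : SmoothMetric 𝓘(ℝ, E) M) {X Y : Π x : M, TangentSpace 𝓘(ℝ, E) x}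
  {A B : Π x : M, Tensor11 E x} {p : T11 E M}

lemma differentiableAt_localChr {x₀ y : M} (hy : y ∈ (chartAt E x₀).source) :
    DifferentiableAt ℝ (localChr (formRep g.inner x₀)) (extChartAt 𝓘(ℝ, E) x₀ y) :=
  ((isLocalMetric_formRep g x₀).contDiffAt_localChr (extChartAt_target_mem hy)).differentiableAt
    (by simp)

lemma eventuallyEq_localRep_hLift (Y : Π x : M, TangentSpace 𝓘(ℝ, E) x) :
    localRep p (fun p : T11 E M ↦ hLift g p (Y p.1)) =ᶠ[𝓝 (extChartAt (T11Model E) p p)]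
      fun q ↦ (localRep p.1 Y q.1,
        horizontalCoord (localChr (formRep g.inner p.1) q.1) q.2 (localRep p.1 Y q.1)) := by
  filter_upwards [eventually_mem_target (mem_chart_source (ModelProd E (E →L[ℝ] E)) p)] with q hq
  exact localRep_hLift g Y hq

lemma eventuallyEq_localRep_vLift (A : Π x : M, Tensor11 E x) :
    localRep p (fun p : T11 E M ↦ vLift p (A p.1)) =ᶠ[𝓝 (extChartAt (T11Model E) p p)]
      fun q ↦ (0, endRep A p.1 q.1) := by
  filter_upwards [eventually_mem_target (mem_chart_source (ModelProd E (E →L[ℝ] E)) p)] with q hq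
  exact localRep_vLift A hq

lemma mdifferentiableAt_hLift (hY : MDiffAt (T% Y) p.1) :
    FieldDiffAt (fun p : T11 E M ↦ hLift g p (Y p.1)) p := by
  have hp := mem_chart_source E p.1
  rw [mdifferentiableAt_section_iff hp] at hY
  refine (mdifferentiableAt_section_iff (mem_chart_source (ModelProd E (E →L[ℝ] E)) p)).2 ?_
  refine DifferentiableAt.congr_of_eventuallyEq ?_ (eventuallyEq_localRep_hLift g Y)
  exact differentiableAt_horizontal (s := endAt p.1 p.1 p.2) (differentiableAt_localChr g hp) hY

lemma mdifferentiableAt_vLift (hA : DifferentiableAt ℝ (endRep A p.1) (extChartAt 𝓘(ℝ, E) p.1 p.1)) :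
    FieldDiffAt (fun p : T11 E M ↦ vLift p (A p.1)) p := by
  refine (mdifferentiableAt_section_iff (mem_chart_source (ModelProd E (E →L[ℝ] E)) p)).2 ?_
  refine DifferentiableAt.congr_of_eventuallyEq ?_ (eventuallyEq_localRep_vLift A)
  exact differentiableAt_vertical (s := endAt p.1 p.1 p.2) hA

/-- The curvature operator `R(u, v)`, in terms of the coordinates of `u` and `v`. -/
def curvatureCoord (x : M) (u v : E) : E →L[ℝ] E :=
  fderiv ℝ (localChr (formRep g.inner x)) (extChartAt 𝓘(ℝ, E) x x) u v
    - fderiv ℝ (localChr (formRep g.inner x)) (extChartAt 𝓘(ℝ, E) x x) v u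
    + localChr (formRep g.inner x) (extChartAt 𝓘(ℝ, E) x x) u
      ∘L localChr (formRep g.inner x) (extChartAt 𝓘(ℝ, E) x x) v
    - localChr (formRep g.inner x) (extChartAt 𝓘(ℝ, E) x x) v
      ∘L localChr (formRep g.inner x) (extChartAt 𝓘(ℝ, E) x x) u

/-- The curvature operator `R(u, v)`. -/
def curvatureEnd (x : M) (u v : TangentSpace 𝓘(ℝ, E) x) : Tensor11 E x :=
  frameAt 𝓘(ℝ, E) x x ∘L curvatureCoord g x (coordAt 𝓘(ℝ, E) x x u) (coordAt 𝓘(ℝ, E) x x v) ∘L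
    coordAt 𝓘(ℝ, E) x x

lemma curvatureEnd_apply (x : M) (u v w : TangentSpace 𝓘(ℝ, E) x) :
    curvatureEnd g x u v w = curvature (leviCivita g) x u v w := by
  have hx := mem_chart_source E x
  obtain ⟨u, rfl⟩ := exists_frameAt_self x u
  obtain ⟨v, rfl⟩ := exists_frameAt_self x v
  obtain ⟨w, rfl⟩ := exists_frameAt_self x w
  rw [curvature_eq]
  simp only [curvatureEnd, ContinuousLinearMap.comp_apply, coordAt_frameAt hx]
  refine congrArg (frameAt 𝓘(ℝ, E) x x) ?_
  simp only [curvatureCoord, localCurv, add_apply, sub_apply, ContinuousLinearMap.comp_apply]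
  abel

lemma mlieBracket_hLift (hX : MDiffAt (T% X) p.1) (hY : MDiffAt (T% Y) p.1) :
    mlieBracket (T11Model E) (fun p : T11 E M ↦ hLift g p (X p.1)) (fun p ↦ hLift g p (Y p.1)) p =
      hLift g p (mlieBracket 𝓘(ℝ, E) X Y p.1) +
        vLift p (p.2 ∘L curvatureEnd g p.1 (X p.1) (Y p.1)
          - curvatureEnd g p.1 (X p.1) (Y p.1) ∘L p.2) := by
  have hp := mem_chart_source E p.1
  have hp' := mem_chart_source (ModelProd E (E →L[ℝ] E)) p
  have hX' := (mdifferentiableAt_section_iff hp).1 hX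
  have hY' := (mdifferentiableAt_section_iff hp).1 hY
  have hrX : localRep p.1 X (extChartAt 𝓘(ℝ, E) p.1 p.1) = coordAt 𝓘(ℝ, E) p.1 p.1 (X p.1) := by
    rw [localRep, extChartAt_leftInv hp]
  have hrY : localRep p.1 Y (extChartAt 𝓘(ℝ, E) p.1 p.1) = coordAt 𝓘(ℝ, E) p.1 p.1 (Y p.1) := by
    rw [localRep, extChartAt_leftInv hp]
  have hz : extChartAt (T11Model E) p p = (extChartAt 𝓘(ℝ, E) p.1 p.1, endAt p.1 p.1 p.2) := rfl
  rw [mlieBracket_eq hp' (mdifferentiableAt_hLift g hX) (mdifferentiableAt_hLift g hY),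
    (eventuallyEq_localRep_hLift g X).lieBracket_vectorField_eq (eventuallyEq_localRep_hLift g Y), hz,
    lieBracket_horizontal (differentiableAt_localChr g hp) hX' hY', hrX, hrY, ← curvatureCoord]
  have h2 := coordAt_hLift g hp (lieBracket ℝ (localRep p.1 X) (localRep p.1 Y)
    (extChartAt 𝓘(ℝ, E) p.1 p.1))
  -- Both sides are compared through their coordinates in the chart at `p`, where the lifts are
  -- explicit.
  rw [mlieBracket_eq hp hX hY, ← frameAt_coordAt hp' (_ + _), map_add, h2, coordAt_vLift hp]
  refine congrArg (frameAt (T11Model E) p p) (Prod.ext (add_zero _).symm ?_)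
  refine congrArg (horizontalCoord (localChr (formRep g.inner p.1) (extChartAt 𝓘(ℝ, E) p.1 p.1))
    (endAt p.1 p.1 p.2) (lieBracket ℝ (localRep p.1 X) (localRep p.1 Y)
      (extChartAt 𝓘(ℝ, E) p.1 p.1)) + ·) ?_
  ext w
  simp only [endAt_apply, sub_apply, ContinuousLinearMap.comp_apply, map_sub, curvatureEnd,
    coordAt_frameAt hp]

lemma mlieBracket_hLift_vLift (hX : MDiffAt (T% X) p.1)
    (hA : DifferentiableAt ℝ (endRep A p.1) (extChartAt 𝓘(ℝ, E) p.1 p.1)) :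
    mlieBracket (T11Model E) (fun p : T11 E M ↦ hLift g p (X p.1)) (fun p ↦ vLift p (A p.1)) p =
      vLift p (nablaEnd (leviCivita g) A p.1 (X p.1)) := by
  have hp := mem_chart_source E p.1
  have hp' := mem_chart_source (ModelProd E (E →L[ℝ] E)) p
  have hX' := (mdifferentiableAt_section_iff hp).1 hX
  have hz : extChartAt (T11Model E) p p = (extChartAt 𝓘(ℝ, E) p.1 p.1, endAt p.1 p.1 p.2) := rfl
  have hrX : localRep p.1 X (extChartAt 𝓘(ℝ, E) p.1 p.1) = coordAt 𝓘(ℝ, E) p.1 p.1 (X p.1) := by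
    rw [localRep, extChartAt_leftInv hp]
  rw [mlieBracket_eq hp' (mdifferentiableAt_hLift g hX) (mdifferentiableAt_vLift hA),
    (eventuallyEq_localRep_hLift g X).lieBracket_vectorField_eq (eventuallyEq_localRep_vLift A), hz,
    lieBracket_horizontal_vertical (differentiableAt_localChr g hp) hX' hA, hrX,
    ← frameAt_coordAt hp' (vLift p _), coordAt_vLift hp]
  refine congrArg (frameAt (T11Model E) p p) (Prod.ext rfl ?_)
  ext w
  obtain ⟨a, ha⟩ := exists_frameAt_self p.1 (X p.1)
  rw [ha, endAt_apply, nablaEnd_leviCivita_eq g hp hA, coordAt_frameAt hp, coordAt_frameAt hp]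
  rfl

lemma mlieBracket_vLift
    (hA : DifferentiableAt ℝ (endRep A p.1) (extChartAt 𝓘(ℝ, E) p.1 p.1))
    (hB : DifferentiableAt ℝ (endRep B p.1) (extChartAt 𝓘(ℝ, E) p.1 p.1)) :
    mlieBracket (T11Model E) (fun p : T11 E M ↦ vLift p (A p.1)) (fun p ↦ vLift p (B p.1)) p = 0 := by
  have hp' := mem_chart_source (ModelProd E (E →L[ℝ] E)) p
  have hz : extChartAt (T11Model E) p p = (extChartAt 𝓘(ℝ, E) p.1 p.1, endAt p.1 p.1 p.2) := rfl
  rw [mlieBracket_eq hp' (mdifferentiableAt_vLift hA) (mdifferentiableAt_vLift hB),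
    (eventuallyEq_localRep_vLift A).lieBracket_vectorField_eq (eventuallyEq_localRep_vLift B), hz,
    lieBracket_vertical hA hB, map_zero]

lemma mfderiv_proj (p : T11 E M) (ξ : TangentSpace (T11Model E) p) :
    mfderiv (T11Model E) 𝓘(ℝ, E) (TotalSpace.proj : T11 E M → M) p ξ = basePart ξ := by
  have hp := mem_chart_source E p.1
  have hd : MDifferentiableAt (T11Model E) 𝓘(ℝ, E) (TotalSpace.proj : T11 E M → M) p :=
    (contMDiff_proj (n := ∞) (IB := 𝓘(ℝ, E)) (fun x : M ↦ Tensor11 E x)).mdifferentiableAt (by simp)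
  have h := coordAt_mfderiv (x₀ := p.1) hp hd ξ
  have hφ : MDifferentiableAt (T11Model E) 𝓘(ℝ, E × (E →L[ℝ] E)) (extChartAt (T11Model E) p) p :=
    (contMDiffAt_chart (mem_chart_source (ModelProd E (E →L[ℝ] E)) p)).mdifferentiableAt (by simp)
  have hc := mfderiv_comp_apply (I' := 𝓘(ℝ, E × (E →L[ℝ] E))) p
    (ContinuousLinearMap.fst ℝ E (E →L[ℝ] E)).differentiableAt.mdifferentiableAt hφ ξ
  rw [← coordAt_eq_mfderiv (mem_chart_source (ModelProd E (E →L[ℝ] E)) p),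
    mfderiv_eq_fderiv, ContinuousLinearMap.fderiv] at hc
  rw [coordAt_self] at h
  exact h.trans (hc.trans (congrArg (ContinuousLinearMap.fst ℝ E (E →L[ℝ] E)) (coordAt_self p ξ)))

/-- A pulled-back function has zero derivative along vertical lifts, and along `ᴴX` the derivative
of the original function along `X`. -/
lemma mvfderiv_comp_proj {F : Type*} [NormedAddCommGroup F] [NormedSpace ℝ F] {h : M → F}
    (hh : MDiffAt h p.1) (ξ : TangentSpace (T11Model E) p) :
    mvfderiv (T11Model E) (fun p : T11 E M ↦ h p.1) p ξ = mvfderiv 𝓘(ℝ, E) h p.1 (basePart ξ) := by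
  have hd : MDifferentiableAt (T11Model E) 𝓘(ℝ, E) (TotalSpace.proj : T11 E M → M) p :=
    (contMDiff_proj (n := ∞) (IB := 𝓘(ℝ, E)) (fun x : M ↦ Tensor11 E x)).mdifferentiableAt (by simp)
  rw [← mfderiv_proj]
  exact mfderiv_comp_apply (I' := 𝓘(ℝ, E)) p hh hd ξ

end Lifts

/-- On the compact unit sphere the form attains a positive minimum `m`, so `m ‖v‖² ≤ B v v` by
homogeneity. The structure of a Riemannian metric requires this boundedness as a field. -/
lemma isVonNBounded_of_pos {V : Type*} [NormedAddCommGroup V] [NormedSpace ℝ V]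
    [FiniteDimensional ℝ V] (B : V →L[ℝ] V →L[ℝ] ℝ) (hB : ∀ v, v ≠ 0 → 0 < B v v) :
    Bornology.IsVonNBounded ℝ {v : V | B v v < 1} := by
  have : ProperSpace V := FiniteDimensional.proper ℝ V
  rw [NormedSpace.isVonNBounded_iff]
  rcases subsingleton_or_nontrivial V with hV | hV
  · exact (Set.subsingleton_of_subsingleton).finite.isBounded
  have hc : Continuous fun v : V ↦ B v v := by fun_prop
  obtain ⟨w, hw, hmin⟩ := (isCompact_sphere (0 : V) 1).exists_isMinOn
    (NormedSpace.sphere_nonempty.2 zero_le_one) hc.continuousOn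
  have hw0 : w ≠ 0 := by
    rintro rfl
    simp at hw
  have hpos := hB w hw0
  -- The radius `1 + 1/m` follows from `‖v‖² < 1/m` without taking a square root.
  refine (Metric.isBounded_iff_subset_closedBall 0).2 ⟨1 + (B w w)⁻¹, fun v hv ↦ ?_⟩
  rw [mem_closedBall_zero_iff]
  have key : B w w * ‖v‖ ^ 2 ≤ B v v := by
    rcases eq_or_ne v 0 with rfl | hv0
    · simp
    have hn := norm_pos_iff.2 hv0
    have h := hmin (show ‖v‖⁻¹ • v ∈ Metric.sphere (0 : V) 1 by
      simp [norm_smul, hn.ne'])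
    simp only [Set.mem_ofPred_eq, map_smul, smul_apply, smul_eq_mul] at h
    have : B v v = ‖v‖ ^ 2 * (‖v‖⁻¹ * (‖v‖⁻¹ * B v v)) := by field_simp
    rw [this, mul_comm]
    exact mul_le_mul_of_nonneg_left h (sq_nonneg _)
  have h1 : B w w * ‖v‖ ^ 2 < 1 := key.trans_lt hv
  have h2 : ‖v‖ ^ 2 < (B w w)⁻¹ := by
    rwa [← one_div, lt_div_iff₀' hpos]
  nlinarith [sq_nonneg (‖v‖ - 1), norm_nonneg v, inv_pos.2 hpos]

/-! ### Existence and uniqueness of the rescaled Sasaki metric -/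

section Lifts

variable {E : Type*} [NormedAddCommGroup E] [NormedSpace ℝ E] [FiniteDimensional ℝ E]
  {M : Type*} [TopologicalSpace M] [ChartedSpace E M] [IsManifold 𝓘(ℝ, E) ∞ M]
  (g : SmoothMetric 𝓘(ℝ, E) M)

lemma basePart_add {u : T11 E M} (ξ η : TangentSpace (T11Model E) u) :
    basePart (ξ + η) = basePart ξ + basePart η := rfl

lemma basePart_smul {u : T11 E M} (c : ℝ) (ξ : TangentSpace (T11Model E) u) :
    basePart (c • ξ) = c • basePart ξ := rfl

lemma basePart_hLift (u : T11 E M) (X : TangentSpace 𝓘(ℝ, E) u.1) : basePart (hLift g u X) = X := rfl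

lemma basePart_vLift (u : T11 E M) (A : Tensor11 E u.1) : basePart (vLift u A) = 0 := rfl

lemma vLift_add (u : T11 E M) (A B : Tensor11 E u.1) : vLift u (A + B) = vLift u A + vLift u B :=
  Prod.ext (add_zero (M := E) 0).symm rfl

lemma vLift_smul (u : T11 E M) (c : ℝ) (A : Tensor11 E u.1) : vLift u (c • A) = c • vLift u A :=
  Prod.ext (smul_zero (A := E) c).symm rfl

lemma vLift_injective (u : T11 E M) : Function.Injective (vLift (E := E) (M := M) u) :=
  fun _ _ h ↦ congrArg Prod.snd h

/-- The splitting into a horizontal and a vertical lift is unique, so components are read off from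
any such expression. -/
lemma eq_hLift_add_vLift_iff {u : T11 E M} {ξ : TangentSpace (T11Model E) u}
    {X : TangentSpace 𝓘(ℝ, E) u.1} {A : Tensor11 E u.1} :
    ξ = hLift g u X + vLift u A ↔ basePart ξ = X ∧ verticalPart g ξ = A := by
  constructor
  · intro h
    have h1 : basePart ξ = X := by
      rw [h, basePart_add, basePart_hLift, basePart_vLift, add_zero]
    refine ⟨h1, vLift_injective u ?_⟩
    have h2 := hLift_add_vLift g ξ
    rw [h1] at h2
    nth_rw 2 [h] at h2
    exact add_left_cancel h2
  · rintro ⟨rfl, rfl⟩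
    exact (hLift_add_vLift g ξ).symm

lemma verticalPart_hLift (u : T11 E M) (X : TangentSpace 𝓘(ℝ, E) u.1) :
    verticalPart g (hLift g u X) = 0 :=
  ((eq_hLift_add_vLift_iff g (X := X) (A := 0)).1 (Prod.ext (add_zero (M := E) _).symm
    (add_zero (M := E →L[ℝ] E) _).symm)).2

lemma hLift_zero (u : T11 E M) : hLift g u 0 = 0 := by
  have := hLift_smul g u 0 0
  rwa [zero_smul, zero_smul] at this

lemma vLift_zero (u : T11 E M) : vLift (E := E) (M := M) u 0 = 0 := rfl

lemma verticalPart_vLift (u : T11 E M) (A : Tensor11 E u.1) : verticalPart g (vLift u A) = A :=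
  ((eq_hLift_add_vLift_iff g (X := 0) (A := A)).1 (by rw [hLift_zero, zero_add])).2

lemma verticalPart_add {u : T11 E M} (ξ η : TangentSpace (T11Model E) u) :
    verticalPart g (ξ + η) = verticalPart g ξ + verticalPart g η := by
  refine ((eq_hLift_add_vLift_iff g (X := basePart ξ + basePart η)).1 ?_).2
  rw [hLift_add, vLift_add, add_add_add_comm, hLift_add_vLift, hLift_add_vLift]

lemma verticalPart_smul {u : T11 E M} (c : ℝ) (ξ : TangentSpace (T11Model E) u) :
    verticalPart g (c • ξ) = c • verticalPart g ξ := by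
  refine ((eq_hLift_add_vLift_iff g (X := c • basePart ξ)).1 ?_).2
  rw [hLift_smul, vLift_smul, ← smul_add, hLift_add_vLift]

/-- The horizontal lift of `a` already has the fibre component `horizontalCoord`; the vertical part
is whatever is left of `S`. -/
lemma frameAt_T11 {u₀ p : T11 E M} (hp : p.1 ∈ (chartAt E u₀.1).source) (a : E) (S : E →L[ℝ] E) :
    frameAt (T11Model E) u₀ p (a, S) = hLift g p (frameAt 𝓘(ℝ, E) u₀.1 p.1 a) +
      vLift p (frameAt 𝓘(ℝ, E) u₀.1 p.1 ∘L (S - horizontalCoord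
        (localChr (formRep g.inner u₀.1) (extChartAt 𝓘(ℝ, E) u₀.1 p.1)) (endAt u₀.1 p.1 p.2) a) ∘L
          coordAt 𝓘(ℝ, E) u₀.1 p.1) := by
  have hp' := mem_chart_T11_iff.2 hp
  rw [← frameAt_coordAt hp' (_ + _), map_add, coordAt_hLift g hp, coordAt_vLift hp]
  refine congrArg (frameAt (T11Model E) u₀ p) (Prod.ext (add_zero a).symm ?_)
  ext w
  simp only [Prod.snd_add, add_apply, endAt_apply, ContinuousLinearMap.comp_apply, coordAt_frameAt hp,
    horizontalCoord, sub_apply]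
  abel

lemma tensorInner_symm (x : M) (A B : Tensor11 E x) : tensorInner g x A B = tensorInner g x B A := by
  have hx := mem_chart_source E x
  have hz := extChartAt_target_mem (I := 𝓘(ℝ, E)) hx
  have hm := isLocalMetric_formRep g x
  rw [tensorInner_eq g hx, tensorInner_eq g hx, traceForm_symm (hm.symm _ hz) (hm.pos _ hz)]

lemma tensorInner_pos (x : M) {A : Tensor11 E x} (hA : A ≠ 0) : 0 < tensorInner g x A A := by
  have hx := mem_chart_source E x
  have hz := extChartAt_target_mem (I := 𝓘(ℝ, E)) hx
  have hm := isLocalMetric_formRep g x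
  rw [tensorInner_eq g hx]
  refine traceForm_pos (hm.symm _ hz) (hm.pos _ hz) fun h ↦ hA ?_
  rw [← endAt_self x A]
  exact h

lemma tensorInner_add_left (x : M) (A A' B : Tensor11 E x) :
    tensorInner g x (A + A') B = tensorInner g x A B + tensorInner g x A' B := by
  simp only [tensorInner, add_apply, map_add, mul_add, Finset.sum_add_distrib]

lemma tensorInner_smul_left (x : M) (c : ℝ) (A B : Tensor11 E x) :
    tensorInner g x (c • A) B = c * tensorInner g x A B := by
  simp only [tensorInner, smul_apply, map_smul, Finset.mul_sum, smul_eq_mul]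
  exact Finset.sum_congr rfl fun _ _ ↦ Finset.sum_congr rfl fun _ _ ↦ by ring

lemma tensorInner_add_right (x : M) (A B B' : Tensor11 E x) :
    tensorInner g x A (B + B') = tensorInner g x A B + tensorInner g x A B' := by
  simp only [tensorInner_symm g x A, tensorInner_add_left]

lemma tensorInner_smul_right (x : M) (c : ℝ) (A B : Tensor11 E x) :
    tensorInner g x A (c • B) = c * tensorInner g x A B := by
  simp only [tensorInner_symm g x A, tensorInner_smul_left]

variable (f : M → ℝ)

/-- The rescaled Sasaki form at a point of the tensor bundle. -/
def sasakiForm (u : T11 E M) :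
    TangentSpace (T11Model E) u →L[ℝ] TangentSpace (T11Model E) u →L[ℝ] ℝ :=
  LinearMap.toContinuousLinearMap
    ((LinearMap.toContinuousLinearMap (𝕜 := ℝ) (E := TangentSpace (T11Model E) u) (F' := ℝ)).toLinearMap
    ∘ₗ LinearMap.mk₂ ℝ (fun ξ η : TangentSpace (T11Model E) u ↦
      f u.1 * g.inner u.1 (basePart ξ) (basePart η)
        + tensorInner g u.1 (verticalPart g ξ) (verticalPart g η))
    (fun ξ ξ' η ↦ by
      simp only [basePart_add, verticalPart_add, map_add, add_apply, tensorInner_add_left]; ring)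
    (fun c ξ η ↦ by
      simp only [basePart_smul, verticalPart_smul, map_smul, smul_apply, tensorInner_smul_left,
        smul_eq_mul]; ring)
    (fun ξ η η' ↦ by
      simp only [basePart_add, verticalPart_add, map_add, tensorInner_add_right]; ring)
    (fun c ξ η ↦ by
      simp only [basePart_smul, verticalPart_smul, map_smul, tensorInner_smul_right,
        smul_eq_mul]; ring))

lemma sasakiForm_apply (u : T11 E M) (ξ η : TangentSpace (T11Model E) u) :
    sasakiForm g f u ξ η = f u.1 * g.inner u.1 (basePart ξ) (basePart η)
        + tensorInner g u.1 (verticalPart g ξ) (verticalPart g η) := rfl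

lemma formRep_sasakiForm {u₀ : T11 E M} {q : E × (E →L[ℝ] E)}
    (hq : q ∈ (extChartAt (T11Model E) u₀).target) (a a' : E) (S S' : E →L[ℝ] E) :
    formRep (sasakiForm g f) u₀ q (a, S) (a', S') =
      f ((extChartAt 𝓘(ℝ, E) u₀.1).symm q.1) * formRep g.inner u₀.1 q.1 a a' +
      traceForm (formRep g.inner u₀.1 q.1)
        (S - horizontalCoord (localChr (formRep g.inner u₀.1) q.1) q.2 a)
        (S' - horizontalCoord (localChr (formRep g.inner u₀.1) q.1) q.2 a') := by
  rw [formRep_apply _ hq, sasakiForm_apply]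
  set p := (extChartAt (T11Model E) u₀).symm q with hpdef
  have hp : p.1 ∈ (chartAt E u₀.1).source := mem_chart_T11_iff.1 (extChartAt_symm_mem hq)
  have h1 : p.1 = (extChartAt 𝓘(ℝ, E) u₀.1).symm q.1 := (extChartAt_T11_symm_fst hq).1
  have h2 : extChartAt 𝓘(ℝ, E) u₀.1 p.1 = q.1 := by
    rw [h1, (extChartAt 𝓘(ℝ, E) u₀.1).right_inv (extChartAt_T11_symm_fst hq).2]
  have key (a : E) (S : E →L[ℝ] E) := (eq_hLift_add_vLift_iff g).1 (frameAt_T11 g hp a S)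
  have h3 : endAt u₀.1 p.1 p.2 = q.2 := endAt_extChartAt_symm hq
  have h4 (T : E →L[ℝ] E) : coordAt 𝓘(ℝ, E) u₀.1 p.1 ∘L (frameAt 𝓘(ℝ, E) u₀.1 p.1 ∘L T ∘L
      coordAt 𝓘(ℝ, E) u₀.1 p.1) ∘L frameAt 𝓘(ℝ, E) u₀.1 p.1 = T := by
    ext w
    simp only [ContinuousLinearMap.comp_apply, coordAt_frameAt hp]
  rw [(key a S).1, (key a' S').1, (key a S).2, (key a' S').2, inner_frameAt g hp,
    tensorInner_eq g hp, h4, h4, h2, h3, congrArg f h1]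

lemma contDiffAt_sasakiForm (hf : ContMDiff 𝓘(ℝ, E) 𝓘(ℝ, ℝ) ∞ f) (u : T11 E M) :
    ContDiffAt ℝ ∞ (formRep (sasakiForm g f) u) (extChartAt (T11Model E) u u) := by
  have hu := mem_chart_source (ModelProd E (E →L[ℝ] E)) u
  -- Smoothness of a map into bilinear forms on a finite-dimensional space may be tested on fixed
  -- pairs of vectors. The criterion is applied on the whole chart domain, where
  -- `formRep_sasakiForm` is valid.
  suffices h : ContDiffOn ℝ ∞ (formRep (sasakiForm g f) u) (extChartAt (T11Model E) u).target from
    h.contDiffAt (eventually_mem_target hu)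
  rw [contDiffOn_clm_apply]
  rintro ⟨a, S⟩
  rw [contDiffOn_clm_apply]
  rintro ⟨a', S'⟩
  refine ContDiffOn.congr ?_ fun q hq ↦ formRep_sasakiForm g f hq a a' S S'
  intro q hq
  refine ContDiffAt.contDiffWithinAt ?_
  have hz := (extChartAt_T11_symm_fst hq).2
  have hm := isLocalMetric_formRep g u.1
  have hfst : ContDiffAt ℝ ∞ (Prod.fst : E × (E →L[ℝ] E) → E) q := contDiffAt_fst
  have h1 : ContDiffAt ℝ ∞ (fun q : E × (E →L[ℝ] E) ↦ f ((extChartAt 𝓘(ℝ, E) u.1).symm q.1)) q := by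
    have := (contMDiffAt_iff_chart (extChartAt_symm_mem hz)).1 (hf.contMDiffAt)
    rw [(extChartAt 𝓘(ℝ, E) u.1).right_inv hz] at this
    exact this.comp q hfst
  have h2 : ContDiffAt ℝ ∞ (fun q : E × (E →L[ℝ] E) ↦ formRep g.inner u.1 q.1) q :=
    (hm.contDiffAt _ hz).comp q hfst
  have h3 : ContDiffAt ℝ ∞ (fun q : E × (E →L[ℝ] E) ↦ localChr (formRep g.inner u.1) q.1) q :=
    (hm.contDiffAt_localChr hz).comp q hfst
  have h4 : ContDiffAt ℝ ∞ (fun q : E × (E →L[ℝ] E) ↦ traceFormCLM E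
      (formRep g.inner u.1 q.1).inverse (formRep g.inner u.1 q.1)) q :=
    (hm.contDiffAt_traceFormCLM hz).comp q hfst
  have h5 (a : E) (S : E →L[ℝ] E) : ContDiffAt ℝ ∞ (fun q : E × (E →L[ℝ] E) ↦
      S - horizontalCoord (localChr (formRep g.inner u.1) q.1) q.2 a) q := by
    have h6 := h3.clm_apply (contDiffAt_const (c := a))
    exact contDiffAt_const.sub ((contDiffAt_snd.clm_comp h6).sub (h6.clm_comp contDiffAt_snd))
  exact (h1.mul ((h2.clm_apply contDiffAt_const).clm_apply contDiffAt_const)).add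
    ((h4.clm_apply (h5 a S)).clm_apply (h5 a' S'))

lemma sasakiForm_pos (hpos : ∀ x, 0 < f x) (u : T11 E M) (ξ : TangentSpace (T11Model E) u)
    (hξ : ξ ≠ 0) : 0 < sasakiForm g f u ξ ξ := by
  rw [sasakiForm_apply]
  have hb : 0 ≤ g.inner u.1 (basePart ξ) (basePart ξ) := by
    rcases eq_or_ne (basePart ξ) 0 with h | h
    · rw [h, map_zero]
    · exact (g.pos _ _ h).le
  rcases eq_or_ne (verticalPart g ξ) 0 with h | h
  · have h' : basePart ξ ≠ 0 := by
      intro h'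
      refine hξ ?_
      rw [← hLift_add_vLift g ξ, h, h', hLift_zero, vLift_zero, add_zero]
    rw [h]
    simpa [tensorInner] using mul_pos (hpos u.1) (g.pos _ _ h')
  · exact add_pos_of_nonneg_of_pos (mul_nonneg (hpos _).le hb) (tensorInner_pos g _ h)

/-- The rescaled Sasaki type metric. -/
def sasakiMetric (hf : ContMDiff 𝓘(ℝ, E) 𝓘(ℝ, ℝ) ∞ f) (hpos : ∀ x, 0 < f x) :
    SmoothMetric (T11Model E) (T11 E M) where
  inner := sasakiForm g f
  symm u ξ η := by
    rw [sasakiForm_apply, sasakiForm_apply, g.symm, tensorInner_symm]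
  pos u ξ hξ := sasakiForm_pos g f hpos u ξ hξ
  -- The tangent space is read as the model space, which carries a norm.
  isVonNBounded u := isVonNBounded_of_pos (V := E × (E →L[ℝ] E)) (sasakiForm g f u)
    (sasakiForm_pos g f hpos u)
  contMDiff u := (contMDiffAt_form_iff (sasakiForm g f)
    (mem_chart_source (ModelProd E (E →L[ℝ] E)) u)).2 (contDiffAt_sasakiForm g f hf u)

lemma isRescaledSasaki_sasakiMetric (hf : ContMDiff 𝓘(ℝ, E) 𝓘(ℝ, ℝ) ∞ f) (hpos : ∀ x, 0 < f x) :
    IsRescaledSasaki g f (sasakiMetric g f hf hpos) where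
  vert_vert u A B := by
    refine (sasakiForm_apply g f u _ _).trans ?_
    simp only [basePart_vLift, verticalPart_vLift, map_zero, mul_zero, zero_add]
  vert_horiz u A Y := by
    refine (sasakiForm_apply g f u _ _).trans ?_
    simp [basePart_vLift, verticalPart_hLift, tensorInner]
  horiz_horiz u X Y := by
    refine (sasakiForm_apply g f u _ _).trans ?_
    simp [basePart_hLift, verticalPart_hLift, tensorInner]

lemma IsRescaledSasaki.unique {G G' : SmoothMetric (T11Model E) (T11 E M)}
    (h : IsRescaledSasaki g f G) (h' : IsRescaledSasaki g f G') : G = G' := by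
  have hi : G.inner = G'.inner := by
    ext u ξ η
    rw [← hLift_add_vLift g ξ, ← hLift_add_vLift g η]
    simp only [map_add, add_apply, h.vert_vert, h'.vert_vert, h.vert_horiz, h'.vert_horiz,
      h.horiz_horiz, h'.horiz_horiz, G.symm u (hLift g u _) (vLift u _),
      G'.symm u (hLift g u _) (vLift u _)]
  cases G; cases G'; congr

end Lifts

/-! ### Koszul's formula on lifts: components of the Levi-Civita connection upstairs -/

section Connection

variable {E : Type*} [NormedAddCommGroup E] [NormedSpace ℝ E] [FiniteDimensional ℝ E]
  {M : Type*} [TopologicalSpace M] [ChartedSpace E M] [IsManifold 𝓘(ℝ, E) ∞ M]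
  (g : SmoothMetric 𝓘(ℝ, E) M)

/-- The field of endomorphisms with constant coordinates in the preferred chart at `x` and with
the value `A` at `x`. -/
def extendEnd {x : M} (A : Tensor11 E x) (y : M) : Tensor11 E y :=
  frameAt 𝓘(ℝ, E) x y ∘L endAt x x A ∘L coordAt 𝓘(ℝ, E) x y

lemma extendEnd_self {x : M} (A : Tensor11 E x) : extendEnd A x = A := by
  ext v
  simp only [extendEnd, ContinuousLinearMap.comp_apply, endAt_apply,
    frameAt_coordAt (mem_chart_source E x)]

lemma differentiableAt_extendEnd {x : M} (A : Tensor11 E x) :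
    DifferentiableAt ℝ (endRep (extendEnd A) x) (extChartAt 𝓘(ℝ, E) x x) := by
  refine (differentiableAt_const (endAt x x A)).congr_of_eventuallyEq ?_
  filter_upwards [eventually_mem_target (mem_chart_source E x)] with z hz
  ext w
  simp only [endRep, extendEnd, ContinuousLinearMap.comp_apply, coordAt_frameAt (extChartAt_symm_mem hz)]

section TensorInner

variable {A B : Π x : M, Tensor11 E x} {x : M}
  (hA : DifferentiableAt ℝ (endRep A x) (extChartAt 𝓘(ℝ, E) x x))
  (hB : DifferentiableAt ℝ (endRep B x) (extChartAt 𝓘(ℝ, E) x x))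

lemma eventuallyEq_tensorInner : (fun y ↦ tensorInner g y (A y) (B y)) ∘ (extChartAt 𝓘(ℝ, E) x).symm
    =ᶠ[𝓝 (extChartAt 𝓘(ℝ, E) x x)] fun z ↦ traceForm (formRep g.inner x z) (endRep A x z) (endRep B x z) := by
  filter_upwards [eventually_mem_target (mem_chart_source E x)] with z hz
  refine (tensorInner_eq g (extChartAt_symm_mem hz) _ _).trans ?_
  rw [(extChartAt 𝓘(ℝ, E) x).right_inv hz]
  rfl

include hA hB

lemma mdifferentiableAt_tensorInner : MDiffAt (fun y ↦ tensorInner g y (A y) (B y)) x := by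
  have hx := mem_chart_source E x
  rw [mdifferentiableAt_iff_chart hx]
  refine DifferentiableAt.congr_of_eventuallyEq ?_ (eventuallyEq_tensorInner g)
  exact ((((isLocalMetric_formRep g x).contDiffAt_traceFormCLM
    (extChartAt_target_mem hx)).differentiableAt (by simp)).clm_apply hA).clm_apply hB

/-- `∇` is compatible with the induced metric on (1,1) tensors; this is `fderiv_traceForm` read in a
chart. -/
lemma mvfderiv_tensorInner (v : TangentSpace 𝓘(ℝ, E) x) :
    mvfderiv 𝓘(ℝ, E) (fun y ↦ tensorInner g y (A y) (B y)) x v =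
      tensorInner g x (nablaEnd (leviCivita g) A x v) (B x) +
        tensorInner g x (A x) (nablaEnd (leviCivita g) B x v) := by
  have hx := mem_chart_source E x
  obtain ⟨a, rfl⟩ := exists_frameAt_self x v
  have hn {A : Π x : M, Tensor11 E x}
      (hA : DifferentiableAt ℝ (endRep A x) (extChartAt 𝓘(ℝ, E) x x)) :
      coordAt 𝓘(ℝ, E) x x ∘L nablaEnd (leviCivita g) A x (frameAt 𝓘(ℝ, E) x x a) ∘L
        frameAt 𝓘(ℝ, E) x x = fderiv ℝ (endRep A x) (extChartAt 𝓘(ℝ, E) x x) a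
          + localChr (formRep g.inner x) (extChartAt 𝓘(ℝ, E) x x) a
            ∘L endRep A x (extChartAt 𝓘(ℝ, E) x x)
          - endRep A x (extChartAt 𝓘(ℝ, E) x x)
            ∘L localChr (formRep g.inner x) (extChartAt 𝓘(ℝ, E) x x) a := by
    ext w
    simp only [ContinuousLinearMap.comp_apply, nablaEnd_leviCivita_eq g hx hA, coordAt_frameAt hx,
      add_apply, sub_apply]
  have hr (A : Π x : M, Tensor11 E x) : coordAt 𝓘(ℝ, E) x x ∘L A x ∘L frameAt 𝓘(ℝ, E) x x =
      endRep A x (extChartAt 𝓘(ℝ, E) x x) := by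
    rw [endRep, extChartAt_leftInv hx]
  rw [mvfderiv_eq_fderiv hx (mdifferentiableAt_tensorInner g hA hB),
    (eventuallyEq_tensorInner g).fderiv_eq, coordAt_frameAt hx,
    (isLocalMetric_formRep g x).fderiv_traceForm (extChartAt_target_mem hx) hA hB,
    tensorInner_eq g hx, tensorInner_eq g hx, hn hA, hn hB, hr, hr]

end TensorInner

variable {g} {f : M → ℝ} {G : SmoothMetric (T11Model E) (T11 E M)} (h : IsRescaledSasaki g f G)
include h

lemma IsRescaledSasaki.horiz_vert (u : T11 E M) (A : Tensor11 E u.1)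
    (Y : TangentSpace 𝓘(ℝ, E) u.1) : G.inner u (hLift g u Y) (vLift u A) = 0 := by
  rw [G.symm, h.vert_horiz]

/-- Pairing with horizontal lifts sees only the base part, and pairing with vertical lifts only the
vertical part. The choice of test field in Koszul's formula therefore selects the component. -/
lemma IsRescaledSasaki.inner_hLift (u : T11 E M) (ξ : TangentSpace (T11Model E) u)
    (Z : TangentSpace 𝓘(ℝ, E) u.1) :
    G.inner u ξ (hLift g u Z) = f u.1 * g.inner u.1 (basePart ξ) Z := by
  rw [← hLift_add_vLift g ξ, map_add, add_apply, h.horiz_horiz, h.vert_horiz, add_zero,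
    hLift_add_vLift]

lemma IsRescaledSasaki.inner_vLift (u : T11 E M) (ξ : TangentSpace (T11Model E) u)
    (A : Tensor11 E u.1) :
    G.inner u ξ (vLift u A) = tensorInner g u.1 (verticalPart g ξ) A := by
  rw [← hLift_add_vLift g ξ, map_add, add_apply, h.horiz_vert, h.vert_vert, zero_add,
    hLift_add_vLift]

variable {u : T11 E M} {Y : Π x : M, TangentSpace 𝓘(ℝ, E) x} {B : Π x : M, Tensor11 E x}

omit h in
lemma eq_of_forall_inner {x : M} {v w : TangentSpace 𝓘(ℝ, E) x}
    (hvw : ∀ z, g.inner x v z = g.inner x w z) : v = w :=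
  flat_injective g x (by ext z; exact hvw z)

omit h in
lemma eq_of_forall_tensorInner (g : SmoothMetric 𝓘(ℝ, E) M) {x : M} {A A' : Tensor11 E x}
    (hA : ∀ B, tensorInner g x A B = tensorInner g x A' B) : A = A' := by
  by_contra hne
  have h1 := tensorInner_pos g x (sub_ne_zero.2 hne)
  rw [sub_eq_add_neg, tensorInner_add_left, hA, ← tensorInner_add_left, ← sub_eq_add_neg, sub_self,
    tensorInner] at h1
  simp at h1

/-- On three horizontal lifts the Koszul expression is `f` times that of `g` plus the terms that
differentiate `f`, which form `ᶠA`. The vertical curvature parts of the brackets are orthogonal to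
horizontal lifts. -/
lemma IsRescaledSasaki.basePart_leviCivita_hLift (hf : MDiffAt f u.1) (hpos : 0 < f u.1)
    (hY : MDiffAt (T% Y) u.1) (X : TangentSpace 𝓘(ℝ, E) u.1) :
    basePart (leviCivita G (fun p ↦ hLift g p (Y p.1)) u (hLift g u X)) =
      leviCivita g Y u.1 X + (1 / (2 * f u.1)) • conformalTensor g f u.1 X (Y u.1) := by
  refine eq_of_forall_inner (g := g) fun Z ↦ ?_
  have hX' := mdifferentiableAt_extend 𝓘(ℝ, E) E X
  have hZ' := mdifferentiableAt_extend 𝓘(ℝ, E) E Z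
  have k1 := two_inner_leviCivita G (mdifferentiableAt_hLift g hX') (mdifferentiableAt_hLift g hY)
    (mdifferentiableAt_hLift g hZ')
  have k2 := two_inner_leviCivita g hX' hY hZ'
  have hd {V W : Π x : M, TangentSpace 𝓘(ℝ, E) x} (hV : MDiffAt (T% V) u.1)
      (hW : MDiffAt (T% W) u.1) (U : TangentSpace 𝓘(ℝ, E) u.1) :
      mvfderiv (T11Model E) (fun p : T11 E M ↦ f p.1 * g.inner p.1 (V p.1) (W p.1)) u (hLift g u U) =
        f u.1 * mvfderiv 𝓘(ℝ, E) (fun y ↦ g.inner y (V y) (W y)) u.1 U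
          + mvfderiv 𝓘(ℝ, E) f u.1 U * g.inner u.1 (V u.1) (W u.1) := by
    have hVW := mdifferentiableAt_inner g hV hW
    refine (mvfderiv_comp_proj (h := fun y ↦ f y * g.inner y (V y) (W y)) (hf.mul hVW) _).trans ?_
    rw [mvfderiv_fun_mul hf hVW, basePart_hLift]
    simp
    ring
  simp only [koszul, h.horiz_horiz, hd hY hZ', hd hZ' hX', hd hX' hY, mlieBracket_hLift g hY hZ',
    mlieBracket_hLift g hZ' hX', mlieBracket_hLift g hX' hY, map_add, h.horiz_vert, add_zero,
    h.inner_hLift, extend_apply_self] at k1 k2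
  have hs : g.inner u.1 (conformalTensor g f u.1 X (Y u.1)) Z =
      mvfderiv 𝓘(ℝ, E) f u.1 X * g.inner u.1 (Y u.1) Z + mvfderiv 𝓘(ℝ, E) f u.1 (Y u.1) * g.inner u.1 X Z
        - g.inner u.1 X (Y u.1) * mvfderiv 𝓘(ℝ, E) f u.1 Z := by
    simp [conformalTensor, grad, inner_sharp]
  rw [map_add, map_smul, add_apply, smul_apply, hs, smul_eq_mul]
  rw [g.symm u.1 Z X] at k1
  field_simp
  -- `k1` is Koszul's formula on the bundle and `k2` the one on the base, where the factor `f` is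
  -- missing.
  linear_combination k1 - f u.1 * k2

section

variable (hB : DifferentiableAt ℝ (endRep B u.1) (extChartAt 𝓘(ℝ, E) u.1 u.1))
include hB

/-- In Koszul's formula for `ᴴX`, `ⱽB`, `ⱽA`, compatibility gives `G(∇_X B, A) + G(B, ∇_X A)`. The
brackets contribute `G(A, ∇_X B) - G(B, ∇_X A)`, and the sum is `2 G(∇_X B, A)`. -/
lemma IsRescaledSasaki.verticalPart_leviCivita_hLift (X : TangentSpace 𝓘(ℝ, E) u.1) :
    verticalPart g (leviCivita G (fun p ↦ vLift p (B p.1)) u (hLift g u X)) =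
      nablaEnd (leviCivita g) B u.1 X := by
  refine eq_of_forall_tensorInner g fun A ↦ ?_
  have hX' := mdifferentiableAt_extend 𝓘(ℝ, E) E X
  have hA := differentiableAt_extendEnd A
  have k1 := two_inner_leviCivita G (mdifferentiableAt_hLift g hX') (mdifferentiableAt_vLift hB)
    (mdifferentiableAt_vLift hA)
  have h0 (ξ : TangentSpace (T11Model E) u) : mvfderiv (T11Model E) (fun _ : T11 E M ↦ (0 : ℝ)) u ξ = 0 := by
    rw [mvfderiv_const]; rfl
  have hd := (mvfderiv_comp_proj (mdifferentiableAt_tensorInner g hB hA) (hLift g u X)).trans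
    (mvfderiv_tensorInner g hB hA _)
  rw [basePart_hLift] at hd
  rw [koszul, mlieBracket_swap_apply (V := fun p : T11 E M ↦ vLift p (extendEnd A p.1))
    (W := fun p : T11 E M ↦ hLift g p (extend E X p.1))] at k1
  simp only [h.vert_vert, h.vert_horiz, h.horiz_vert, h.inner_vLift, mlieBracket_vLift hB hA,
    mlieBracket_hLift_vLift g hX' hA, mlieBracket_hLift_vLift g hX' hB, extend_apply_self,
    extendEnd_self, h0, hd, map_neg, map_zero] at k1
  rw [tensorInner_symm g u.1 A] at k1
  linarith

/-- Fibre inner products are constant along the fibres and vertical lifts commute, so every Koszul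
term vanishes. -/
lemma IsRescaledSasaki.verticalPart_leviCivita_vLift (C : Tensor11 E u.1) :
    verticalPart g (leviCivita G (fun p ↦ vLift p (B p.1)) u (vLift u C)) = 0 := by
  refine eq_of_forall_tensorInner g fun A ↦ ?_
  have hC := differentiableAt_extendEnd C
  have hA := differentiableAt_extendEnd A
  have k1 := two_inner_leviCivita G (mdifferentiableAt_vLift hC) (mdifferentiableAt_vLift hB)
    (mdifferentiableAt_vLift hA)
  have hd {B B' : Π x : M, Tensor11 E x}
      (hB : DifferentiableAt ℝ (endRep B u.1) (extChartAt 𝓘(ℝ, E) u.1 u.1))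
      (hB' : DifferentiableAt ℝ (endRep B' u.1) (extChartAt 𝓘(ℝ, E) u.1 u.1)) (C : Tensor11 E u.1) :
      mvfderiv (T11Model E) (fun p : T11 E M ↦ tensorInner g p.1 (B p.1) (B' p.1)) u (vLift u C) = 0 := by
    refine (mvfderiv_comp_proj (mdifferentiableAt_tensorInner g hB hB') (vLift u C)).trans ?_
    rw [basePart_vLift, map_zero]
  simp only [koszul, h.vert_vert, hd hB hA, hd hA hC, hd hC hB, mlieBracket_vLift hB hA,
    mlieBracket_vLift hA hC, mlieBracket_vLift hC hB, map_zero, extendEnd_self, h.inner_vLift] at k1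
  have h0 : tensorInner g u.1 0 A = 0 := by simp [tensorInner]
  rw [h0]
  linarith

/-- In Koszul's formula for `ᴴY`, `ⱽB`, `ᴴZ` only `⟨ⱽB, [ᴴZ, ᴴY]⟩` survives, which is the pairing of
`B` with the curvature part of the bracket. -/
lemma IsRescaledSasaki.two_inner_basePart_leviCivita_vLift (hf : MDiffAt f u.1)
    (Y Z : TangentSpace 𝓘(ℝ, E) u.1) :
    2 * (f u.1 * g.inner u.1
      (basePart (leviCivita G (fun p ↦ vLift p (B p.1)) u (hLift g u Y))) Z) =
      tensorInner g u.1 (B u.1) (u.2 ∘L curvatureEnd g u.1 Z Y - curvatureEnd g u.1 Z Y ∘L u.2) := by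
  have hY := mdifferentiableAt_extend 𝓘(ℝ, E) E Y
  have hZ := mdifferentiableAt_extend 𝓘(ℝ, E) E Z
  have k1 := two_inner_leviCivita G (mdifferentiableAt_hLift g hY) (mdifferentiableAt_vLift hB)
    (mdifferentiableAt_hLift g hZ)
  have h0 (ξ : TangentSpace (T11Model E) u) : mvfderiv (T11Model E) (fun _ : T11 E M ↦ (0 : ℝ)) u ξ = 0 := by
    rw [mvfderiv_const]; rfl
  have hd : mvfderiv (T11Model E) (fun p : T11 E M ↦ G.inner p (hLift g p (extend E Z p.1))
      (hLift g p (extend E Y p.1))) u (vLift u (B u.1)) = 0 := by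
    simp only [h.horiz_horiz]
    refine (mvfderiv_comp_proj (h := fun y ↦ f y * g.inner y (extend E Z y) (extend E Y y))
      (hf.mul (mdifferentiableAt_inner g hZ hY)) _).trans ?_
    rw [basePart_vLift, map_zero]
  rw [koszul, hd, mlieBracket_swap_apply (V := fun p : T11 E M ↦ vLift p (B p.1))
    (W := fun p : T11 E M ↦ hLift g p (extend E Z p.1))] at k1
  simp only [h.vert_horiz, h.horiz_vert, mlieBracket_hLift_vLift g hZ hB, map_add, h.vert_vert,
    mlieBracket_hLift_vLift g hY hB, mlieBracket_hLift g hZ hY, extend_apply_self,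
    h0, map_neg, h.inner_hLift] at k1
  linarith

end

section

variable (g)

omit h in
lemma inner_curvatureTerm (x : M) (t C : Tensor11 E x) (Y Z : TangentSpace 𝓘(ℝ, E) x) :
    g.inner x (curvatureTerm g x t C Y) Z =
      tensorInner g x C (t ∘L curvatureEnd g x Z Y - curvatureEnd g x Z Y ∘L t) := by
  have hL (b) := exists_curvature_left g x Y (coordBasis 𝓘(ℝ, E) x b)
  choose L hL using hL
  rw [curvatureTerm, extendLinear_eq (∑ b, ∑ l, gInv g x b l •
    (g.inner x (C (coordBasis 𝓘(ℝ, E) x l)) ∘L t ∘L L b)) fun Z ↦ ?_]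
  · rw [map_add, add_apply, inner_sharp, tensorInner_symm]
    simp only [map_sum, map_smul, sum_apply, smul_apply, ContinuousLinearMap.comp_apply, ← hL,
      tensorInner, sub_apply, curvatureEnd_apply, map_sub, mul_sub,
      Finset.sum_sub_distrib, smul_eq_mul]
    rw [add_comm, sub_eq_add_neg, ← Finset.sum_neg_distrib]
    congr 1
    · exact Finset.sum_congr rfl fun _ _ ↦ Finset.sum_congr rfl fun _ _ ↦ by rw [g.symm x (C _)]
    refine Finset.sum_congr rfl fun b _ ↦ ?_
    rw [← Finset.sum_neg_distrib]
    refine Finset.sum_congr rfl fun l _ ↦ ?_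
    -- Pair symmetry followed by skewness: `-g(R(Z, Y) t_b, C_l) = g(R(t_b, C_l) Y, Z)`. The other
    -- term, with `t ∘ R(Z, Y)`, is by definition the dual covector.
    rw [curvature_pair g x Z Y, curvature_skew g x _ _ Z Y]
    ring
  · simp only [sum_apply, smul_apply, ContinuousLinearMap.comp_apply, ← hL,
      g.symm x (C _), smul_eq_mul]

end

lemma IsRescaledSasaki.basePart_leviCivita_vLift (hf : MDiffAt f u.1) (hpos : 0 < f u.1)
    (hB : DifferentiableAt ℝ (endRep B u.1) (extChartAt 𝓘(ℝ, E) u.1 u.1))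
    (Y : TangentSpace 𝓘(ℝ, E) u.1) :
    basePart (leviCivita G (fun p ↦ vLift p (B p.1)) u (hLift g u Y)) =
      (1 / (2 * f u.1)) • curvatureTerm g u.1 u.2 (B u.1) Y := by
  refine eq_of_forall_inner (g := g) fun Z ↦ ?_
  rw [map_smul, smul_apply, inner_curvatureTerm, ← h.two_inner_basePart_leviCivita_vLift hB hf, smul_eq_mul]
  field_simp

end Connection

/-! ### Bilinearity of the tensor `S` and evaluation of the almost product connection -/

section ProductConnection

variable {E : Type*} [NormedAddCommGroup E] [NormedSpace ℝ E] [FiniteDimensional ℝ E]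
  {H : Type*} [TopologicalSpace H] {I : ModelWithCorners ℝ E H} [I.Boundaryless]
  {M : Type*} [TopologicalSpace M] [ChartedSpace H M] [IsManifold I ∞ M]

lemma extendLinear_apply {F : Type*} [AddCommGroup F] [Module ℝ F] [TopologicalSpace F]
    [IsTopologicalAddGroup F] [ContinuousSMul ℝ F] {x : M} {c : TangentSpace I x → F}
    (hc : IsLinearMap ℝ c) (v : TangentSpace I x) : extendLinear x c v = c v := by
  exact congrArg (fun L ↦ L v)
    (extendLinear_eq (LinearMap.toContinuousLinearMap (IsLinearMap.mk' c hc)) fun _ ↦ rfl)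

variable (D : CovariantDerivative I E (TangentSpace I : M → Type _))
  (J : Π x : M, TangentSpace I x →L[ℝ] TangentSpace I x)

lemma nablaEnd_add (x : M) (v v' : TangentSpace I x) :
    nablaEnd D J x (v + v') = nablaEnd D J x v + nablaEnd D J x v' := by
  apply ContinuousLinearMap.coe_injective
  refine (coordBasis I x).ext fun i ↦ ?_
  simp only [nablaEnd, extendLinear, LinearMap.coe_toContinuousLinearMap, ContinuousLinearMap.toLinearMap_add,
    LinearMap.add_apply, Module.Basis.constr_basis, map_add]
  abel

lemma nablaEnd_smul (x : M) (c : ℝ) (v : TangentSpace I x) :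
    nablaEnd D J x (c • v) = c • nablaEnd D J x v := by
  apply ContinuousLinearMap.coe_injective
  refine (coordBasis I x).ext fun i ↦ ?_
  simp only [nablaEnd, extendLinear, LinearMap.coe_toContinuousLinearMap, ContinuousLinearMap.toLinearMap_smul,
    LinearMap.smul_apply, Module.Basis.constr_basis, map_smul, smul_sub]

lemma nablaEnd_neg (x : M) (v : TangentSpace I x) : nablaEnd D J x (-v) = -nablaEnd D J x v := by
  simpa using nablaEnd_smul D J x (-1) v

lemma leviCivita_sub_leviCivita (g : SmoothMetric I M) {X Y : Π x : M, TangentSpace I x} {x : M}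
    (hX : MDiffAt (T% X) x) (hY : MDiffAt (T% Y) x) :
    leviCivita g Y x (X x) - leviCivita g X x (Y x) = mlieBracket I X Y x :=
  (CovariantDerivative.torsion_eq_zero_iff _).1 (leviCivita_torsion g) hX hY

lemma isLinearMap_productTensor_left (x : M) (Y : TangentSpace I x) :
    IsLinearMap ℝ fun X ↦ -productTensor D J x X Y := by
  constructor
  · intro X X'
    simp only [productTensor, map_add, nablaEnd_add, add_apply]
    module
  · intro c X
    simp only [productTensor, map_smul, nablaEnd_smul, smul_apply]
    module

/-- The definition stores `S` through nested linear extensions; bilinearity of `S` shows that they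
return its actual values. -/
lemma almostProductConnection_apply (W : Π x : M, TangentSpace I x) (x : M) (ξ : TangentSpace I x) :
    almostProductConnection D J W x ξ = D W x ξ - productTensor D J x ξ (W x) := by
  have h : IsLinearMap ℝ fun Y : TangentSpace I x ↦ extendLinear x fun X ↦ -productTensor D J x X Y := by
    constructor
    · intro Y Y'
      ext X
      rw [add_apply]
      simp only [extendLinear_apply (isLinearMap_productTensor_left D J x _)]
      simp only [productTensor, map_add, nablaEnd_add, add_apply]
      module
    · intro c Y
      ext X
      rw [smul_apply]
      simp only [extendLinear_apply (isLinearMap_productTensor_left D J x _)]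
      simp only [productTensor, map_smul, nablaEnd_smul, smul_apply]
      module
  have h1 : almostProductConnection D J W x = D W x +
      (extendLinear x fun Y : TangentSpace I x ↦ extendLinear x fun X ↦ -productTensor D J x X Y) (W x) := rfl
  rw [h1, add_apply, extendLinear_apply h, extendLinear_apply (isLinearMap_productTensor_left D J x _),
    sub_eq_add_neg]

end ProductConnection

/-! ### The almost product structure and its connection on lifts -/

section StructureJ

variable {E : Type*} [NormedAddCommGroup E] [NormedSpace ℝ E] [FiniteDimensional ℝ E]
  {M : Type*} [TopologicalSpace M] [ChartedSpace E M] [IsManifold 𝓘(ℝ, E) ∞ M]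
  (g : SmoothMetric 𝓘(ℝ, E) M)

lemma structureJ_apply (u : T11 E M) (ξ : TangentSpace (T11Model E) u) :
    structureJ g u ξ = vLift u (verticalPart g ξ) - hLift g u (basePart ξ) := by
  refine extendLinear_apply (I := T11Model E) (c := fun ξ : TangentSpace (T11Model E) u ↦
    vLift u (verticalPart g ξ) - hLift g u (basePart ξ)) ⟨fun ξ η ↦ ?_, fun c ξ ↦ ?_⟩ ξ
  · simp only [verticalPart_add, basePart_add, vLift_add, hLift_add]
    abel
  · simp only [verticalPart_smul, basePart_smul, vLift_smul, hLift_smul, smul_sub]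

lemma structureJ_neg (u : T11 E M) (ξ : TangentSpace (T11Model E) u) :
    structureJ g u (-ξ) = -structureJ g u ξ := (structureJ g u).map_neg ξ

lemma structureJ_smul (u : T11 E M) (c : ℝ) (ξ : TangentSpace (T11Model E) u) :
    structureJ g u (c • ξ) = c • structureJ g u ξ := (structureJ g u).map_smul c ξ

lemma structureJ_hLift (u : T11 E M) (X : TangentSpace 𝓘(ℝ, E) u.1) :
    structureJ g u (hLift g u X) = -hLift g u X := by
  rw [structureJ_apply, verticalPart_hLift, basePart_hLift, vLift_zero, zero_sub]

lemma structureJ_vLift (u : T11 E M) (A : Tensor11 E u.1) :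
    structureJ g u (vLift u A) = vLift u A := by
  rw [structureJ_apply, verticalPart_vLift, basePart_vLift, hLift_zero, sub_zero]

lemma coordAt_structureJ {u₀ p : T11 E M} (hp : p.1 ∈ (chartAt E u₀.1).source) (a : E)
    (S : E →L[ℝ] E) :
    coordAt (T11Model E) u₀ p (structureJ g p (frameAt (T11Model E) u₀ p (a, S))) =
      (-a, S - (2 : ℝ) • horizontalCoord (localChr (formRep g.inner u₀.1)
        (extChartAt 𝓘(ℝ, E) u₀.1 p.1)) (endAt u₀.1 p.1 p.2) a) := by
  rw [frameAt_T11 g hp, (structureJ g p).map_add, structureJ_hLift, structureJ_vLift, map_add, map_neg,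
    coordAt_hLift g hp, coordAt_vLift hp]
  refine Prod.ext (add_zero (-a)) ?_
  ext w
  simp only [Prod.snd_add, Prod.snd_neg, add_apply, neg_apply, endAt_apply,
    ContinuousLinearMap.comp_apply, coordAt_frameAt hp, horizontalCoord, sub_apply, two_smul]
  abel

/-- In a chart `J` sends `(a, S)` to `(-a, S - 2 h(a))`, where `h` is the smooth horizontal
coefficient. Preservation of differentiable fields is what `nablaEnd_apply` asks of `J`. -/
lemma mdifferentiableAt_structureJ {u : T11 E M} {W : Π p : T11 E M, TangentSpace (T11Model E) p}
    (hW : FieldDiffAt W u) : FieldDiffAt (fun p ↦ structureJ g p (W p)) u := by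
  have hu := mem_chart_source (ModelProd E (E →L[ℝ] E)) u
  have hW' := (mdifferentiableAt_section_iff hu).1 hW
  refine (mdifferentiableAt_section_iff hu).2 ?_
  have hΓ : DifferentiableAt ℝ (fun q : E × (E →L[ℝ] E) ↦ localChr (formRep g.inner u.1) q.1)
      (extChartAt (T11Model E) u u) :=
    DifferentiableAt.comp (g := localChr (formRep g.inner u.1)) (f := Prod.fst)
      (extChartAt (T11Model E) u u) (differentiableAt_localChr g (mem_chart_source E u.1))
      differentiableAt_fst
  have h1 := hΓ.clm_apply hW'.fst
  have h2 : DifferentiableAt ℝ (Prod.snd : E × (E →L[ℝ] E) → E →L[ℝ] E) (extChartAt (T11Model E) u u) :=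
    differentiableAt_snd
  have h3 := hW'.fst.neg.prodMk
    (hW'.snd.sub (((h2.clm_comp h1).sub (h1.clm_comp h2)).const_smul (2 : ℝ)))
  refine h3.congr_of_eventuallyEq ?_
  filter_upwards [eventually_mem_target hu] with q hq
  have hp := extChartAt_symm_mem hq
  have hp' := mem_chart_T11_iff.1 hp
  have h4 := coordAt_structureJ g hp' (localRep u W q).1 (localRep u W q).2
  have h5 : frameAt (T11Model E) u ((extChartAt (T11Model E) u).symm q)
      ((localRep u W q).1, (localRep u W q).2) = W ((extChartAt (T11Model E) u).symm q) :=
    frameAt_coordAt hp _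
  have h6 : extChartAt 𝓘(ℝ, E) u.1 ((extChartAt (T11Model E) u).symm q).1 = q.1 := by
    rw [(extChartAt_T11_symm_fst hq).1, (extChartAt 𝓘(ℝ, E) u.1).right_inv (extChartAt_T11_symm_fst hq).2]
  rw [h5, h6, endAt_extChartAt_symm hq] at h4
  exact h4

variable (D : CovariantDerivative (T11Model E) (E × (E →L[ℝ] E))
  (TangentSpace (T11Model E) : T11 E M → Type _)) {u : T11 E M}
  {Y : Π x : M, TangentSpace 𝓘(ℝ, E) x} {B : Π x : M, Tensor11 E x}

/-- On horizontal fields `J = -1`, so `(∇_ξ J) F = -∇_ξ F - J ∇_ξ F`, and the horizontal part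
cancels. Thus `∇J` measures how far `∇` is from preserving the distribution. -/
lemma nablaEnd_structureJ_hLift (hY : MDiffAt (T% Y) u.1) (ξ : TangentSpace (T11Model E) u) :
    nablaEnd D (structureJ g) u ξ (hLift g u (Y u.1)) =
      -((2 : ℝ) • vLift u (verticalPart g (D (fun p ↦ hLift g p (Y p.1)) u ξ))) := by
  have hF := mdifferentiableAt_hLift g hY
  have h := nablaEnd_apply D (fun _ hW ↦ mdifferentiableAt_structureJ g hW) hF ξ
  refine h.trans ?_
  have h1 : (fun p : T11 E M ↦ structureJ g p (hLift g p (Y p.1))) =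
      (-1 : ℝ) • fun p : T11 E M ↦ hLift g p (Y p.1) := by
    ext p
    simp [structureJ_hLift]
  have h2 : D ((-1 : ℝ) • fun p : T11 E M ↦ hLift g p (Y p.1)) u =
      (-1 : ℝ) • D (fun p ↦ hLift g p (Y p.1)) u :=
    D.isCovariantDerivativeOnUniv.smul_const (-1) hF
  rw [h1, h2, structureJ_apply, smul_apply]
  have key (V a b : TangentSpace (T11Model E) u) (hd : a + b = V) :
      (-1 : ℝ) • V - (b - a) = -((2 : ℝ) • b) := by
    rw [← hd]
    module
  exact key _ _ _ (hLift_add_vLift g _)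

lemma nablaEnd_structureJ_vLift
    (hB : DifferentiableAt ℝ (endRep B u.1) (extChartAt 𝓘(ℝ, E) u.1 u.1))
    (ξ : TangentSpace (T11Model E) u) :
    nablaEnd D (structureJ g) u ξ (vLift u (B u.1)) =
      (2 : ℝ) • hLift g u (basePart (D (fun p ↦ vLift p (B p.1)) u ξ)) := by
  have hF := mdifferentiableAt_vLift hB
  have h := nablaEnd_apply D (fun _ hW ↦ mdifferentiableAt_structureJ g hW) hF ξ
  refine h.trans ?_
  simp only [structureJ_vLift]
  rw [structureJ_apply]
  have key (V a b : TangentSpace (T11Model E) u) (hd : a + b = V) :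
      V - (b - a) = (2 : ℝ) • a := by
    rw [← hd]
    module
  exact key _ _ _ (hLift_add_vLift g _)

variable {G : SmoothMetric (T11Model E) (T11 E M)} {f : M → ℝ}

section

variable (G) {X Y : Π x : M, TangentSpace 𝓘(ℝ, E) x} {B C : Π x : M, Tensor11 E x}

lemma almostProductConnection_hLift_hLift (hX : MDiffAt (T% X) u.1) (hY : MDiffAt (T% Y) u.1) :
    almostProductConnection (leviCivita G) (structureJ g) (fun p ↦ hLift g p (Y p.1)) u
        (hLift g u (X u.1)) =
      hLift g u (basePart (leviCivita G (fun p ↦ hLift g p (Y p.1)) u (hLift g u (X u.1)))) := by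
  rw [almostProductConnection_apply, productTensor, structureJ_hLift, nablaEnd_neg,
    neg_apply, nablaEnd_structureJ_hLift g _ hX, nablaEnd_structureJ_hLift g _ hY]
  simp only [structureJ_neg, structureJ_smul, structureJ_vLift]
  -- `b` and `c` are the vertical parts of `∇̃_ᴴX ᴴY` and `∇̃_ᴴY ᴴX`. The first two terms of `S̃`
  -- cancel, so `S̃ = b` and the horizontal part `a` is left.
  have key (V a b c : TangentSpace (T11Model E) u) (hd : a + b = V) :
      V - (1 / 2 : ℝ) • (-(-((2 : ℝ) • c)) + -((2 : ℝ) • c) - -((2 : ℝ) • b)) = a := by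
    rw [← hd]
    module
  exact key _ _ _ _ (hLift_add_vLift g _)

lemma almostProductConnection_vLift_hLift (hY : MDiffAt (T% Y) u.1)
    (hC : DifferentiableAt ℝ (endRep C u.1) (extChartAt 𝓘(ℝ, E) u.1 u.1)) :
    almostProductConnection (leviCivita G) (structureJ g) (fun p ↦ hLift g p (Y p.1)) u
        (vLift u (C u.1)) =
      hLift g u ((3 : ℝ) • basePart (leviCivita G (fun p ↦ vLift p (C p.1)) u (hLift g u (Y u.1)))) := by
  have ht := leviCivita_sub_leviCivita G (mdifferentiableAt_hLift g hY) (mdifferentiableAt_vLift hC)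
  rw [mlieBracket_hLift_vLift g hY hC] at ht
  rw [almostProductConnection_apply, productTensor, structureJ_hLift, nablaEnd_neg,
    neg_apply, nablaEnd_structureJ_hLift g _ hY, nablaEnd_structureJ_vLift g _ hC]
  simp only [structureJ_neg, structureJ_smul, structureJ_vLift, structureJ_hLift]
  -- The bracket of the two lifts is vertical, so the two orders of differentiation have the same
  -- horizontal part.
  have hb : basePart (leviCivita G (fun p ↦ hLift g p (Y p.1)) u (vLift u (C u.1))) =
      basePart (leviCivita G (fun p ↦ vLift p (C p.1)) u (hLift g u (Y u.1))) := by
    rw [sub_eq_iff_eq_add.1 ht, basePart_add, basePart_vLift, zero_add]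
  -- Here `S̃ = b - 2a`, with `a` horizontal and `b` vertical, so subtracting it triples the
  -- horizontal part.
  have key (V a b : TangentSpace (T11Model E) u) (hd : a + b = V) :
      V - (1 / 2 : ℝ) • (-((2 : ℝ) • a) + (2 : ℝ) • -a - -((2 : ℝ) • b)) = (3 : ℝ) • a := by
    rw [← hd]
    module
  rw [hLift_smul, ← hb]
  exact key _ _ _ (hLift_add_vLift g _)

lemma almostProductConnection_hLift_vLift (hX : MDiffAt (T% X) u.1)
    (hB : DifferentiableAt ℝ (endRep B u.1) (extChartAt 𝓘(ℝ, E) u.1 u.1)) :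
    almostProductConnection (leviCivita G) (structureJ g) (fun p ↦ vLift p (B p.1)) u
        (hLift g u (X u.1)) =
      vLift u ((3 : ℝ) • verticalPart g (leviCivita G (fun p ↦ vLift p (B p.1)) u (hLift g u (X u.1)))
        - (2 : ℝ) • nablaEnd (leviCivita g) B u.1 (X u.1)) := by
  have ht := leviCivita_sub_leviCivita G (mdifferentiableAt_hLift g hX) (mdifferentiableAt_vLift hB)
  rw [mlieBracket_hLift_vLift g hX hB] at ht
  rw [almostProductConnection_apply, productTensor, structureJ_vLift,
    nablaEnd_structureJ_hLift g _ hX, nablaEnd_structureJ_vLift g _ hB]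
  simp only [structureJ_neg, structureJ_smul, structureJ_vLift, structureJ_hLift]
  have hb : verticalPart g (leviCivita G (fun p ↦ hLift g p (X p.1)) u (vLift u (B u.1))) =
      verticalPart g (leviCivita G (fun p ↦ vLift p (B p.1)) u (hLift g u (X u.1))) -
        nablaEnd (leviCivita g) B u.1 (X u.1) := by
    rw [sub_eq_iff_eq_add.1 ht, verticalPart_add, verticalPart_vLift, add_sub_cancel_left]
  -- Here `S̃ = a - 2c`, with `c` the vertical part of `∇̃_ⱽB ᴴX`. By torsion-freeness `c = b - ∇_X
  -- B`, so the result is `3b - 2 ∇_X B`.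
  have key (V a b c : TangentSpace (T11Model E) u) (hd : a + b = V) :
      V - (1 / 2 : ℝ) • (-((2 : ℝ) • c) + -((2 : ℝ) • c) - (2 : ℝ) • -a) = b + (2 : ℝ) • c := by
    rw [← hd]
    module
  refine (key _ _ _ _ (hLift_add_vLift g _)).trans ?_
  rw [hb, ← vLift_smul, ← vLift_add]
  congr 1
  module

lemma almostProductConnection_vLift_vLift
    (hB : DifferentiableAt ℝ (endRep B u.1) (extChartAt 𝓘(ℝ, E) u.1 u.1))
    (hC : DifferentiableAt ℝ (endRep C u.1) (extChartAt 𝓘(ℝ, E) u.1 u.1)) :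
    almostProductConnection (leviCivita G) (structureJ g) (fun p ↦ vLift p (B p.1)) u
        (vLift u (C u.1)) =
      vLift u (verticalPart g (leviCivita G (fun p ↦ vLift p (B p.1)) u (vLift u (C u.1)))) := by
  rw [almostProductConnection_apply, productTensor, structureJ_vLift,
    nablaEnd_structureJ_vLift g _ hB, nablaEnd_structureJ_vLift g _ hC]
  simp only [structureJ_smul, structureJ_hLift]
  -- The terms in `c`, the horizontal part of `∇̃_ⱽB ⱽC`, cancel, so `S̃` is the horizontal part `a`
  -- and the vertical part `b` is left.
  have key (V a b c : TangentSpace (T11Model E) u) (hd : a + b = V) :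
      V - (1 / 2 : ℝ) • ((2 : ℝ) • c + (2 : ℝ) • -c - (2 : ℝ) • -a) = b := by
    rw [← hd]
    module
  exact key _ _ _ _ (hLift_add_vLift g _)

end

end StructureJ

end TensorBundle

end

noncomputable section

open scoped Topology

namespace TensorBundle

/-! ### Parallelism of `J`, the four formulas, and the torsion -/

section Final

variable {E : Type*} [NormedAddCommGroup E] [NormedSpace ℝ E] [FiniteDimensional ℝ E]
  {M : Type*} [TopologicalSpace M] [ChartedSpace E M] [IsManifold 𝓘(ℝ, E) ∞ M]
  {g : SmoothMetric 𝓘(ℝ, E) M} {f : M → ℝ} {G : SmoothMetric (T11Model E) (T11 E M)}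
  {u : T11 E M}

section

variable {Y : Π x : M, TangentSpace 𝓘(ℝ, E) x} {B : Π x : M, Tensor11 E x}

lemma verticalPart_almostProductConnection_hLift (hY : MDiffAt (T% Y) u.1)
    (ξ : TangentSpace (T11Model E) u) : verticalPart g (almostProductConnection (leviCivita G)
      (structureJ g) (fun p ↦ hLift g p (Y p.1)) u ξ) = 0 := by
  rw [← hLift_add_vLift g ξ, ContinuousLinearMap.map_add, verticalPart_add]
  have h1 := almostProductConnection_hLift_hLift g G
    (mdifferentiableAt_extend 𝓘(ℝ, E) E (basePart ξ)) hY
  have h2 := almostProductConnection_vLift_hLift g G hY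
    (differentiableAt_extendEnd (verticalPart g ξ))
  rw [extend_apply_self] at h1
  rw [extendEnd_self] at h2
  rw [h1, h2, verticalPart_hLift, verticalPart_hLift, add_zero]

lemma basePart_almostProductConnection_vLift
    (hB : DifferentiableAt ℝ (endRep B u.1) (extChartAt 𝓘(ℝ, E) u.1 u.1))
    (ξ : TangentSpace (T11Model E) u) : basePart (almostProductConnection (leviCivita G)
      (structureJ g) (fun p ↦ vLift p (B p.1)) u ξ) = 0 := by
  rw [← hLift_add_vLift g ξ, ContinuousLinearMap.map_add, basePart_add]
  have h1 := almostProductConnection_hLift_vLift g G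
    (mdifferentiableAt_extend 𝓘(ℝ, E) E (basePart ξ)) hB
  have h2 := almostProductConnection_vLift_vLift g G hB
    (differentiableAt_extendEnd (verticalPart g ξ))
  rw [extend_apply_self] at h1
  rw [extendEnd_self] at h2
  rw [h1, h2, basePart_vLift, basePart_vLift, add_zero]

end

/-- The product connection keeps horizontal fields horizontal and vertical fields vertical. The
general formulas for `∇J` on lifts, applied to this connection, therefore give zero. -/
theorem nablaEnd_almostProductConnection (g : SmoothMetric 𝓘(ℝ, E) M)
    (G : SmoothMetric (T11Model E) (T11 E M)) (ξ : TangentSpace (T11Model E) u) :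
    nablaEnd (almostProductConnection (leviCivita G) (structureJ g)) (structureJ g) u ξ = 0 := by
  apply ContinuousLinearMap.ext
  intro η
  have hY := mdifferentiableAt_extend 𝓘(ℝ, E) E (basePart η)
  have hB := differentiableAt_extendEnd (verticalPart g η)
  have h1 := nablaEnd_structureJ_hLift g (almostProductConnection (leviCivita G) (structureJ g)) hY ξ
  have h2 := nablaEnd_structureJ_vLift g (almostProductConnection (leviCivita G) (structureJ g)) hB ξ
  rw [verticalPart_almostProductConnection_hLift hY, extend_apply_self, vLift_zero, smul_zero,
    neg_zero] at h1
  rw [basePart_almostProductConnection_vLift hB, extendEnd_self, hLift_zero, smul_zero] at h2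
  rw [← hLift_add_vLift g η, ContinuousLinearMap.map_add, h1, h2, add_zero, zero_apply]

lemma conformalTensor_symm (g : SmoothMetric 𝓘(ℝ, E) M) (f : M → ℝ) (x : M)
    (X Y : TangentSpace 𝓘(ℝ, E) x) : conformalTensor g f x X Y = conformalTensor g f x Y X := by
  rw [conformalTensor, conformalTensor, g.symm x X Y, add_comm (_ • Y)]

namespace IsRescaledSasaki

variable (h : IsRescaledSasaki g f G) {X Y : Π x : M, TangentSpace 𝓘(ℝ, E) x}
  {B C : Π x : M, Tensor11 E x}
include h

theorem connection_hLift_hLift (hf : MDiffAt f u.1) (hpos : 0 < f u.1) (hX : MDiffAt (T% X) u.1)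
    (hY : MDiffAt (T% Y) u.1) :
    almostProductConnection (leviCivita G) (structureJ g) (fun p ↦ hLift g p (Y p.1)) u
        (hLift g u (X u.1)) =
      hLift g u (leviCivita g Y u.1 (X u.1)
        + (1 / (2 * f u.1)) • conformalTensor g f u.1 (X u.1) (Y u.1)) := by
  rw [almostProductConnection_hLift_hLift g G hX hY, h.basePart_leviCivita_hLift hf hpos hY]

theorem connection_hLift_vLift (hX : MDiffAt (T% X) u.1)
    (hB : DifferentiableAt ℝ (endRep B u.1) (extChartAt 𝓘(ℝ, E) u.1 u.1)) :
    almostProductConnection (leviCivita G) (structureJ g) (fun p ↦ vLift p (B p.1)) u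
        (hLift g u (X u.1)) = vLift u (nablaEnd (leviCivita g) B u.1 (X u.1)) := by
  rw [almostProductConnection_hLift_vLift g G hX hB, h.verticalPart_leviCivita_hLift hB]
  congr 1
  module

theorem connection_vLift_hLift (hf : MDiffAt f u.1) (hpos : 0 < f u.1) (hY : MDiffAt (T% Y) u.1)
    (hC : DifferentiableAt ℝ (endRep C u.1) (extChartAt 𝓘(ℝ, E) u.1 u.1)) :
    almostProductConnection (leviCivita G) (structureJ g) (fun p ↦ hLift g p (Y p.1)) u
        (vLift u (C u.1)) =
      (3 / (2 * f u.1)) • hLift g u (curvatureTerm g u.1 u.2 (C u.1) (Y u.1)) := by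
  rw [almostProductConnection_vLift_hLift g G hY hC, h.basePart_leviCivita_vLift hf hpos hC, smul_smul,
    hLift_smul]
  congr 1
  ring

theorem connection_vLift_vLift
    (hB : DifferentiableAt ℝ (endRep B u.1) (extChartAt 𝓘(ℝ, E) u.1 u.1))
    (hC : DifferentiableAt ℝ (endRep C u.1) (extChartAt 𝓘(ℝ, E) u.1 u.1)) :
    almostProductConnection (leviCivita G) (structureJ g) (fun p ↦ vLift p (B p.1)) u
        (vLift u (C u.1)) = 0 := by
  rw [almostProductConnection_vLift_vLift g G hB hC, h.verticalPart_leviCivita_vLift hB, vLift_zero]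

/-- `ᶠA` is symmetric and `∇` torsion-free, so the horizontal parts cancel and only the curvature
part of the bracket remains. -/
lemma torsion_hLift_hLift (hf : MDiffAt f u.1) (hpos : 0 < f u.1)
    (X Y : TangentSpace 𝓘(ℝ, E) u.1) :
    (almostProductConnection (leviCivita G) (structureJ g)).torsion u (hLift g u X) (hLift g u Y) =
      -vLift u (u.2 ∘L curvatureEnd g u.1 X Y - curvatureEnd g u.1 X Y ∘L u.2) := by
  have hX := mdifferentiableAt_extend 𝓘(ℝ, E) E X
  have hY := mdifferentiableAt_extend 𝓘(ℝ, E) E Y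
  have ht := CovariantDerivative.torsion_apply
    (almostProductConnection (leviCivita G) (structureJ g)) (mdifferentiableAt_hLift g hX)
    (mdifferentiableAt_hLift g hY)
  rw [h.connection_hLift_hLift hf hpos hX hY, h.connection_hLift_hLift hf hpos hY hX,
    mlieBracket_hLift g hX hY, ← leviCivita_sub_leviCivita g hX hY] at ht
  simp only [extend_apply_self] at ht
  rw [ht, conformalTensor_symm g f u.1 Y X]
  have hs (a b c : TangentSpace 𝓘(ℝ, E) u.1) :
      hLift g u (a + c) - hLift g u (b + c) = hLift g u (a - b) := by
    rw [sub_eq_iff_eq_add, ← hLift_add]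
    congr 1
    abel
  rw [hs]
  abel

/-- `ᴾ∇̃_ᴴY ⱽC` equals the bracket `ⱽ(∇_Y C)`, so only `-ᴾ∇̃_ⱽC ᴴY` remains. -/
lemma torsion_hLift_vLift (hf : MDiffAt f u.1) (hpos : 0 < f u.1)
    (Y : TangentSpace 𝓘(ℝ, E) u.1) (C : Tensor11 E u.1) :
    (almostProductConnection (leviCivita G) (structureJ g)).torsion u (hLift g u Y) (vLift u C) =
      -((3 / (2 * f u.1)) • hLift g u (curvatureTerm g u.1 u.2 C Y)) := by
  have hY := mdifferentiableAt_extend 𝓘(ℝ, E) E Y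
  have hC := differentiableAt_extendEnd C
  have ht := CovariantDerivative.torsion_apply
    (almostProductConnection (leviCivita G) (structureJ g)) (mdifferentiableAt_hLift g hY)
    (mdifferentiableAt_vLift hC)
  rw [h.connection_hLift_vLift hY hC, h.connection_vLift_hLift hf hpos hY hC,
    mlieBracket_hLift_vLift g hY hC] at ht
  simp only [extend_apply_self, extendEnd_self] at ht
  rw [ht]
  abel

lemma torsion_vLift_vLift (B C : Tensor11 E u.1) :
    (almostProductConnection (leviCivita G) (structureJ g)).torsion u (vLift u B) (vLift u C) = 0 := by
  have hB := differentiableAt_extendEnd B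
  have hC := differentiableAt_extendEnd C
  have ht := CovariantDerivative.torsion_apply
    (almostProductConnection (leviCivita G) (structureJ g)) (mdifferentiableAt_vLift hB)
    (mdifferentiableAt_vLift hC)
  rw [h.connection_vLift_vLift hB hC, h.connection_vLift_vLift hC hB,
    mlieBracket_vLift hB hC] at ht
  simpa only [extendEnd_self, sub_zero] using ht

theorem torsion_eq_zero_of_isFlat (hf : MDiff f) (hpos : ∀ x, 0 < f x) (hg : IsFlat g) :
    (almostProductConnection (leviCivita G) (structureJ g)).torsion = 0 := by
  funext u
  have hR (X Y : TangentSpace 𝓘(ℝ, E) u.1) : curvatureEnd g u.1 X Y = 0 := by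
    ext w
    rw [curvatureEnd_apply, hg, zero_apply]
  have h1 (X Y : TangentSpace 𝓘(ℝ, E) u.1) := h.torsion_hLift_hLift (hf u.1) (hpos u.1) X Y
  have h2 (Y : TangentSpace 𝓘(ℝ, E) u.1) (C : Tensor11 E u.1) :=
    h.torsion_hLift_vLift (hf u.1) (hpos u.1) Y C
  have hc (Y : TangentSpace 𝓘(ℝ, E) u.1) (C : Tensor11 E u.1) : curvatureTerm g u.1 u.2 C Y = 0 := by
    refine eq_of_forall_inner (g := g) fun Z ↦ ?_
    rw [inner_curvatureTerm, hR]
    simp [tensorInner]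
  simp only [hR, hc, hLift_zero, smul_zero, neg_zero, ContinuousLinearMap.comp_zero,
    ContinuousLinearMap.zero_comp, sub_zero, vLift_zero] at h1 h2
  ext ξ η
  rw [← hLift_add_vLift g ξ, ← hLift_add_vLift g η]
  simp only [ContinuousLinearMap.map_add, add_apply, h1, h2, h.torsion_vLift_vLift]
  -- The remaining mixed term has the vertical argument first.
  rw [CovariantDerivative.torsion_antisymm, h2]
  simp

theorem isFlat_of_torsion_eq_zero (hf : MDiff f) (hpos : ∀ x, 0 < f x)
    (hT : (almostProductConnection (leviCivita G) (structureJ g)).torsion = 0) : IsFlat g := by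
  intro x X Y a
  rcases eq_or_ne a 0 with rfl | ha
  · rw [← curvatureEnd_apply, map_zero]
  -- The point `t` of the fibre is arbitrary, so vanishing torsion makes `R(X, Y)` commute with
  -- every endomorphism.
  have key (t : Tensor11 E x) (c : TangentSpace 𝓘(ℝ, E) x) :
      t (curvature (leviCivita g) x X Y c) = curvature (leviCivita g) x X Y (t c) := by
    have h1 := h.torsion_hLift_hLift (u := ⟨x, t⟩) (hf x) (hpos x) X Y
    rw [hT] at h1
    have h2 : vLift (⟨x, t⟩ : T11 E M) (t ∘L curvatureEnd g x X Y - curvatureEnd g x X Y ∘L t) =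
      vLift (⟨x, t⟩ : T11 E M) 0 := by
      rw [vLift_zero]
      exact neg_eq_zero.1 h1.symm
    have h3 := congrArg (fun L : Tensor11 E x ↦ L c) (vLift_injective _ h2)
    simp only [sub_apply, ContinuousLinearMap.comp_apply, curvatureEnd_apply, zero_apply] at h3
    exact sub_eq_zero.1 h3
  -- For the rank-one endomorphism `t = g(a, ·) a`, skewness gives `t (R(X, Y) a) = g(a, R(X, Y) a)
  -- a = 0`, whereas `R(X, Y)(t a) = g(a, a) R(X, Y) a`.
  have h1 := key ((g.inner x a).smulRight a) a
  have h2 := curvature_skew g x X Y a a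
  have h3 : g.inner x a (curvature (leviCivita g) x X Y a) = 0 := by
    rw [g.symm]
    linarith
  simp only [ContinuousLinearMap.smulRight_apply, h3, zero_smul] at h1
  rw [← curvatureEnd_apply, map_smul, curvatureEnd_apply] at h1
  exact (smul_eq_zero.1 h1.symm).resolve_left (g.pos x a ha).ne'

end IsRescaledSasaki

end Final
end TensorBundle
end

/-! ### The main theorem -/

open TensorBundle
theorem mainTheorem8 {E : Type*} [NormedAddCommGroup E] [NormedSpace ℝ E] [FiniteDimensional ℝ E]
    {M : Type*} [TopologicalSpace M] [T2Space M] [SecondCountableTopology M] [ChartedSpace E M]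
    [IsManifold 𝓘(ℝ, E) ∞ M]
    (g : SmoothMetric 𝓘(ℝ, E) M) (f : M → ℝ) (hf : ContMDiff 𝓘(ℝ, E) 𝓘(ℝ, ℝ) ∞ f)
    (hpos : ∀ x, 0 < f x) :
    (∃! G : SmoothMetric (T11Model E) (T11 E M), IsRescaledSasaki g f G) ∧
    ∀ G : SmoothMetric (T11Model E) (T11 E M), IsRescaledSasaki g f G →
      (∀ (u : T11 E M) (ξ : TangentSpace (T11Model E) u),
        nablaEnd (almostProductConnection (leviCivita G) (structureJ g)) (structureJ g) u ξ = 0) ∧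
      (∀ (X Y : Π x : M, TangentSpace 𝓘(ℝ, E) x) (B C : Π x : M, Tensor11 E x),
        ContMDiff 𝓘(ℝ, E) 𝓘(ℝ, E).tangent ∞ (fun x ↦ TotalSpace.mk' E x (X x)) →
        ContMDiff 𝓘(ℝ, E) 𝓘(ℝ, E).tangent ∞ (fun x ↦ TotalSpace.mk' E x (Y x)) →
        ContMDiff 𝓘(ℝ, E) (T11Model E) ∞ (fun x ↦ (TotalSpace.mk' (E →L[ℝ] E) x (B x) : T11 E M)) →
        ContMDiff 𝓘(ℝ, E) (T11Model E) ∞ (fun x ↦ (TotalSpace.mk' (E →L[ℝ] E) x (C x) : T11 E M)) →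
        ∀ u : T11 E M,
          almostProductConnection (leviCivita G) (structureJ g)
              (fun p ↦ hLift g p (Y p.1)) u (hLift g u (X u.1)) =
            hLift g u (leviCivita g Y u.1 (X u.1)
              + (1 / (2 * f u.1)) • conformalTensor g f u.1 (X u.1) (Y u.1)) ∧
          almostProductConnection (leviCivita G) (structureJ g)
              (fun p ↦ vLift p (B p.1)) u (hLift g u (X u.1)) =
            vLift u (nablaEnd (leviCivita g) B u.1 (X u.1)) ∧
          almostProductConnection (leviCivita G) (structureJ g)
              (fun p ↦ hLift g p (Y p.1)) u (vLift u (C u.1)) =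
            (3 / (2 * f u.1)) • hLift g u (curvatureTerm g u.1 u.2 (C u.1) (Y u.1)) ∧
          almostProductConnection (leviCivita G) (structureJ g)
              (fun p ↦ vLift p (B p.1)) u (vLift u (C u.1)) = 0) ∧
      ((almostProductConnection (leviCivita G) (structureJ g)).torsion = 0 ↔ IsFlat g) := by

  have hd : MDiff f := hf.mdifferentiable (by simp)
  refine ⟨⟨sasakiMetric g f hf hpos, isRescaledSasaki_sasakiMetric g f hf hpos,
    fun G hG ↦ IsRescaledSasaki.unique g f hG (isRescaledSasaki_sasakiMetric g f hf hpos)⟩,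
    fun G h ↦ ⟨fun u ξ ↦ nablaEnd_almostProductConnection g G ξ, ?_,
      h.isFlat_of_torsion_eq_zero hd hpos, h.torsion_eq_zero_of_isFlat hd hpos⟩⟩
  intro X Y B C hX hY hB hC u
  have hX' := hX.mdifferentiableAt (x := u.1) (by simp)
  have hY' := hY.mdifferentiableAt (x := u.1) (by simp)
  have hB' := (mdifferentiableAt_T11_section_iff B (mem_chart_source E u.1)).1
    (hB.mdifferentiableAt (by simp))
  have hC' := (mdifferentiableAt_T11_section_iff C (mem_chart_source E u.1)).1
    (hC.mdifferentiableAt (by simp))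
  exact ⟨h.connection_hLift_hLift (hd u.1) (hpos u.1) hX' hY', h.connection_hLift_vLift hX' hB',
    h.connection_vLift_hLift (hd u.1) (hpos u.1) hY' hC', h.connection_vLift_vLift hB' hC'⟩
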